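/- Let $G$ be a Lie groupoid over a smooth manifold $M$ (Hausdorff and second countable; the manifold of arrows, also denoted $G$, need not be Hausdorff; $M$ and $G$ have constant dimension), with source $s$ and target $t$. **Conventions.** For an abelian Lie group $A$ (written multiplicatively), $H^1_{\mathrm{diff}}(G,A)$ is the group of smooth functions $c:G\to A$ with $c(gh)=c(g)c(h)$ for all composable $g,h$, modulo those of the form $c(g)=f(s(g))/f(t(g))$ with $f:M\to A$ smooth; $H^1_{\mathrm{diff}}(G)$ is the real vector space obtained for the additive group $A=\mathbb R$; $\mathbb Z_2=\{\pm1\}$. A 1-dimensional representation of $G$ is a smooth real line bundle $L\to M$ with a smooth linear action of $G$, an arrow $g:x\to y$ acting as a map $L_x\to L_y$; $\mathrm{Rep}^1(G)$ is the group of isomorphism classes of such representations, with the tensor product. If $\sigma$ is a nowhere vanishing smooth section of $L$, then $g\cdot\sigma(s(g))=\tilde c_\sigma(g)\,\sigma(t(g))$ defines a cocycle $\tilde c_\sigma:G\to\mathbb R^*$. For an open cover $\mathcal U$ of $M$, $G_{\mathcal U}$ is the pull-back of $G$ along the canonical map $\coprod_{U\in\mathcal U}U\to M$, which is a Lie groupoid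 over $\coprod_{U\in\mathcal U}U$, and $L_{\mathcal U}$ is the representation of $G_{\mathcal U}$ obtained by pulling back $L$. Put $$\check H^1_{\mathrm{diff}}(G,A)=\varinjlim_{\mathcal U}H^1_{\mathrm{diff}}(G_{\mathcal U},A),$$ the filtered colimit over the open covers of $M$ with respect to refinement. **Statement.** 1. For every open cover $\mathcal U$ of $M$, the pull-back map $H^1_{\mathrm{diff}}(G)\to H^1_{\mathrm{diff}}(G_{\mathcal U})$ is an isomorphism. 2. For every 1-dimensional representation $L$ of $G$ there is an open cover $\mathcal U$ such that $L_{\mathcal U}$ has a nowhere vanishing smooth section, and $L\otimes L$ has a nowhere vanishing smooth section on $M$. The following classes are well defined, i.e. they depend only on the isomorphism class of $L$ and not on the choices of covers and sections: * $\check\theta_G(L)\in\check H^1_{\mathrm{diff}}(G,\mathbb R^*)$, the class of $[\tilde c_\sigma]\in H^1_{\mathrm{diff}}(G_{\mathcal U},\mathbb R^*)$, for any open cover $\mathcal U$ and any nowhere vanishing smooth section $\sigma$ of $L_{\mathcal U}$; * $w(L)\in\check H^1_{\mathrm{diff}}(G,\mathbb Z_2)$, the class of $[\mathrm{sign}\circ\tilde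 c_\sigma]\in H^1_{\mathrm{diff}}(G_{\mathcal U},\mathbb Z_2)$, for the same $\mathcal U$ and $\sigma$; * $\theta_G(L)\in H^1_{\mathrm{diff}}(G)$, equal to $[\ln|\tilde c_\sigma|]$ for any nowhere vanishing smooth section $\sigma$ of $L$ if there is one, and to $\tfrac12\theta_G(L\otimes L)$ for every $L$. 3. The map $\check\theta_G$ is an isomorphism of groups $$\check\theta_G:\mathrm{Rep}^1(G)\xrightarrow{\ \sim\ }\check H^1_{\mathrm{diff}}(G,\mathbb R^*).$$ 4. There is an isomorphism of groups $$\Phi:\check H^1_{\mathrm{diff}}(G,\mathbb R^*)\xrightarrow{\ \sim\ }H^1_{\mathrm{diff}}(G)\times\check H^1_{\mathrm{diff}}(G,\mathbb Z_2),$$ induced by $\mathbb R^*\cong\mathbb R\times\mathbb Z_2$, $\lambda\mapsto(\ln|\lambda|,\mathrm{sign}(\lambda))$, and the isomorphisms of 1: for every open cover $\mathcal U$ and every $[c]\in H^1_{\mathrm{diff}}(G_{\mathcal U},\mathbb R^*)$, the first component of $\Phi([c])$ is the class in $H^1_{\mathrm{diff}}(G)$ whose pull-back to $G_{\mathcal U}$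 is $[\ln|c|]$, and the second component is the class of $[\mathrm{sign}\circ c]$. 5. For every 1-dimensional representation $L$ of $G$, $\Phi(\check\theta_G(L))=(\theta_G(L),w(L))$. -/

import Mathlib

open Bundle TopologicalSpace Set
open scoped Manifold ContDiff Topology TensorProduct

universe u v w u' v' w'

noncomputable section

/-! ### Disjoint unions of open subsets of a manifold -/

/-- The disjoint union of a family of open subsets of a topological space, with the disjoint
union topology. -/
def DisjUnion {X : Type u} [TopologicalSpace X] {ι : Type v} (O : ι → Opens X) : Type (max u v) :=
  Σ i, O i

namespace DisjUnion

variable {X : Type u} [TopologicalSpace X] {ι : Type v} {O : ι → Opens X}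

instance : TopologicalSpace (DisjUnion O) := inferInstanceAs (TopologicalSpace (Σ i, O i))

/-- The canonical map of the disjoint union to the ambient space. -/
def val (p : DisjUnion O) : X := p.2.1

/-- The index of the summand in which a point lies. -/
def idx (p : DisjUnion O) : ι := p.1

/-- The point `x`, regarded as a point of the summand of index `i`. -/
def mk (i : ι) (x : X) (hx : x ∈ O i) : DisjUnion O := ⟨i, x, hx⟩

@[simp] theorem val_mk (i : ι) (x : X) (hx : x ∈ O i) : val (mk i x hx : DisjUnion O) = x := rfl
@[simp] theorem idx_mk (i : ι) (x : X) (hx : x ∈ O i) : idx (mk i x hx : DisjUnion O) = i := rfl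

theorem val_mem (p : DisjUnion O) : p.val ∈ O p.idx := p.2.2

theorem ext' {p q : DisjUnion O} (h₁ : p.idx = q.idx) (h₂ : p.val = q.val) : p = q := by
  obtain ⟨i, x, hx⟩ := p
  obtain ⟨j, y, hy⟩ := q
  change i = j at h₁
  change x = y at h₂
  subst h₁ h₂
  rfl

theorem continuous_val : Continuous (val : DisjUnion O → X) :=
  continuous_sigma fun _ => continuous_subtype_val

theorem isOpenMap_val : IsOpenMap (val : DisjUnion O → X) :=
  isOpenMap_sigma.2 fun i => (O i).isOpen.isOpenMap_subtype_val

theorem isOpen_idx_eq (i : ι) : IsOpen {q : DisjUnion O | q.idx = i} := by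
  refine isOpen_sigma_iff.2 fun j => ?_
  by_cases h : j = i
  · convert isOpen_univ
    exact eq_univ_of_forall fun _ => h
  · convert isOpen_empty
    exact eq_empty_of_forall_notMem fun _ => h

theorem eventually_idx (p : DisjUnion O) : ∀ᶠ q in 𝓝 p, q.idx = p.idx :=
  (isOpen_idx_eq p.idx).mem_nhds rfl

theorem isLocalHomeomorph_val : IsLocalHomeomorph (val : DisjUnion O → X) := by
  rw [isLocalHomeomorph_iff_isOpenEmbedding_restrict]
  intro p
  refine ⟨_, eventually_idx p, ?_⟩
  refine .of_continuous_injective_isOpenMap (continuous_val.comp continuous_subtype_val) ?_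
    (isOpenMap_val.domRestrict (isOpen_idx_eq p.idx))
  rintro ⟨q, hq⟩ ⟨q', hq'⟩ hqq
  exact Subtype.ext (ext' (Eq.trans hq (Eq.symm hq')) hqq)

theorem continuousWithinAt_iff {Y : Type*} [TopologicalSpace Y] {f : Y → DisjUnion O} {s : Set Y}
    {y : Y} : ContinuousWithinAt f s y ↔
      ContinuousWithinAt (val ∘ f) s y ∧ ∀ᶠ y' in 𝓝[s] y, (f y').idx = (f y).idx := by
  constructor
  · intro h
    exact ⟨continuous_val.continuousAt.comp_continuousWithinAt h,
      h.eventually (eventually_idx (f y))⟩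
  · rintro ⟨h₁, h₂⟩
    rw [ContinuousWithinAt, Filter.tendsto_def]
    intro t ht
    have ht' : val '' (t ∩ {q : DisjUnion O | q.idx = (f y).idx}) ∈ 𝓝 ((f y).val) :=
      isOpenMap_val.image_mem_nhds (Filter.inter_mem ht (eventually_idx (f y)))
    filter_upwards [h₁ ht', h₂] with y' hy₁ hy₂
    obtain ⟨q, ⟨hq, hz⟩, hqy⟩ := hy₁
    have : f y' = q := ext' (hy₂.trans (Eq.symm hz)) hqy.symm
    change f y' ∈ t
    rw [this]
    exact hq

variable {H : Type*} [TopologicalSpace H] {E : Type*} [NormedAddCommGroup E] [NormedSpace ℝ E]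
  {I : ModelWithCorners ℝ E H}

theorem compatible_aux (f f' : OpenPartialHomeomorph (DisjUnion O) X) (hf : val = f)
    (hf' : val = f') (c c' : OpenPartialHomeomorph X H)
    (hc : c.symm ≫ₕ c' ∈ contDiffGroupoid ∞ I) :
    (f ≫ₕ c).symm ≫ₕ (f' ≫ₕ c') ∈ contDiffGroupoid ∞ I := by
  set e := (f ≫ₕ c).symm ≫ₕ (f' ≫ₕ c') with he
  have hS : IsOpen e.source := e.open_source
  have key : ∀ y ∈ e.source, f' (f.symm (c.symm y)) = c.symm y := by
    intro y hy
    simp only [he, mfld_simps] at hy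
    rw [← hf', hf, f.right_inv hy.1.2]
  have hsub : e.source ⊆ (c.symm ≫ₕ c').source := by
    intro y hy
    have hk := key y hy
    simp only [he, mfld_simps] at hy ⊢
    rw [hk] at hy
    exact ⟨hy.1.1, hy.2.2⟩
  refine (contDiffGroupoid ∞ I).mem_of_eqOnSource
    (closedUnderRestriction' hc hS) ⟨?_, ?_⟩
  · rw [OpenPartialHomeomorph.restr_source' _ _ hS, inter_eq_right.2 hsub]
  · intro y hy
    simp only [OpenPartialHomeomorph.restr_apply, he, OpenPartialHomeomorph.coe_trans,
      OpenPartialHomeomorph.trans_symm_eq_symm_trans_symm, Function.comp_apply]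
    rw [key y hy]

variable [ChartedSpace H X]

/-- The charts of the disjoint union are the charts of the ambient space, precomposed with
local inverses of the inclusions of the summands. -/
instance : ChartedSpace H (DisjUnion O) where
  atlas := {e | ∃ f : OpenPartialHomeomorph (DisjUnion O) X, val = f ∧
    ∃ c ∈ atlas H X, e = f ≫ₕ c}
  chartAt p := (isLocalHomeomorph_val p).choose ≫ₕ chartAt H p.val
  mem_chart_source p := by
    have h := (isLocalHomeomorph_val p).choose_spec
    rw [OpenPartialHomeomorph.trans_source]
    refine ⟨h.1, ?_⟩
    rw [mem_preimage, ← h.2]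
    exact mem_chart_source H p.val
  chart_mem_atlas p :=
    ⟨_, (isLocalHomeomorph_val p).choose_spec.2, _, chart_mem_atlas H p.val, rfl⟩

instance [IsManifold I ∞ X] : IsManifold I ∞ (DisjUnion O) where
  compatible := by
    rintro _ _ ⟨f, hf, c, hc, rfl⟩ ⟨f', hf', c', hc', rfl⟩
    exact compatible_aux f f' hf hf' c c' (HasGroupoid.compatible hc hc')

theorem mem_maximalAtlas [IsManifold I ∞ X] (f : OpenPartialHomeomorph (DisjUnion O) X)
    (hf : val = f) (c : OpenPartialHomeomorph X H) (hc : c ∈ IsManifold.maximalAtlas I ∞ X) :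
    f ≫ₕ c ∈ IsManifold.maximalAtlas I ∞ (DisjUnion O) := by
  rw [IsManifold.maximalAtlas, mem_maximalAtlas_iff]
  rintro _ ⟨f', hf', c', hc', rfl⟩
  have h := mem_maximalAtlas_iff.1 hc c' hc'
  exact ⟨compatible_aux f f' hf hf' c c' h.1, compatible_aux f' f hf' hf c' c h.2⟩

variable {Y : Type*} [TopologicalSpace Y] {H' : Type*} [TopologicalSpace H'] [ChartedSpace H' Y]
  {E' : Type*} [NormedAddCommGroup E'] [NormedSpace ℝ E'] {I' : ModelWithCorners ℝ E' H'}

/-- A map to the disjoint union is smooth iff it is smooth as a map to the ambient space and the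
index is locally constant. -/
theorem contMDiffWithinAt_iff {f : Y → DisjUnion O} {s : Set Y} {y : Y} :
    ContMDiffWithinAt I' I ∞ f s y ↔
      ContMDiffWithinAt I' I ∞ (val ∘ f) s y ∧ ∀ᶠ y' in 𝓝[s] y, (f y').idx = (f y).idx := by
  have hcd : ∀ q : DisjUnion O, (extChartAt I q : DisjUnion O → E) = extChartAt I q.val ∘ val := by
    intro q
    have h := (isLocalHomeomorph_val q).choose_spec.2
    have : (chartAt H q : DisjUnion O → H) = chartAt H q.val ∘ val := by
      change ((isLocalHomeomorph_val q).choose ≫ₕ chartAt H q.val : DisjUnion O → H) = _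
      rw [OpenPartialHomeomorph.coe_trans, ← h]
    ext1 z
    simp [extChartAt, this]
  rw [_root_.contMDiffWithinAt_iff, _root_.contMDiffWithinAt_iff, continuousWithinAt_iff]
  have : (extChartAt I (f y) ∘ f ∘ (extChartAt I' y).symm) =
      (extChartAt I ((val ∘ f) y) ∘ (val ∘ f) ∘ (extChartAt I' y).symm) := by
    rw [hcd]; rfl
  rw [this]
  tauto

theorem contMDiff_iff {f : Y → DisjUnion O} :
    ContMDiff I' I ∞ f ↔
      ContMDiff I' I ∞ (val ∘ f) ∧ ∀ y, ∀ᶠ y' in 𝓝 y, (f y').idx = (f y).idx := by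
  simp only [ContMDiff, ← contMDiffWithinAt_univ, contMDiffWithinAt_iff, nhdsWithin_univ,
    forall_and]

theorem contMDiff_val : ContMDiff I I ∞ (val : DisjUnion O → X) :=
  (contMDiff_iff.1 (contMDiff_id (M := DisjUnion O))).1

end DisjUnion

/-! ### Lie groupoids -/

/-- A Lie groupoid over the `n`-dimensional manifold `M`, with `m`-dimensional manifold of arrows
`G` (not assumed to be Hausdorff). An arrow `g` goes from `src g` to `tgt g`, and `mul g h` is the
composition `g ∘ h`; only its values on composable pairs, `src g = tgt h`, are meaningful. The
space of composable pairs is an embedded submanifold of `G × G`, so that smoothness of the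
multiplication is smoothness on this subset. -/
structure LieGroupoid (n m : ℕ) (M : Type u) (G : Type w)
    [TopologicalSpace M] [ChartedSpace (EuclideanSpace ℝ (Fin n)) M]
    [TopologicalSpace G] [ChartedSpace (EuclideanSpace ℝ (Fin m)) G] where
  src : C^∞⟮𝓡 m, G; 𝓡 n, M⟯
  tgt : C^∞⟮𝓡 m, G; 𝓡 n, M⟯
  one : C^∞⟮𝓡 n, M; 𝓡 m, G⟯
  inv : C^∞⟮𝓡 m, G; 𝓡 m, G⟯
  mul : G → G → G
  src_one : ∀ x, src (one x) = x
  tgt_one : ∀ x, tgt (one x) = x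
  src_inv : ∀ g, src (inv g) = tgt g
  tgt_inv : ∀ g, tgt (inv g) = src g
  src_mul : ∀ g h, src g = tgt h → src (mul g h) = src h
  tgt_mul : ∀ g h, src g = tgt h → tgt (mul g h) = tgt g
  mul_assoc : ∀ g h k, src g = tgt h → src h = tgt k → mul (mul g h) k = mul g (mul h k)
  one_mul : ∀ g, mul (one (tgt g)) g = g
  mul_one : ∀ g, mul g (one (src g)) = g
  inv_mul : ∀ g, mul (inv g) g = one (src g)
  mul_inv : ∀ g, mul g (inv g) = one (tgt g)
  isSubmersion_src : Manifold.IsSubmersion (𝓡 m) (𝓡 n) ∞ src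
  contMDiffOn_mul : ContMDiffOn ((𝓡 m).prod (𝓡 m)) (𝓡 m) ∞ (fun p : G × G => mul p.1 p.2)
    {p | src p.1 = tgt p.2}

namespace LieGroupoid

variable {n m : ℕ} {M : Type u} {G : Type w}
  [TopologicalSpace M] [ChartedSpace (EuclideanSpace ℝ (Fin n)) M]
  [TopologicalSpace G] [ChartedSpace (EuclideanSpace ℝ (Fin m)) G]
  {n' m' : ℕ} {M' : Type u'} {G' : Type w'}
  [TopologicalSpace M'] [ChartedSpace (EuclideanSpace ℝ (Fin n')) M']
  [TopologicalSpace G'] [ChartedSpace (EuclideanSpace ℝ (Fin m')) G']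

/-- The arrows of a Lie groupoid from `x` to `y`. -/
def Arrow (𝒢 : LieGroupoid n m M G) (x y : M) : Type w := {g : G // 𝒢.src g = x ∧ 𝒢.tgt g = y}

/-- An element of `G`, as an arrow from its source to its target. -/
def arrow (𝒢 : LieGroupoid n m M G) (g : G) : 𝒢.Arrow (𝒢.src g) (𝒢.tgt g) := ⟨g, rfl, rfl⟩

/-- The unit arrow at `x`. -/
def unit (𝒢 : LieGroupoid n m M G) (x : M) : 𝒢.Arrow x x := ⟨𝒢.one x, 𝒢.src_one x, 𝒢.tgt_one x⟩

/-- Composition of arrows. -/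
def Arrow.comp {𝒢 : LieGroupoid n m M G} {x y z : M} (g : 𝒢.Arrow y z) (h : 𝒢.Arrow x y) :
    𝒢.Arrow x z :=
  ⟨𝒢.mul g.1 h.1, (𝒢.src_mul _ _ (g.2.1.trans h.2.2.symm)).trans h.2.1,
    (𝒢.tgt_mul _ _ (g.2.1.trans h.2.2.symm)).trans g.2.2⟩

/-- A morphism of Lie groupoids: a smooth functor. -/
structure Hom (𝒢' : LieGroupoid n' m' M' G') (𝒢 : LieGroupoid n m M G) where
  base : C^∞⟮𝓡 n', M'; 𝓡 n, M⟯
  arr : C^∞⟮𝓡 m', G'; 𝓡 m, G⟯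
  src_arr : ∀ g, 𝒢.src (arr g) = base (𝒢'.src g)
  tgt_arr : ∀ g, 𝒢.tgt (arr g) = base (𝒢'.tgt g)
  arr_one : ∀ x, arr (𝒢'.one x) = 𝒢.one (base x)
  arr_mul : ∀ g h, 𝒢'.src g = 𝒢'.tgt h → arr (𝒢'.mul g h) = 𝒢.mul (arr g) (arr h)

/-- The action of a morphism of Lie groupoids on arrows. -/
def Hom.map {𝒢' : LieGroupoid n' m' M' G'} {𝒢 : LieGroupoid n m M G} (Φ : 𝒢'.Hom 𝒢) {x y : M'}
    (g : 𝒢'.Arrow x y) : 𝒢.Arrow (Φ.base x) (Φ.base y) :=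
  ⟨Φ.arr g.1, by rw [Φ.src_arr, g.2.1], by rw [Φ.tgt_arr, g.2.2]⟩

end LieGroupoid

/-! ### Open covers and the pull-back of a Lie groupoid along an open cover -/

/-- An open cover of `M`. -/
structure OpenCover (M : Type u) [TopologicalSpace M] where
  carrier : Set (Opens M)
  covers : ∀ x, ∃ U ∈ carrier, x ∈ U

namespace OpenCover

variable {M : Type u} [TopologicalSpace M]

/-- Open covers are ordered by refinement: `𝒰 ≤ 𝒱` iff `𝒱` is finer than `𝒰`, i.e., every member
of `𝒱` is contained in a member of `𝒰`. -/
instance : Preorder (OpenCover M) where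
  le 𝒰 𝒱 := ∀ V ∈ 𝒱.carrier, ∃ U ∈ 𝒰.carrier, V ≤ U
  le_refl 𝒰 V hV := ⟨V, hV, le_rfl⟩
  le_trans 𝒰 𝒱 𝒲 h₁ h₂ W hW := by
    obtain ⟨V, hV, hWV⟩ := h₂ W hW
    obtain ⟨U, hU, hVU⟩ := h₁ V hV
    exact ⟨U, hU, hWV.trans hVU⟩

instance : Nonempty (OpenCover M) := ⟨⟨{⊤}, fun _ => ⟨⊤, rfl, trivial⟩⟩⟩

instance : IsDirectedOrder (OpenCover M) where
  directed 𝒰 𝒱 := by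
    refine ⟨⟨{W | ∃ U ∈ 𝒰.carrier, ∃ V ∈ 𝒱.carrier, W = U ⊓ V}, fun x => ?_⟩, ?_, ?_⟩
    · obtain ⟨U, hU, hx⟩ := 𝒰.covers x
      obtain ⟨V, hV, hx'⟩ := 𝒱.covers x
      exact ⟨U ⊓ V, ⟨U, hU, V, hV, rfl⟩, hx, hx'⟩
    · rintro _ ⟨U, hU, V, hV, rfl⟩
      exact ⟨U, hU, inf_le_left⟩
    · rintro _ ⟨U, hU, V, hV, rfl⟩
      exact ⟨V, hV, inf_le_right⟩

/-- The disjoint union of the members of an open cover. -/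
abbrev Space (𝒰 : OpenCover M) : Type u := DisjUnion (fun U : 𝒰.carrier => U.1)

end OpenCover

namespace LieGroupoid

variable {n m : ℕ} {M : Type u} {G : Type w}
  [TopologicalSpace M] [ChartedSpace (EuclideanSpace ℝ (Fin n)) M]
  [TopologicalSpace G] [ChartedSpace (EuclideanSpace ℝ (Fin m)) G]

/-- The open set of arrows of `𝒢` from a point of `U` to a point of `V`. -/
def arrowOpens (𝒢 : LieGroupoid n m M G) (U V : Opens M) : Opens G where
  carrier := {g | 𝒢.src g ∈ U ∧ 𝒢.tgt g ∈ V}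
  is_open' := (U.isOpen.preimage 𝒢.src.contMDiff.continuous).inter
    (V.isOpen.preimage 𝒢.tgt.contMDiff.continuous)

/-- The space of arrows of the pull-back of `𝒢` to the disjoint union of the members of an open
cover: the triples `(U, g, V)` with `g` an arrow from a point of `U` to a point of `V`. -/
abbrev CoverArrows (𝒢 : LieGroupoid n m M G) (𝒰 : OpenCover M) : Type (max u w) :=
  DisjUnion (fun UV : 𝒰.carrier × 𝒰.carrier => 𝒢.arrowOpens UV.1 UV.2)

variable (𝒢 : LieGroupoid n m M G) (𝒰 : OpenCover M)

theorem CoverArrows.src_mem (a : 𝒢.CoverArrows 𝒰) : 𝒢.src a.val ∈ (a.idx.1 : Opens M) :=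
  a.val_mem.1

theorem CoverArrows.tgt_mem (a : 𝒢.CoverArrows 𝒰) : 𝒢.tgt a.val ∈ (a.idx.2 : Opens M) :=
  a.val_mem.2

theorem isSubmersion_lift {O : Type*} {O' : Type*} {A : O → Opens G} {B : O' → Opens M}
    [IsManifold (𝓡 n) ∞ M] [IsManifold (𝓡 m) ∞ G]
    (f : DisjUnion A → DisjUnion B) (f₀ : G → M)
    (hf : Continuous f) (hff : ∀ a, (f a).val = f₀ a.val)
    (h₀ : Manifold.IsSubmersion (𝓡 m) (𝓡 n) ∞ f₀) : Manifold.IsSubmersion (𝓡 m) (𝓡 n) ∞ f := by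
  obtain ⟨F, i₁, i₂, h⟩ := h₀
  refine ⟨F, i₁, i₂, fun a => ?_⟩
  have ha := h a.val
  obtain ⟨p, hp⟩ := DisjUnion.isLocalHomeomorph_val a
  obtain ⟨q, hq⟩ := DisjUnion.isLocalHomeomorph_val (f a)
  refine .mk_of_continuousAt hf.continuousAt ha.equiv (p ≫ₕ ha.domChart) (q ≫ₕ ha.codChart)
    ?_ ?_ (DisjUnion.mem_maximalAtlas p hp.2 _ ha.domChart_mem_maximalAtlas)
    (DisjUnion.mem_maximalAtlas q hq.2 _ ha.codChart_mem_maximalAtlas) ?_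
  · rw [OpenPartialHomeomorph.trans_source]
    refine ⟨hp.1, ?_⟩
    rw [mem_preimage, ← hp.2]
    exact ha.mem_domChart_source
  · rw [OpenPartialHomeomorph.trans_source]
    refine ⟨hq.1, ?_⟩
    rw [mem_preimage, ← hq.2, hff]
    exact ha.mem_codChart_source
  · intro y hy
    have hy' : y ∈ (ha.domChart.extend (𝓡 m)).target ∧
        (ha.domChart.extend (𝓡 m)).symm y ∈ p.target := by
      simp only [mfld_simps] at hy ⊢
      tauto
    rw [← ha.writtenInCharts hy'.1]
    have hr : (p (p.symm ((ha.domChart.extend (𝓡 m)).symm y))) =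
      (ha.domChart.extend (𝓡 m)).symm y := p.right_inv hy'.2
    refine congrArg (ha.codChart.extend (𝓡 n)) (?_ : q (f (p.symm _)) = f₀ _)
    rw [← hq.2, hff]
    exact congrArg f₀ ((congrFun hp.2 _).trans hr)

open Classical in
/-- The composition of arrows of the pull-back (with a junk value on pairs that are not
composable). -/
def coverMul (a b : 𝒢.CoverArrows 𝒰) : 𝒢.CoverArrows 𝒰 :=
  if h : 𝒢.src a.val = 𝒢.tgt b.val then
    .mk (b.idx.1, a.idx.2) (𝒢.mul a.val b.val)
      ⟨by rw [𝒢.src_mul _ _ h]; exact CoverArrows.src_mem 𝒢 𝒰 b,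
        by rw [𝒢.tgt_mul _ _ h]; exact CoverArrows.tgt_mem 𝒢 𝒰 a⟩
  else a

variable {𝒰} in
theorem val_coverMul {a b : 𝒢.CoverArrows 𝒰} (h : 𝒢.src a.val = 𝒢.tgt b.val) :
    (𝒢.coverMul 𝒰 a b).val = 𝒢.mul a.val b.val := by
  rw [coverMul, dif_pos h]; rfl

variable {𝒰} in
theorem idx_coverMul {a b : 𝒢.CoverArrows 𝒰} (h : 𝒢.src a.val = 𝒢.tgt b.val) :
    (𝒢.coverMul 𝒰 a b).idx = (b.idx.1, a.idx.2) := by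
  rw [coverMul, dif_pos h]; rfl

/-- The pull-back of a Lie groupoid over `M` along the canonical map to `M` from the disjoint union
of the members of an open cover of `M`: the arrows from the copy of `x` in `U` to the copy of `y`
in `V` are the arrows from `x` to `y`. -/
def cover [IsManifold (𝓡 n) ∞ M] [IsManifold (𝓡 m) ∞ G] :
    LieGroupoid n m 𝒰.Space (𝒢.CoverArrows 𝒰) where
  src := ⟨fun a => .mk a.idx.1 (𝒢.src a.val) (CoverArrows.src_mem 𝒢 𝒰 a),
    DisjUnion.contMDiff_iff.2 ⟨𝒢.src.contMDiff.comp DisjUnion.contMDiff_val, fun a =>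
      (DisjUnion.eventually_idx a).mono fun b hb => congrArg Prod.fst hb⟩⟩
  tgt := ⟨fun a => .mk a.idx.2 (𝒢.tgt a.val) (CoverArrows.tgt_mem 𝒢 𝒰 a),
    DisjUnion.contMDiff_iff.2 ⟨𝒢.tgt.contMDiff.comp DisjUnion.contMDiff_val, fun a =>
      (DisjUnion.eventually_idx a).mono fun b hb => congrArg Prod.snd hb⟩⟩
  one := ⟨fun x => .mk (x.idx, x.idx) (𝒢.one x.val)
      ⟨by rw [𝒢.src_one]; exact x.val_mem, by rw [𝒢.tgt_one]; exact x.val_mem⟩,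
    DisjUnion.contMDiff_iff.2 ⟨𝒢.one.contMDiff.comp DisjUnion.contMDiff_val, fun a =>
      (DisjUnion.eventually_idx a).mono fun b hb => congrArg (fun i => (i, i)) hb⟩⟩
  inv := ⟨fun a => .mk (a.idx.2, a.idx.1) (𝒢.inv a.val)
      ⟨by rw [𝒢.src_inv]; exact CoverArrows.tgt_mem 𝒢 𝒰 a,
        by rw [𝒢.tgt_inv]; exact CoverArrows.src_mem 𝒢 𝒰 a⟩,
    DisjUnion.contMDiff_iff.2 ⟨𝒢.inv.contMDiff.comp DisjUnion.contMDiff_val, fun a =>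
      (DisjUnion.eventually_idx a).mono fun b hb => congrArg Prod.swap hb⟩⟩
  mul := 𝒢.coverMul 𝒰
  src_one x := DisjUnion.ext' rfl (𝒢.src_one _)
  tgt_one x := DisjUnion.ext' rfl (𝒢.tgt_one _)
  src_inv a := DisjUnion.ext' rfl (𝒢.src_inv _)
  tgt_inv a := DisjUnion.ext' rfl (𝒢.tgt_inv _)
  src_mul a b h := by
    have h' : 𝒢.src a.val = 𝒢.tgt b.val := congrArg DisjUnion.val h
    have hi := congrArg Prod.fst (𝒢.idx_coverMul h')
    refine DisjUnion.ext' hi ?_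
    exact (congrArg 𝒢.src (𝒢.val_coverMul h')).trans (𝒢.src_mul _ _ h')
  tgt_mul a b h := by
    have h' : 𝒢.src a.val = 𝒢.tgt b.val := congrArg DisjUnion.val h
    have hi := congrArg Prod.snd (𝒢.idx_coverMul h')
    refine DisjUnion.ext' hi ?_
    exact (congrArg 𝒢.tgt (𝒢.val_coverMul h')).trans (𝒢.tgt_mul _ _ h')
  mul_assoc a b c h₁ h₂ := by
    have h₁' : 𝒢.src a.val = 𝒢.tgt b.val := congrArg DisjUnion.val h₁
    have h₂' : 𝒢.src b.val = 𝒢.tgt c.val := congrArg DisjUnion.val h₂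
    have h₃ : 𝒢.src (𝒢.coverMul 𝒰 a b).val = 𝒢.tgt c.val := by
      rw [𝒢.val_coverMul h₁', 𝒢.src_mul _ _ h₁', h₂']
    have h₄ : 𝒢.src a.val = 𝒢.tgt (𝒢.coverMul 𝒰 b c).val := by
      rw [𝒢.val_coverMul h₂', 𝒢.tgt_mul _ _ h₂', h₁']
    refine DisjUnion.ext' ?_ ?_
    · rw [𝒢.idx_coverMul h₃, 𝒢.idx_coverMul h₄, 𝒢.idx_coverMul h₁', 𝒢.idx_coverMul h₂']
    · rw [𝒢.val_coverMul h₃, 𝒢.val_coverMul h₄, 𝒢.val_coverMul h₁', 𝒢.val_coverMul h₂',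
        𝒢.mul_assoc _ _ _ h₁' h₂']
  one_mul a := by
    have h : 𝒢.src (𝒢.one (𝒢.tgt a.val)) = 𝒢.tgt a.val := 𝒢.src_one _
    refine DisjUnion.ext' (𝒢.idx_coverMul h) (Eq.trans (𝒢.val_coverMul ?_) (𝒢.one_mul _))
    exact h
  mul_one a := by
    have h : 𝒢.src a.val = 𝒢.tgt (𝒢.one (𝒢.src a.val)) := (𝒢.tgt_one _).symm
    refine DisjUnion.ext' (𝒢.idx_coverMul h) (Eq.trans (𝒢.val_coverMul ?_) (𝒢.mul_one _))
    exact h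
  inv_mul a := by
    have h : 𝒢.src (𝒢.inv a.val) = 𝒢.tgt a.val := 𝒢.src_inv _
    refine DisjUnion.ext' (𝒢.idx_coverMul h) (Eq.trans (𝒢.val_coverMul ?_) (𝒢.inv_mul _))
    exact h
  mul_inv a := by
    have h : 𝒢.src a.val = 𝒢.tgt (𝒢.inv a.val) := (𝒢.tgt_inv _).symm
    refine DisjUnion.ext' (𝒢.idx_coverMul h) (Eq.trans (𝒢.val_coverMul ?_) (𝒢.mul_inv _))
    exact h
  isSubmersion_src := by
    refine isSubmersion_lift _ 𝒢.src ?_ (fun _ => rfl) 𝒢.isSubmersion_src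
    exact ContMDiff.continuous (I := 𝓡 m) (I' := 𝓡 n) (n := ∞)
      (DisjUnion.contMDiff_iff.2 ⟨𝒢.src.contMDiff.comp DisjUnion.contMDiff_val, fun a =>
        (DisjUnion.eventually_idx a).mono fun b hb => congrArg Prod.fst hb⟩)
  contMDiffOn_mul := by
    rintro ⟨a, b⟩ hab
    have hab' : 𝒢.src a.val = 𝒢.tgt b.val := congrArg DisjUnion.val hab
    refine DisjUnion.contMDiffWithinAt_iff.2 ⟨?_, ?_⟩
    · have h₁ : ContMDiffWithinAt ((𝓡 m).prod (𝓡 m)) (𝓡 m) ∞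
          (fun p : 𝒢.CoverArrows 𝒰 × 𝒢.CoverArrows 𝒰 => 𝒢.mul p.1.val p.2.val)
          {p | 𝒢.src p.1.val = 𝒢.tgt p.2.val} (a, b) :=
        (𝒢.contMDiffOn_mul (a.val, b.val) hab').comp (a, b)
          (((DisjUnion.contMDiff_val.comp contMDiff_fst).prodMk
            (DisjUnion.contMDiff_val.comp contMDiff_snd)).contMDiffAt.contMDiffWithinAt)
          (fun _ h => h)
      refine (h₁.mono ?_).congr (fun p hp => ?_) ?_
      · intro p hp
        exact congrArg DisjUnion.val hp
      · exact 𝒢.val_coverMul (congrArg DisjUnion.val hp)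
      · exact 𝒢.val_coverMul hab'
    · have h₁ : ∀ᶠ p : 𝒢.CoverArrows 𝒰 × 𝒢.CoverArrows 𝒰 in 𝓝 (a, b), p.1.idx = a.idx :=
        (continuous_fst.tendsto (a, b)).eventually (DisjUnion.eventually_idx a)
      have h₂ : ∀ᶠ p : 𝒢.CoverArrows 𝒰 × 𝒢.CoverArrows 𝒰 in 𝓝 (a, b), p.2.idx = b.idx :=
        (continuous_snd.tendsto (a, b)).eventually (DisjUnion.eventually_idx b)
      filter_upwards [nhdsWithin_le_nhds h₁, nhdsWithin_le_nhds h₂, self_mem_nhdsWithin]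
        with p hp₁ hp₂ hp
      exact (𝒢.idx_coverMul (congrArg DisjUnion.val hp)).trans
        (by rw [hp₁, hp₂]; exact (𝒢.idx_coverMul hab').symm)

variable [IsManifold (𝓡 n) ∞ M] [IsManifold (𝓡 m) ∞ G]

/-- The canonical morphism from the pull-back of `𝒢` along an open cover to `𝒢`. -/
def coverMap : (𝒢.cover 𝒰).Hom 𝒢 where
  base := ⟨DisjUnion.val, DisjUnion.contMDiff_val⟩
  arr := ⟨DisjUnion.val, DisjUnion.contMDiff_val⟩
  src_arr _ := rfl
  tgt_arr _ := rfl
  arr_one _ := rfl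
  arr_mul a b h := by
    have h' : 𝒢.src a.val = 𝒢.tgt b.val := congrArg DisjUnion.val h
    exact 𝒢.val_coverMul h'

variable {𝒰} {𝒱 : OpenCover M}

/-- The morphism between the pull-backs of `𝒢` along two open covers that is induced by a
choice `r`, for each member of the finer one, of a member of the other one containing it. -/
def refineMap (r : 𝒱.carrier → 𝒰.carrier) (hr : ∀ V, V.1 ≤ (r V).1) :
    (𝒢.cover 𝒱).Hom (𝒢.cover 𝒰) where
  base := ⟨fun x => .mk (r x.idx) x.val (hr _ x.val_mem),
    DisjUnion.contMDiff_iff.2 ⟨DisjUnion.contMDiff_val, fun a =>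
      (DisjUnion.eventually_idx a).mono fun b hb => congrArg r hb⟩⟩
  arr := ⟨fun a => .mk (r a.idx.1, r a.idx.2) a.val
      ⟨hr _ (CoverArrows.src_mem 𝒢 𝒱 a), hr _ (CoverArrows.tgt_mem 𝒢 𝒱 a)⟩,
    DisjUnion.contMDiff_iff.2 ⟨DisjUnion.contMDiff_val, fun a =>
      (DisjUnion.eventually_idx a).mono fun b hb => congrArg (Prod.map r r) hb⟩⟩
  src_arr _ := rfl
  tgt_arr _ := rfl
  arr_one _ := rfl
  arr_mul a b h := by
    have h' : 𝒢.src a.val = 𝒢.tgt b.val := congrArg DisjUnion.val h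
    refine DisjUnion.ext' ?_ ((𝒢.val_coverMul h').trans (Eq.symm (𝒢.val_coverMul h')))
    refine Eq.trans ?_ (Eq.symm (𝒢.idx_coverMul h'))
    exact congrArg (Prod.map r r) (𝒢.idx_coverMul h')

end LieGroupoid

/-! ### Differentiable cohomology in degree one -/

namespace LieGroupoid

variable {n m : ℕ} {M : Type u} {G : Type w}
  [TopologicalSpace M] [ChartedSpace (EuclideanSpace ℝ (Fin n)) M]
  [TopologicalSpace G] [ChartedSpace (EuclideanSpace ℝ (Fin m)) G]
  {n' m' : ℕ} {M' : Type u'} {G' : Type w'}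
  [TopologicalSpace M'] [ChartedSpace (EuclideanSpace ℝ (Fin n')) M']
  [TopologicalSpace G'] [ChartedSpace (EuclideanSpace ℝ (Fin m')) G']

section Coefficients

variable (𝒢 : LieGroupoid n m M G) {EA : Type*} [NormedAddCommGroup EA] [NormedSpace ℝ EA]
  {HA : Type*} [TopologicalSpace HA] (IA : ModelWithCorners ℝ EA HA)
  (A : Type*) [CommGroup A] [TopologicalSpace A] [ChartedSpace HA A] [LieGroup IA ∞ A]
  {EB : Type*} [NormedAddCommGroup EB] [NormedSpace ℝ EB]
  {HB : Type*} [TopologicalSpace HB] (IB : ModelWithCorners ℝ EB HB)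
  (B : Type*) [CommGroup B] [TopologicalSpace B] [ChartedSpace HB B] [LieGroup IB ∞ B]

/-- The group of differentiable 1-cocycles with coefficients in an abelian Lie group: the smooth
groupoid homomorphisms to it. -/
def Z1 : Subgroup (G → A) where
  carrier := {c | ContMDiff (𝓡 m) IA ∞ c ∧ ∀ g h, 𝒢.src g = 𝒢.tgt h → c (𝒢.mul g h) = c g * c h}
  mul_mem' {c d} hc hd := by
    have : ContMDiffMul IA ∞ A := LieGroup.toContMDiffMul
    refine ⟨hc.1.mul hd.1, fun g h hgh => ?_⟩
    simp only [Pi.mul_apply, hc.2 g h hgh, hd.2 g h hgh]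
    exact mul_mul_mul_comm _ _ _ _
  one_mem' := ⟨contMDiff_const, fun _ _ _ => (_root_.mul_one _).symm⟩
  inv_mem' {c} hc := by
    refine ⟨hc.1.inv, fun g h hgh => ?_⟩
    simp only [Pi.inv_apply, hc.2 g h hgh]
    exact _root_.mul_inv _ _

/-- The group of differentiable 1-coboundaries with coefficients in an abelian Lie group. -/
def B1 : Subgroup (G → A) where
  carrier := {c | ∃ f : M → A, ContMDiff (𝓡 n) IA ∞ f ∧ ∀ g, c g = f (𝒢.src g) / f (𝒢.tgt g)}
  mul_mem' := by
    rintro c d ⟨f, hf, hc⟩ ⟨f', hf', hd⟩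
    have : ContMDiffMul IA ∞ A := LieGroup.toContMDiffMul
    refine ⟨f * f', hf.mul hf', fun g => ?_⟩
    simp only [Pi.mul_apply, hc, hd]
    exact div_mul_div_comm _ _ _ _
  one_mem' := ⟨1, contMDiff_const, fun _ => by simp⟩
  inv_mem' := by
    rintro c ⟨f, hf, hc⟩
    refine ⟨f⁻¹, hf.inv, fun g => ?_⟩
    simp only [Pi.inv_apply, hc]
    rw [inv_div, inv_div_inv]

theorem B1_le_Z1 : 𝒢.B1 IA A ≤ 𝒢.Z1 IA A := by
  rintro c ⟨f, hf, hc⟩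
  refine ⟨?_, fun g h hgh => ?_⟩
  · have : c = fun g => f (𝒢.src g) / f (𝒢.tgt g) := funext hc
    rw [this]
    exact (hf.comp 𝒢.src.contMDiff).div (hf.comp 𝒢.tgt.contMDiff)
  · rw [hc, hc, hc, 𝒢.src_mul g h hgh, 𝒢.tgt_mul g h hgh, hgh, mul_comm]
    exact (div_mul_div_cancel _ _ _).symm

/-- The first differentiable cohomology group of a Lie groupoid with coefficients in an abelian Lie
group. -/
abbrev H1 := 𝒢.Z1 IA A ⧸ (𝒢.B1 IA A).subgroupOf (𝒢.Z1 IA A)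

variable {𝒢}

/-- The pull-back of cocycles along a morphism of Lie groupoids. -/
def Hom.pullZ1 {𝒢' : LieGroupoid n' m' M' G'} (Φ : 𝒢'.Hom 𝒢) : 𝒢.Z1 IA A →* 𝒢'.Z1 IA A where
  toFun c := ⟨c.1 ∘ Φ.arr, c.2.1.comp Φ.arr.contMDiff, fun g h hgh => by
    have h' : 𝒢.src (Φ.arr g) = 𝒢.tgt (Φ.arr h) := by rw [Φ.src_arr, Φ.tgt_arr, hgh]
    simp only [Function.comp_apply, Φ.arr_mul g h hgh, c.2.2 _ _ h']⟩
  map_one' := rfl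
  map_mul' _ _ := rfl

/-- The pull-back of cohomology classes along a morphism of Lie groupoids. -/
def Hom.pullH1 {𝒢' : LieGroupoid n' m' M' G'} (Φ : 𝒢'.Hom 𝒢) : 𝒢.H1 IA A →* 𝒢'.H1 IA A :=
  QuotientGroup.map _ _ (Φ.pullZ1 IA A) (by
    rintro c ⟨f, hf, hc⟩
    refine ⟨f ∘ Φ.base, hf.comp Φ.base.contMDiff, fun g => ?_⟩
    have := hc (Φ.arr g)
    rw [Φ.src_arr, Φ.tgt_arr] at this
    exact this)

variable {IA IB A B}

/-- The map on cohomology induced by a morphism of abelian Lie groups. -/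
def H1.mapCoeff (φ : A →* B) (hφ : ContMDiff IA IB ∞ φ) : 𝒢.H1 IA A →* 𝒢.H1 IB B :=
  QuotientGroup.map _ _
    (MonoidHom.mk' (fun c : 𝒢.Z1 IA A => (⟨φ ∘ c.1, hφ.comp c.2.1, fun g h hgh => by
        simp only [Function.comp_apply, c.2.2 g h hgh, map_mul]⟩ : 𝒢.Z1 IB B))
      (fun c d => Subtype.ext (funext fun g => map_mul φ (c.1 g) (d.1 g)))) (by
    rintro c ⟨f, hf, hc⟩
    refine ⟨φ ∘ f, hφ.comp hf, fun g => ?_⟩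
    exact (congrArg φ (hc g)).trans (map_div φ _ _))

end Coefficients

section Real

variable (𝒢 : LieGroupoid n m M G)

/-- The space of real valued differentiable 1-cocycles. -/
def RealZ1 : Submodule ℝ (G → ℝ) where
  carrier := {c | ContMDiff (𝓡 m) 𝓘(ℝ, ℝ) ∞ c ∧
    ∀ g h, 𝒢.src g = 𝒢.tgt h → c (𝒢.mul g h) = c g + c h}
  add_mem' {c d} hc hd := by
    refine ⟨hc.1.add hd.1, fun g h hgh => ?_⟩
    simp only [Pi.add_apply, hc.2 g h hgh, hd.2 g h hgh]
    ring
  zero_mem' := ⟨contMDiff_const, fun _ _ _ => (add_zero _).symm⟩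
  smul_mem' r c hc := by
    refine ⟨(contDiff_const_smul r).contMDiff.comp hc.1, fun g h hgh => ?_⟩
    simp only [Pi.smul_apply, hc.2 g h hgh, smul_add]

/-- The space of real valued differentiable 1-coboundaries. -/
def RealB1 : Submodule ℝ (G → ℝ) where
  carrier := {c | ∃ f : M → ℝ, ContMDiff (𝓡 n) 𝓘(ℝ, ℝ) ∞ f ∧
    ∀ g, c g = f (𝒢.src g) - f (𝒢.tgt g)}
  add_mem' := by
    rintro c d ⟨f, hf, hc⟩ ⟨f', hf', hd⟩
    refine ⟨f + f', hf.add hf', fun g => ?_⟩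
    simp only [Pi.add_apply, hc, hd]
    ring
  zero_mem' := ⟨0, contMDiff_const, fun _ => by simp⟩
  smul_mem' := by
    rintro r c ⟨f, hf, hc⟩
    refine ⟨r • f, (contDiff_const_smul r).contMDiff.comp hf, fun g => ?_⟩
    simp only [Pi.smul_apply, hc, smul_sub]

/-- The first differentiable cohomology of a Lie groupoid (with real coefficients), a real vector
space. -/
abbrev RealH1 := 𝒢.RealZ1 ⧸ 𝒢.RealB1.submoduleOf 𝒢.RealZ1

variable {𝒢}

/-- The pull-back of real cohomology classes along a morphism of Lie groupoids. -/
def Hom.pullRealH1 {𝒢' : LieGroupoid n' m' M' G'} (Φ : 𝒢'.Hom 𝒢) : 𝒢.RealH1 →ₗ[ℝ] 𝒢'.RealH1 :=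
  Submodule.mapQ _ _
    { toFun := fun c => (⟨c.1 ∘ Φ.arr, c.2.1.comp Φ.arr.contMDiff, fun g h hgh => by
        have h' : 𝒢.src (Φ.arr g) = 𝒢.tgt (Φ.arr h) := by rw [Φ.src_arr, Φ.tgt_arr, hgh]
        simp only [Function.comp_apply, Φ.arr_mul g h hgh, c.2.2 _ _ h']⟩ : 𝒢'.RealZ1)
      map_add' := fun _ _ => rfl
      map_smul' := fun _ _ => rfl } (by
    rintro c ⟨f, hf, hc⟩
    refine ⟨f ∘ Φ.base, hf.comp Φ.base.contMDiff, fun g => ?_⟩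
    have := hc (Φ.arr g)
    rw [Φ.src_arr, Φ.tgt_arr] at this
    exact this)

theorem contMDiff_logAbs : ContMDiff 𝓘(ℝ, ℝ) 𝓘(ℝ, ℝ) ∞ (fun a : ℝˣ => Real.log |(a : ℝ)|) := by
  intro a
  have h : ContMDiffAt 𝓘(ℝ, ℝ) 𝓘(ℝ, ℝ) ∞ Real.log (a : ℝ) :=
    (Real.contDiffAt_log.2 a.ne_zero).contMDiffAt
  simp only [Real.log_abs]
  exact h.comp a (Units.contMDiff_val a)

/-- The map `[c] ↦ [ln |c|]`. -/
def H1.logAbs : 𝒢.H1 𝓘(ℝ, ℝ) ℝˣ →* Multiplicative 𝒢.RealH1 :=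
  QuotientGroup.lift _
    (MonoidHom.mk' (fun c : 𝒢.Z1 𝓘(ℝ, ℝ) ℝˣ => Multiplicative.ofAdd (Submodule.Quotient.mk
        (⟨fun g => Real.log |(c.1 g : ℝ)|, contMDiff_logAbs.comp c.2.1, fun g h hgh => by
          simp only [c.2.2 g h hgh, Units.val_mul, abs_mul]
          exact Real.log_mul (abs_ne_zero.2 (c.1 g).ne_zero) (abs_ne_zero.2 (c.1 h).ne_zero)⟩ :
          𝒢.RealZ1)))
      (fun c d => by
        rw [← ofAdd_add, ← Submodule.Quotient.mk_add]
        refine congrArg (fun x => Multiplicative.ofAdd (Submodule.Quotient.mk x))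
          (Subtype.ext (funext fun g => ?_))
        change Real.log |((c.1 g * d.1 g : ℝˣ) : ℝ)| = _
        rw [Units.val_mul, abs_mul]
        exact Real.log_mul (abs_ne_zero.2 (c.1 g).ne_zero) (abs_ne_zero.2 (d.1 g).ne_zero))) (by
    rintro c ⟨f, hf, hc⟩
    refine congrArg Multiplicative.ofAdd ((Submodule.Quotient.mk_eq_zero _).2
      ⟨fun x => Real.log |(f x : ℝ)|, contMDiff_logAbs.comp hf, fun g => ?_⟩)
    have : c.1 g = f (𝒢.src g) / f (𝒢.tgt g) := hc g
    change Real.log |((c.1 g : ℝˣ) : ℝ)| = _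
    rw [this, Units.val_div_eq_div_val, abs_div]
    exact Real.log_div (abs_ne_zero.2 (f _).ne_zero) (abs_ne_zero.2 (f _).ne_zero))

end Real

end LieGroupoid

/-- The group `ℤ₂ = {1, -1}` as a zero-dimensional manifold. -/
instance : ChartedSpace (EuclideanSpace ℝ (Fin 0)) ℤˣ := ChartedSpace.ofDiscreteTopology

/-- The group `ℤ₂ = {1, -1}` as a zero-dimensional Lie group. -/
instance : LieGroup (𝓡 0) ∞ ℤˣ where
  toIsManifold := IsManifold.of_discreteTopology _
  contMDiff_mul := contMDiff_of_discreteTopology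
  contMDiff_inv := contMDiff_of_discreteTopology

/-- The homomorphism `sign : ℝ^* → {1, -1}`. -/
def signUnits : ℝˣ →* ℤˣ where
  toFun a := if 0 < (a : ℝ) then 1 else -1
  map_one' := by simp
  map_mul' a b := by
    rcases lt_or_gt_of_ne a.ne_zero with ha | ha <;> rcases lt_or_gt_of_ne b.ne_zero with hb | hb
    · simp [ha.not_gt, hb.not_gt, mul_pos_of_neg_of_neg ha hb]
    · simp [ha.not_gt, hb, (mul_neg_of_neg_of_pos ha hb).not_gt]
    · simp [ha, hb.not_gt, (mul_neg_of_pos_of_neg ha hb).not_gt]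
    · simp [ha, hb]

theorem contMDiff_signUnits : ContMDiff 𝓘(ℝ, ℝ) (𝓡 0) ∞ signUnits := by
  intro a
  have h : ∀ᶠ b : ℝˣ in 𝓝 a, signUnits b = signUnits a := by
    rcases lt_or_gt_of_ne a.ne_zero with ha | ha
    · have := (Units.continuous_val.tendsto a).eventually (gt_mem_nhds ha)
      filter_upwards [this] with b hb
      simp [signUnits, ha.not_gt, hb.not_gt]
    · have := (Units.continuous_val.tendsto a).eventually (lt_mem_nhds ha)
      filter_upwards [this] with b hb
      simp [signUnits, ha, hb]
  exact (contMDiffAt_const (c := signUnits a)).congr_of_eventuallyEq h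

namespace LieGroupoid

variable {n m : ℕ} {M : Type u} {G : Type w}
  [TopologicalSpace M] [ChartedSpace (EuclideanSpace ℝ (Fin n)) M]
  [TopologicalSpace G] [ChartedSpace (EuclideanSpace ℝ (Fin m)) G]

/-- The map `[c] ↦ [sign c]`. -/
def H1.sign {𝒢 : LieGroupoid n m M G} : 𝒢.H1 𝓘(ℝ, ℝ) ℝˣ →* 𝒢.H1 (𝓡 0) ℤˣ :=
  H1.mapCoeff signUnits contMDiff_signUnits

/-! ### Čech-type differentiable cohomology -/

section Cech

variable [IsManifold (𝓡 n) ∞ M] [IsManifold (𝓡 m) ∞ G] (𝒢 : LieGroupoid n m M G)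
  {EA : Type*} [NormedAddCommGroup EA] [NormedSpace ℝ EA]
  {HA : Type*} [TopologicalSpace HA] (IA : ModelWithCorners ℝ EA HA)
  (A : Type*) [CommGroup A] [TopologicalSpace A] [ChartedSpace HA A] [LieGroup IA ∞ A]

theorem exists_refine {𝒰 𝒱 : OpenCover M} (h : 𝒰 ≤ 𝒱) :
    ∃ r : 𝒱.carrier → 𝒰.carrier, ∀ V, V.1 ≤ (r V).1 := by
  choose f hf hf' using h
  exact ⟨fun V => ⟨f V.1 V.2, hf V.1 V.2⟩, fun V => hf' V.1 V.2⟩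

/-- The restriction of cohomology classes to a refinement of an open cover. -/
def resH1 {𝒰 𝒱 : OpenCover M} (h : 𝒰 ≤ 𝒱) :
    (𝒢.cover 𝒰).H1 IA A →* (𝒢.cover 𝒱).H1 IA A :=
  (𝒢.refineMap (exists_refine h).choose (exists_refine h).choose_spec).pullH1 IA A

variable {IA A} in
/-- The restriction to a refinement does not depend on the choice of the refinement map. -/
theorem pullH1_refineMap_eq {𝒰 𝒱 : OpenCover M} (r r' : 𝒱.carrier → 𝒰.carrier)
    (hr : ∀ V, V.1 ≤ (r V).1) (hr' : ∀ V, V.1 ≤ (r' V).1) (x : (𝒢.cover 𝒰).H1 IA A) :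
    (𝒢.refineMap r hr).pullH1 IA A x = (𝒢.refineMap r' hr').pullH1 IA A x := by
  induction x using QuotientGroup.induction_on with | _ c
  refine QuotientGroup.eq.2 ?_
  let φ : 𝒱.Space → 𝒢.CoverArrows 𝒰 := fun x => .mk (r x.idx, r' x.idx) (𝒢.one x.val)
      ⟨by rw [𝒢.src_one]; exact hr _ x.val_mem, by rw [𝒢.tgt_one]; exact hr' _ x.val_mem⟩
  have hφ : ContMDiff (𝓡 n) (𝓡 m) ∞ φ :=
    DisjUnion.contMDiff_iff.2 ⟨𝒢.one.contMDiff.comp DisjUnion.contMDiff_val, fun a =>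
      (DisjUnion.eventually_idx a).mono fun b hb => congrArg (fun i => (r i, r' i)) hb⟩
  refine ⟨fun x => (c.1 (φ x))⁻¹, (c.2.1.comp hφ).inv, fun a => ?_⟩
  have h₁ := c.2.2 ((𝒢.refineMap r' hr').arr a) (φ ((𝒢.cover 𝒱).src a))
    (DisjUnion.ext' rfl (𝒢.tgt_one _).symm)
  have h₂ := c.2.2 (φ ((𝒢.cover 𝒱).tgt a)) ((𝒢.refineMap r hr).arr a)
    (DisjUnion.ext' rfl (𝒢.src_one _))
  have h₃ : (𝒢.cover 𝒰).mul ((𝒢.refineMap r' hr').arr a) (φ ((𝒢.cover 𝒱).src a)) =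
      (𝒢.cover 𝒰).mul (φ ((𝒢.cover 𝒱).tgt a)) ((𝒢.refineMap r hr).arr a) := by
    have e₁ : 𝒢.src ((𝒢.refineMap r' hr').arr a).val = 𝒢.tgt (φ ((𝒢.cover 𝒱).src a)).val :=
      (𝒢.tgt_one _).symm
    have e₂ : 𝒢.src (φ ((𝒢.cover 𝒱).tgt a)).val = 𝒢.tgt ((𝒢.refineMap r hr).arr a).val :=
      𝒢.src_one _
    refine DisjUnion.ext' ((𝒢.idx_coverMul e₁).trans (𝒢.idx_coverMul e₂).symm)
      ((𝒢.val_coverMul e₁).trans (Eq.trans ?_ (𝒢.val_coverMul e₂).symm))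
    exact (𝒢.mul_one a.val).trans (𝒢.one_mul a.val).symm
  rw [h₃, h₂] at h₁
  change (c.1 ((𝒢.refineMap r hr).arr a))⁻¹ * c.1 ((𝒢.refineMap r' hr').arr a) =
    (c.1 (φ ((𝒢.cover 𝒱).src a)))⁻¹ / (c.1 (φ ((𝒢.cover 𝒱).tgt a)))⁻¹
  rw [inv_div_inv, inv_mul_eq_iff_eq_mul, ← mul_div_assoc, eq_div_iff_mul_eq']
  exact h₁.symm.trans (mul_comm _ _)

instance : DirectedSystem (fun 𝒰 : OpenCover M => (𝒢.cover 𝒰).H1 IA A)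
    (fun _ _ h => 𝒢.resH1 IA A h) where
  map_self 𝒰 x := by
    refine (𝒢.pullH1_refineMap_eq _ id _ (fun V => le_rfl) x).trans ?_
    induction x using QuotientGroup.induction_on with | _ c
    rfl
  map_map 𝒰 𝒱 𝒲 h₁ h₂ x := by
    refine Eq.trans ?_ (𝒢.pullH1_refineMap_eq
      ((exists_refine h₁).choose ∘ (exists_refine h₂).choose) _
      (fun V => ((exists_refine h₂).choose_spec V).trans ((exists_refine h₁).choose_spec _)) _ x)
    induction x using QuotientGroup.induction_on with | _ c
    rfl

/-- The Čech-type differentiable cohomology group in degree one: the filtered colimit of the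
differentiable cohomology groups of the pull-backs of the groupoid along the open covers of the
base, with respect to refinement. -/
abbrev CechH1 := DirectLimit (fun 𝒰 : OpenCover M => (𝒢.cover 𝒰).H1 IA A)
  (fun _ _ h => 𝒢.resH1 IA A h)

variable {IA A}

/-- The class in Čech-type cohomology that is represented by a class over an open cover. -/
def CechH1.of (𝒰 : OpenCover M) (x : (𝒢.cover 𝒰).H1 IA A) : 𝒢.CechH1 IA A := ⟦⟨𝒰, x⟩⟧

end Cech

end LieGroupoid

/-! ### Smooth line bundles -/

/-- A smooth real line bundle over the manifold `M`. -/
structure LineBundle (n : ℕ) (M : Type u) [TopologicalSpace M]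
    [ChartedSpace (EuclideanSpace ℝ (Fin n)) M] where
  fib : M → Type v
  [addCommGroup : ∀ x, AddCommGroup (fib x)]
  [module : ∀ x, Module ℝ (fib x)]
  [topFib : ∀ x, TopologicalSpace (fib x)]
  [topTotal : TopologicalSpace (TotalSpace ℝ fib)]
  [fiberBundle : FiberBundle ℝ fib]
  [vectorBundle : VectorBundle ℝ ℝ fib]
  [contMDiffVectorBundle : ContMDiffVectorBundle ∞ ℝ fib (𝓡 n)]

attribute [instance] LineBundle.addCommGroup LineBundle.module LineBundle.topFib
  LineBundle.topTotal LineBundle.fiberBundle LineBundle.vectorBundle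
  LineBundle.contMDiffVectorBundle

/-- A family of 1-dimensional vector spaces over `M` together with local frames near each point
that are related by smooth functions. -/
structure FrameAtlas (n : ℕ) {M : Type u} [TopologicalSpace M]
    [ChartedSpace (EuclideanSpace ℝ (Fin n)) M] (fib : M → Type v) [∀ x, AddCommGroup (fib x)]
    [∀ x, Module ℝ (fib x)] where
  dom : M → Set M
  isOpen_dom : ∀ i, IsOpen (dom i)
  mem_dom : ∀ i, i ∈ dom i
  frame : ∀ _ : M, ∀ x, fib x
  coord : ∀ _ : M, ∀ x, fib x →ₗ[ℝ] ℝ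
  coord_frame : ∀ i, ∀ x ∈ dom i, coord i x (frame i x) = 1
  coord_smul_frame : ∀ i, ∀ x ∈ dom i, ∀ v, coord i x v • frame i x = v
  smooth : ∀ i j, ContMDiffOn (𝓡 n) 𝓘(ℝ, ℝ) ∞ (fun x => coord j x (frame i x)) (dom i ∩ dom j)

namespace FrameAtlas

variable {n : ℕ} {M : Type u} [TopologicalSpace M]
    [ChartedSpace (EuclideanSpace ℝ (Fin n)) M] {fib : M → Type v} [∀ x, AddCommGroup (fib x)]
    [∀ x, Module ℝ (fib x)] (𝒜 : FrameAtlas n fib)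

/-- The local trivialization given by a local frame. -/
def pretriv (i : M) : Pretrivialization ℝ (π ℝ fib) where
  toFun p := (p.1, 𝒜.coord i p.1 p.2)
  invFun q := ⟨q.1, q.2 • 𝒜.frame i q.1⟩
  source := π ℝ fib ⁻¹' 𝒜.dom i
  target := 𝒜.dom i ×ˢ univ
  map_source' _ hp := ⟨hp, mem_univ _⟩
  map_target' _ hq := hq.1
  left_inv' := by
    rintro ⟨x, v⟩ hp
    exact congrArg (TotalSpace.mk x) (𝒜.coord_smul_frame i x hp v)
  right_inv' := by
    rintro ⟨x, a⟩ hq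
    simp only [map_smul, 𝒜.coord_frame i x hq.1, smul_eq_mul, _root_.mul_one]
  open_target := (𝒜.isOpen_dom i).prod isOpen_univ
  baseSet := 𝒜.dom i
  open_baseSet := 𝒜.isOpen_dom i
  source_eq := rfl
  target_eq := rfl
  proj_toFun _ _ := rfl

/-- The topology on the fibers. -/
@[reducible] def topFib (x : M) : TopologicalSpace (fib x) :=
  TopologicalSpace.induced (𝒜.coord x x) inferInstance

theorem pretriv_symm {i x : M} (hx : x ∈ 𝒜.dom i) (a : ℝ) :
    TotalSpace.mk' ℝ x ((𝒜.pretriv i).symm x a) = ⟨x, a • 𝒜.frame i x⟩ :=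
  (𝒜.pretriv i).mk_symm hx a

theorem coordChange_eq {i j b : M} (hb : b ∈ 𝒜.dom i ∩ 𝒜.dom j) (a : ℝ) :
    (𝒜.coord j b (𝒜.frame i b) • ContinuousLinearMap.id ℝ ℝ) a =
      (𝒜.pretriv j ⟨b, (𝒜.pretriv i).symm b a⟩).2 := by
  have h := congrArg (fun p => (𝒜.pretriv j p).2) (𝒜.pretriv_symm hb.1 a)
  refine Eq.trans ?_ h.symm
  change _ = 𝒜.coord j b (a • 𝒜.frame i b)
  simp [mul_comm]

/-- The line bundle with the given fibers and local frames, as a prebundle. -/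
def prebundle : letI := 𝒜.topFib; VectorPrebundle ℝ ℝ fib :=
  letI := 𝒜.topFib
  { pretrivializationAtlas := range 𝒜.pretriv
    pretrivialization_linear' := by
      rintro _ ⟨i, rfl⟩
      exact ⟨fun x _ => (𝒜.coord i x).isLinear⟩
    pretrivializationAt := 𝒜.pretriv
    mem_base_pretrivializationAt := 𝒜.mem_dom
    pretrivialization_mem_atlas := mem_range_self
    exists_coordChange := by
      rintro _ ⟨i, rfl⟩ _ ⟨j, rfl⟩
      exact ⟨fun b => 𝒜.coord j b (𝒜.frame i b) • ContinuousLinearMap.id ℝ ℝ,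
        (𝒜.smooth i j).continuousOn.smul continuousOn_const, fun b hb a => 𝒜.coordChange_eq hb a⟩
    totalSpaceMk_isInducing := fun b =>
      (isEmbedding_prodMkRight b).isInducing.comp ⟨rfl⟩ }

/-- The line bundle with the given fibers and local frames. -/
def lineBundle : LineBundle n M :=
  letI := 𝒜.topFib
  letI := 𝒜.prebundle.totalSpaceTopology
  letI := 𝒜.prebundle.toFiberBundle
  letI : VectorBundle ℝ ℝ fib := 𝒜.prebundle.toVectorBundle
  have : 𝒜.prebundle.IsContMDiff (𝓡 n) ∞ := ⟨by
    rintro _ ⟨i, rfl⟩ _ ⟨j, rfl⟩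
    refine ⟨fun b => 𝒜.coord j b (𝒜.frame i b) • ContinuousLinearMap.id ℝ ℝ, ?_,
      fun b hb a => 𝒜.coordChange_eq hb a⟩
    have h : ContMDiff 𝓘(ℝ, ℝ) 𝓘(ℝ, ℝ →L[ℝ] ℝ) ∞
        (fun a : ℝ => a • ContinuousLinearMap.id ℝ ℝ) :=
      (contDiff_id.smul contDiff_const).contMDiff
    exact h.comp_contMDiffOn (𝒜.smooth i j)⟩
  letI : ContMDiffVectorBundle ∞ ℝ fib (𝓡 n) := 𝒜.prebundle.contMDiffVectorBundle (𝓡 n)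
  { fib := fib }

theorem trivializationAt_apply (i : M) (p : TotalSpace ℝ 𝒜.lineBundle.fib) :
    (trivializationAt ℝ 𝒜.lineBundle.fib i p).2 = 𝒜.coord i p.1 p.2 := rfl

end FrameAtlas

namespace LineBundle

variable {n : ℕ} {M : Type u} [TopologicalSpace M] [ChartedSpace (EuclideanSpace ℝ (Fin n)) M]
  {n' : ℕ} {M' : Type u'} [TopologicalSpace M'] [ChartedSpace (EuclideanSpace ℝ (Fin n')) M']
  (L : LineBundle.{u, v} n M) (L' : LineBundle.{u', v'} n' M')

/-- The pull-back of a line bundle along a smooth map. -/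
def pull (f : C^∞⟮𝓡 n', M'; 𝓡 n, M⟯) : LineBundle.{u', v} n' M' where
  fib := f *ᵖ L.fib
  addCommGroup x := L.addCommGroup (f x)
  module x := L.module (f x)
  topFib x := L.topFib (f x)
  topTotal := Pullback.TotalSpace.topologicalSpace ℝ L.fib f
  fiberBundle := FiberBundle.pullback f
  vectorBundle := VectorBundle.pullback ℝ f
  contMDiffVectorBundle := ContMDiffVectorBundle.pullback ℝ L.fib (𝓡 n') f

/-- The coordinate in the preferred trivialization at `i`. -/
def crd (i x : M) (w : L.fib x) : ℝ := (trivializationAt ℝ L.fib i ⟨x, w⟩).2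

theorem crd_smul {i x : M} (hx : x ∈ (trivializationAt ℝ L.fib i).baseSet) (a : ℝ)
    (w : L.fib x) : L.crd i x (a • w) = a * L.crd i x w :=
  ((trivializationAt ℝ L.fib i).linear ℝ hx).map_smul a w

theorem crd_injective {i x : M} (hx : x ∈ (trivializationAt ℝ L.fib i).baseSet) :
    Function.Injective (L.crd i x) :=
  ((trivializationAt ℝ L.fib i).linearEquivAt ℝ x hx).injective

theorem crd_ne_zero {i x : M} (hx : x ∈ (trivializationAt ℝ L.fib i).baseSet) {w : L.fib x}
    (hw : w ≠ 0) : L.crd i x w ≠ 0 :=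
  ((trivializationAt ℝ L.fib i).linearEquivAt ℝ x hx).map_ne_zero_iff.2 hw

theorem mem_base (x : M) : x ∈ (trivializationAt ℝ L.fib x).baseSet :=
  mem_baseSet_trivializationAt ℝ L.fib x

theorem eq_div_smul {i x : M} (hx : x ∈ (trivializationAt ℝ L.fib i).baseSet) {w₀ : L.fib x}
    (h : L.crd i x w₀ ≠ 0) (w : L.fib x) : w = (L.crd i x w / L.crd i x w₀) • w₀ :=
  L.crd_injective hx (by rw [L.crd_smul hx, div_mul_cancel₀ _ h])

theorem exists_smul_eq {x : M} {w₀ : L.fib x} (h : w₀ ≠ 0) (w : L.fib x) : ∃ a : ℝ, w = a • w₀ :=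
  ⟨_, L.eq_div_smul (L.mem_base x) (L.crd_ne_zero (L.mem_base x) h) w⟩

/-- A section is smooth at a point. -/
def SmoothAt (σ : ∀ x, L.fib x) (x : M) : Prop :=
  ContMDiffAt (𝓡 n) ((𝓡 n).prod 𝓘(ℝ, ℝ)) ∞ (fun y => TotalSpace.mk' ℝ y (σ y)) x

variable {E : Type*} [NormedAddCommGroup E] [NormedSpace ℝ E] {H : Type*} [TopologicalSpace H]
  {I : ModelWithCorners ℝ E H} {K : Type*} [TopologicalSpace K] [ChartedSpace H K]

variable {L}

theorem eventually_mem_base {f : K → M} {k : K} (hf : ContMDiffAt I (𝓡 n) ∞ f k) :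
    ∀ᶠ k' in 𝓝 k, f k' ∈ (trivializationAt ℝ L.fib (f k)).baseSet :=
  hf.continuousAt.eventually
    ((trivializationAt ℝ L.fib (f k)).open_baseSet.mem_nhds (L.mem_base _))

theorem contMDiffAt_iff {f : K → M} {σ : ∀ k, L.fib (f k)} {k : K} :
    ContMDiffAt I ((𝓡 n).prod 𝓘(ℝ, ℝ)) ∞ (fun k => TotalSpace.mk' ℝ (f k) (σ k)) k ↔
      ContMDiffAt I (𝓡 n) ∞ f k ∧
        ContMDiffAt I 𝓘(ℝ, ℝ) ∞ (fun k' => L.crd (f k) (f k') (σ k')) k :=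
  contMDiffAt_totalSpace

theorem contMDiffAt_smul {f : K → M} {σ : ∀ k, L.fib (f k)} {c : K → ℝ} {k : K}
    (hσ : ContMDiffAt I ((𝓡 n).prod 𝓘(ℝ, ℝ)) ∞ (fun k => TotalSpace.mk' ℝ (f k) (σ k)) k)
    (hc : ContMDiffAt I 𝓘(ℝ, ℝ) ∞ c k) :
    ContMDiffAt I ((𝓡 n).prod 𝓘(ℝ, ℝ)) ∞ (fun k => TotalSpace.mk' ℝ (f k) (c k • σ k)) k := by
  rw [contMDiffAt_iff] at hσ ⊢
  refine ⟨hσ.1, (hc.mul hσ.2).congr_of_eventuallyEq ?_⟩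
  filter_upwards [eventually_mem_base (L := L) hσ.1] with k' hk'
  exact L.crd_smul hk' _ _

/-- The quotient of two smooth sections is smooth. -/
theorem contMDiffAt_coeff {f : K → M} {σ τ : ∀ k, L.fib (f k)} {c : K → ℝ} {k : K}
    (hσ : ContMDiffAt I ((𝓡 n).prod 𝓘(ℝ, ℝ)) ∞ (fun k => TotalSpace.mk' ℝ (f k) (σ k)) k)
    (hτ : ContMDiffAt I ((𝓡 n).prod 𝓘(ℝ, ℝ)) ∞ (fun k => TotalSpace.mk' ℝ (f k) (τ k)) k)
    (hσ₀ : σ k ≠ 0) (hc : ∀ᶠ k' in 𝓝 k, τ k' = c k' • σ k') : ContMDiffAt I 𝓘(ℝ, ℝ) ∞ c k := by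
  rw [contMDiffAt_iff] at hσ hτ
  have hne : L.crd (f k) (f k) (σ k) ≠ 0 := L.crd_ne_zero (L.mem_base _) hσ₀
  have hne' := hσ.2.continuousAt.eventually (isOpen_ne.mem_nhds hne)
  have hd := hτ.2.mul (((contDiffAt_inv ℝ hne).contMDiffAt (n := ∞)).comp k hσ.2)
  refine hd.congr_of_eventuallyEq ?_
  filter_upwards [eventually_mem_base (L := L) hσ.1, hne', hc] with k' hk' hk'' hk
  change c k' = L.crd (f k) (f k') (τ k') * (L.crd (f k) (f k') (σ k'))⁻¹
  rw [hk, L.crd_smul hk', mul_assoc, mul_inv_cancel₀ hk'', _root_.mul_one]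

variable (L) in
theorem exists_frame (x₀ : M) : ∃ σ : ∀ x, L.fib x, L.SmoothAt σ x₀ ∧ σ x₀ ≠ 0 := by
  set e := trivializationAt ℝ L.fib x₀ with he
  have hb : ∀ x (hx : x ∈ e.baseSet), L.crd x₀ x (e.symm x 1) = 1 := by
    intro x hx
    change (e ⟨x, e.symm x 1⟩).2 = 1
    rw [e.apply_mk_symm hx]
  refine ⟨fun x => e.symm x 1, ?_, ?_⟩
  · refine contMDiffAt_iff.2 ⟨contMDiffAt_id, ?_⟩
    refine (contMDiffAt_const (c := (1 : ℝ))).congr_of_eventuallyEq ?_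
    filter_upwards [e.open_baseSet.mem_nhds (L.mem_base x₀)] with x hx
    exact hb x hx
  · intro h
    have h₁ := hb x₀ (L.mem_base x₀)
    rw [show e.symm x₀ 1 = 0 from h] at h₁
    have h₂ := L.crd_smul (L.mem_base x₀) 0 (0 : L.fib x₀)
    rw [zero_smul, zero_mul, h₁] at h₂
    exact one_ne_zero h₂

/-- A fiberwise linear map between line bundles is smooth if near each point it sends some smooth
local frame to a smooth map. -/
theorem contMDiff_of_frames {L' : LineBundle.{u', v'} n' M'} {f : M → M'}
    (F : ∀ x, L.fib x →ₗ[ℝ] L'.fib (f x))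
    (h : ∀ x₀, ∃ σ : ∀ x, L.fib x, L.SmoothAt σ x₀ ∧ σ x₀ ≠ 0 ∧
      ContMDiffAt (𝓡 n) ((𝓡 n').prod 𝓘(ℝ, ℝ)) ∞
        (fun x => TotalSpace.mk' ℝ (f x) (F x (σ x))) x₀) :
    ContMDiff ((𝓡 n).prod 𝓘(ℝ, ℝ)) ((𝓡 n').prod 𝓘(ℝ, ℝ)) ∞
      (fun p : TotalSpace ℝ L.fib => TotalSpace.mk' ℝ (f p.1) (F p.1 p.2)) := by
  rintro ⟨x₀, w₀⟩
  obtain ⟨σ, hσ, hσ₀, hF⟩ := h x₀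
  have hp : ContMDiffAt ((𝓡 n).prod 𝓘(ℝ, ℝ)) (𝓡 n) ∞ (fun p : TotalSpace ℝ L.fib => p.1)
      ⟨x₀, w₀⟩ := contMDiffAt_proj L.fib
  have hσ' : ContMDiffAt ((𝓡 n).prod 𝓘(ℝ, ℝ)) ((𝓡 n).prod 𝓘(ℝ, ℝ)) ∞
      (fun p : TotalSpace ℝ L.fib => TotalSpace.mk' ℝ p.1 (σ p.1)) ⟨x₀, w₀⟩ :=
    hσ.comp_of_eq hp rfl
  have hF' : ContMDiffAt ((𝓡 n).prod 𝓘(ℝ, ℝ)) ((𝓡 n').prod 𝓘(ℝ, ℝ)) ∞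
      (fun p : TotalSpace ℝ L.fib => TotalSpace.mk' ℝ (f p.1) (F p.1 (σ p.1))) ⟨x₀, w₀⟩ :=
    hF.comp_of_eq hp rfl
  have hne : L.crd x₀ x₀ (σ x₀) ≠ 0 := L.crd_ne_zero (L.mem_base _) hσ₀
  have hne' : ∀ᶠ p : TotalSpace ℝ L.fib in 𝓝 ⟨x₀, w₀⟩, L.crd x₀ p.1 (σ p.1) ≠ 0 :=
    (contMDiffAt_iff.1 hσ').2.continuousAt.eventually (isOpen_ne.mem_nhds hne)
  have hb := eventually_mem_base (L := L) hp
  have heq : ∀ᶠ p : TotalSpace ℝ L.fib in 𝓝 ⟨x₀, w₀⟩,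
      p.2 = (L.crd x₀ p.1 p.2 / L.crd x₀ p.1 (σ p.1)) • σ p.1 := by
    filter_upwards [hb, hne'] with p hp₁ hp₂
    exact L.eq_div_smul hp₁ hp₂ _
  have hc : ContMDiffAt ((𝓡 n).prod 𝓘(ℝ, ℝ)) 𝓘(ℝ, ℝ) ∞
      (fun p : TotalSpace ℝ L.fib => L.crd x₀ p.1 p.2 / L.crd x₀ p.1 (σ p.1)) ⟨x₀, w₀⟩ :=
    contMDiffAt_coeff hσ' (contMDiffAt_id (x := (⟨x₀, w₀⟩ : TotalSpace ℝ L.fib))) hσ₀ heq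
  refine (contMDiffAt_smul hF' hc).congr_of_eventuallyEq ?_
  filter_upwards [heq] with p hp
  refine congrArg (TotalSpace.mk' ℝ (f p.1)) ?_
  conv_lhs => rw [hp]
  rw [map_smul]

/-- A map to a pull-back bundle is smooth iff its components are. -/
theorem contMDiffAt_pull_iff {g : C^∞⟮𝓡 n', M'; 𝓡 n, M⟯} {f : K → M'}
    {σ : ∀ k, L.fib (g (f k))} {k : K} :
    ContMDiffAt I ((𝓡 n').prod 𝓘(ℝ, ℝ)) ∞
        (fun k => (TotalSpace.mk' ℝ (f k) (σ k) : TotalSpace ℝ (L.pull g).fib)) k ↔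
      ContMDiffAt I (𝓡 n') ∞ f k ∧
        ContMDiffAt I ((𝓡 n).prod 𝓘(ℝ, ℝ)) ∞ (fun k => TotalSpace.mk' ℝ (g (f k)) (σ k)) k := by
  refine (contMDiffAt_iff (L := L.pull g)).trans (Iff.trans ?_
    (and_congr Iff.rfl (contMDiffAt_iff (L := L)).symm))
  constructor
  · rintro ⟨h₁, h₂⟩
    exact ⟨h₁, g.contMDiff.contMDiffAt.comp k h₁, h₂⟩
  · rintro ⟨h₁, h₂, h₃⟩
    exact ⟨h₁, h₃⟩

end LineBundle

namespace FrameAtlas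

variable {n : ℕ} {M : Type u} [TopologicalSpace M]
  [ChartedSpace (EuclideanSpace ℝ (Fin n)) M] {fib : M → Type v} [∀ x, AddCommGroup (fib x)]
  [∀ x, Module ℝ (fib x)] {fib' : M → Type v'} [∀ x, AddCommGroup (fib' x)]
  [∀ x, Module ℝ (fib' x)]

/-- The tensor products of local frames. -/
def tensor (𝒜 : FrameAtlas n fib) (𝒜' : FrameAtlas n fib') :
    FrameAtlas n (fun x => fib x ⊗[ℝ] fib' x) where
  dom i := 𝒜.dom i ∩ 𝒜'.dom i
  isOpen_dom i := (𝒜.isOpen_dom i).inter (𝒜'.isOpen_dom i)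
  mem_dom i := ⟨𝒜.mem_dom i, 𝒜'.mem_dom i⟩
  frame i x := 𝒜.frame i x ⊗ₜ 𝒜'.frame i x
  coord i x := (TensorProduct.lid ℝ ℝ).toLinearMap ∘ₗ
    TensorProduct.map (𝒜.coord i x) (𝒜'.coord i x)
  coord_frame i x hx := by
    simp [𝒜.coord_frame i x hx.1, 𝒜'.coord_frame i x hx.2]
  coord_smul_frame i x hx w := by
    induction w using TensorProduct.induction_on with
    | zero => simp
    | tmul a b =>
      conv_rhs => rw [← 𝒜.coord_smul_frame i x hx.1 a, ← 𝒜'.coord_smul_frame i x hx.2 b]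
      rw [TensorProduct.smul_tmul_smul]
      simp
    | add a b ha hb => rw [map_add, add_smul, ha, hb]
  smooth i j := by
    have h : (𝒜.dom i ∩ 𝒜'.dom i) ∩ (𝒜.dom j ∩ 𝒜'.dom j) ⊆ 𝒜.dom i ∩ 𝒜.dom j :=
      fun x hx => ⟨hx.1.1, hx.2.1⟩
    have h' : (𝒜.dom i ∩ 𝒜'.dom i) ∩ (𝒜.dom j ∩ 𝒜'.dom j) ⊆ 𝒜'.dom i ∩ 𝒜'.dom j :=
      fun x hx => ⟨hx.1.2, hx.2.2⟩
    exact (((𝒜.smooth i j).mono h).mul ((𝒜'.smooth i j).mono h')).congr fun x _ => by simp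

/-- The dual local frames. -/
def dual (𝒜 : FrameAtlas n fib) : FrameAtlas n (fun x => Module.Dual ℝ (fib x)) where
  dom := 𝒜.dom
  isOpen_dom := 𝒜.isOpen_dom
  mem_dom := 𝒜.mem_dom
  frame i x := 𝒜.coord i x
  coord i x := Module.Dual.eval ℝ (fib x) (𝒜.frame i x)
  coord_frame i x hx := 𝒜.coord_frame i x hx
  coord_smul_frame i x hx ξ := by
    ext w
    conv_rhs => rw [← 𝒜.coord_smul_frame i x hx w]
    simp [mul_comm]
  smooth i j := by
    rw [inter_comm]
    exact 𝒜.smooth j i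

/-- The constant frame of the trivial line bundle. -/
def trivial (n : ℕ) (M : Type u) [TopologicalSpace M]
    [ChartedSpace (EuclideanSpace ℝ (Fin n)) M] : FrameAtlas n (fun _ : M => ULift.{v} ℝ) where
  dom _ := univ
  isOpen_dom _ := isOpen_univ
  mem_dom _ := mem_univ _
  frame _ _ := ⟨1⟩
  coord _ _ := ULift.moduleEquiv.toLinearMap
  coord_frame _ _ _ := rfl
  coord_smul_frame _ _ _ w := by
    ext
    simp
  smooth _ _ := contMDiffOn_const

end FrameAtlas

namespace LineBundle

variable {n : ℕ} {M : Type u} [TopologicalSpace M] [ChartedSpace (EuclideanSpace ℝ (Fin n)) M]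
  (L : LineBundle.{u, v} n M) (L' : LineBundle.{u, v'} n M)

/-- The local frames of a line bundle. -/
def frameAtlas : FrameAtlas n L.fib where
  dom i := (trivializationAt ℝ L.fib i).baseSet
  isOpen_dom i := (trivializationAt ℝ L.fib i).open_baseSet
  mem_dom := L.mem_base
  frame i x := (trivializationAt ℝ L.fib i).symm x 1
  coord i x := (trivializationAt ℝ L.fib i).linearMapAt ℝ x
  coord_frame i x hx := (trivializationAt ℝ L.fib i).linearMapAt_symm hx 1
  coord_smul_frame i x hx w := by
    have h := (trivializationAt ℝ L.fib i).symm_linearMapAt (R := ℝ) hx w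
    conv_rhs => rw [← h]
    rw [← (trivializationAt ℝ L.fib i).symmₗ_apply (R := ℝ) hx,
      ← (trivializationAt ℝ L.fib i).symmₗ_apply (R := ℝ) hx, ← map_smul, smul_eq_mul,
      _root_.mul_one]
  smooth i j := by
    have h := contMDiffOn_coordChangeL (n := ∞) (IB := 𝓡 n) (trivializationAt ℝ L.fib i)
      (trivializationAt ℝ L.fib j)
    refine ((h.clm_apply (contMDiffOn_const (c := (1 : ℝ))))).congr fun x hx => ?_
    rw [(trivializationAt ℝ L.fib j).coe_linearMapAt_of_mem (R := ℝ) hx.2]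
    exact ((trivializationAt ℝ L.fib i).coordChangeL_apply (R := ℝ) _ hx 1).symm

theorem coord_eq_crd {i x : M} (hx : x ∈ (trivializationAt ℝ L.fib i).baseSet) (w : L.fib x) :
    L.frameAtlas.coord i x w = L.crd i x w := by
  change (trivializationAt ℝ L.fib i).linearMapAt ℝ x w = _
  rw [(trivializationAt ℝ L.fib i).coe_linearMapAt_of_mem (R := ℝ) hx]
  rfl

/-- The tensor product of two line bundles; its fibers are the tensor products of the fibers. -/
def tensor : LineBundle.{u, max v v'} n M := (L.frameAtlas.tensor L'.frameAtlas).lineBundle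

/-- The dual of a line bundle; its fibers are the dual spaces of the fibers. -/
def dual : LineBundle.{u, v} n M := L.frameAtlas.dual.lineBundle

/-- The trivial line bundle. -/
def trivial (n : ℕ) (M : Type u) [TopologicalSpace M]
    [ChartedSpace (EuclideanSpace ℝ (Fin n)) M] : LineBundle.{u, v} n M :=
  (FrameAtlas.trivial n M).lineBundle

variable {E : Type*} [NormedAddCommGroup E] [NormedSpace ℝ E] {H : Type*} [TopologicalSpace H]
  {I : ModelWithCorners ℝ E H} {K : Type*} [TopologicalSpace K] [ChartedSpace H K]

variable {L L'}

theorem contMDiffAt_tmul {f : K → M} {σ : ∀ k, L.fib (f k)} {τ : ∀ k, L'.fib (f k)} {k : K}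
    (hσ : ContMDiffAt I ((𝓡 n).prod 𝓘(ℝ, ℝ)) ∞ (fun k => TotalSpace.mk' ℝ (f k) (σ k)) k)
    (hτ : ContMDiffAt I ((𝓡 n).prod 𝓘(ℝ, ℝ)) ∞ (fun k => TotalSpace.mk' ℝ (f k) (τ k)) k) :
    ContMDiffAt I ((𝓡 n).prod 𝓘(ℝ, ℝ)) ∞
      (fun k => (TotalSpace.mk' ℝ (f k) (σ k ⊗ₜ[ℝ] τ k) : TotalSpace ℝ (L.tensor L').fib)) k := by
  rw [contMDiffAt_iff] at hσ hτ
  refine (contMDiffAt_iff (L := L.tensor L')).2 ⟨hσ.1, (hσ.2.mul hτ.2).congr_of_eventuallyEq ?_⟩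
  filter_upwards [eventually_mem_base (L := L) hσ.1, eventually_mem_base (L := L') hσ.1]
    with k' h₁ h₂
  change (TensorProduct.lid ℝ ℝ).toLinearMap (TensorProduct.map (L.frameAtlas.coord (f k) (f k'))
    (L'.frameAtlas.coord (f k) (f k')) (σ k' ⊗ₜ[ℝ] τ k')) = _
  simp [L.coord_eq_crd h₁, L'.coord_eq_crd h₂]

/-- A section of the dual bundle is smooth if its pairing with a smooth frame is. -/
theorem contMDiffAt_dual {f : K → M} {σ : ∀ k, L.fib (f k)}
    {ξ : ∀ k, Module.Dual ℝ (L.fib (f k))} {k : K}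
    (hσ : ContMDiffAt I ((𝓡 n).prod 𝓘(ℝ, ℝ)) ∞ (fun k => TotalSpace.mk' ℝ (f k) (σ k)) k)
    (hσ₀ : σ k ≠ 0) (hξ : ContMDiffAt I 𝓘(ℝ, ℝ) ∞ (fun k => ξ k (σ k)) k) :
    ContMDiffAt I ((𝓡 n).prod 𝓘(ℝ, ℝ)) ∞
      (fun k => (TotalSpace.mk' ℝ (f k) (ξ k) : TotalSpace ℝ L.dual.fib)) k := by
  rw [contMDiffAt_iff] at hσ
  have hne : L.crd (f k) (f k) (σ k) ≠ 0 := L.crd_ne_zero (L.mem_base _) hσ₀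
  have hne' := hσ.2.continuousAt.eventually (isOpen_ne.mem_nhds hne)
  have hd := hξ.mul (((contDiffAt_inv ℝ hne).contMDiffAt (n := ∞)).comp k hσ.2)
  refine (contMDiffAt_iff (L := L.dual)).2 ⟨hσ.1, hd.congr_of_eventuallyEq ?_⟩
  filter_upwards [eventually_mem_base (L := L) hσ.1, hne'] with k' h₁ h₂
  have hfr : L.crd (f k) (f k') (L.frameAtlas.frame (f k) (f k')) = 1 := by
    rw [← L.coord_eq_crd h₁]
    exact L.frameAtlas.coord_frame _ _ h₁
  change ξ k' (L.frameAtlas.frame (f k) (f k')) = ξ k' (σ k') * (L.crd (f k) (f k') (σ k'))⁻¹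
  rw [L.eq_div_smul h₁ h₂ (L.frameAtlas.frame (f k) (f k')), hfr, map_smul, smul_eq_mul, mul_comm,
    one_div]

/-- The pairing of smooth sections is smooth. -/
theorem contMDiffAt_pairing {f : K → M} {σ : ∀ k, L.fib (f k)}
    {ξ : ∀ k, Module.Dual ℝ (L.fib (f k))} {k : K}
    (hσ : ContMDiffAt I ((𝓡 n).prod 𝓘(ℝ, ℝ)) ∞ (fun k => TotalSpace.mk' ℝ (f k) (σ k)) k)
    (hξ : ContMDiffAt I ((𝓡 n).prod 𝓘(ℝ, ℝ)) ∞
      (fun k => (TotalSpace.mk' ℝ (f k) (ξ k) : TotalSpace ℝ L.dual.fib)) k) :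
    ContMDiffAt I 𝓘(ℝ, ℝ) ∞ (fun k => ξ k (σ k)) k := by
  have h₁ := contMDiffAt_iff.1 hσ
  have h₂ := (contMDiffAt_iff (L := L.dual)).1 hξ
  refine (h₁.2.mul h₂.2).congr_of_eventuallyEq ?_
  filter_upwards [eventually_mem_base (L := L) h₁.1] with k' hk'
  change _ = L.crd (f k) (f k') (σ k') * ξ k' (L.frameAtlas.frame (f k) (f k'))
  rw [← L.coord_eq_crd hk', ← smul_eq_mul, ← map_smul, L.frameAtlas.coord_smul_frame _ _ hk']

theorem contMDiffAt_trivial {f : K → M} {c : K → ℝ} {k : K} (hf : ContMDiffAt I (𝓡 n) ∞ f k)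
    (hc : ContMDiffAt I 𝓘(ℝ, ℝ) ∞ c k) : ContMDiffAt I ((𝓡 n).prod 𝓘(ℝ, ℝ)) ∞
      (fun k => (TotalSpace.mk' ℝ (f k) ⟨c k⟩ : TotalSpace ℝ (trivial.{u, v} n M).fib)) k :=
  (contMDiffAt_iff (L := trivial.{u, v} n M)).2 ⟨hf, hc⟩

end LineBundle

/-! ### One-dimensional representations -/

namespace LieGroupoid

variable {n m : ℕ} {M : Type u} {G : Type w}
  [TopologicalSpace M] [ChartedSpace (EuclideanSpace ℝ (Fin n)) M]
  [TopologicalSpace G] [ChartedSpace (EuclideanSpace ℝ (Fin m)) G]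

/-- The inverse of an arrow. -/
def Arrow.symm {𝒢 : LieGroupoid n m M G} {x y : M} (g : 𝒢.Arrow x y) : 𝒢.Arrow y x :=
  ⟨𝒢.inv g.1, (𝒢.src_inv _).trans g.2.2, (𝒢.tgt_inv _).trans g.2.1⟩

theorem Arrow.symm_comp {𝒢 : LieGroupoid n m M G} {x y : M} (g : 𝒢.Arrow x y) :
    g.symm.comp g = 𝒢.unit x := by
  obtain ⟨g, rfl, rfl⟩ := g
  exact Subtype.ext (𝒢.inv_mul g)

theorem Arrow.comp_symm {𝒢 : LieGroupoid n m M G} {x y : M} (g : 𝒢.Arrow x y) :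
    g.comp g.symm = 𝒢.unit y := by
  obtain ⟨g, rfl, rfl⟩ := g
  exact Subtype.ext (𝒢.mul_inv g)

theorem Arrow.unit_comp {𝒢 : LieGroupoid n m M G} {x y : M} (g : 𝒢.Arrow x y) :
    (𝒢.unit y).comp g = g := by
  obtain ⟨g, rfl, rfl⟩ := g
  exact Subtype.ext (𝒢.one_mul g)

theorem Arrow.comp_assoc {𝒢 : LieGroupoid n m M G} {x y z t : M} (g : 𝒢.Arrow z t)
    (h : 𝒢.Arrow y z) (k : 𝒢.Arrow x y) : (g.comp h).comp k = g.comp (h.comp k) :=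
  Subtype.ext (𝒢.mul_assoc _ _ _ (g.2.1.trans h.2.2.symm) (h.2.1.trans k.2.2.symm))

theorem Arrow.symm_unit (𝒢 : LieGroupoid n m M G) (x : M) : (𝒢.unit x).symm = 𝒢.unit x := by
  have h := (𝒢.unit x).comp_symm
  rwa [Arrow.unit_comp] at h

theorem Arrow.symm_comp_rev {𝒢 : LieGroupoid n m M G} {x y z : M} (g : 𝒢.Arrow y z)
    (h : 𝒢.Arrow x y) : (g.comp h).symm = h.symm.comp g.symm := by
  have e : (h.symm.comp g.symm).comp (g.comp h) = 𝒢.unit x := by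
    rw [Arrow.comp_assoc, ← Arrow.comp_assoc g.symm, g.symm_comp, Arrow.unit_comp, h.symm_comp]
  have e' : ((h.symm.comp g.symm).comp (g.comp h)).comp (g.comp h).symm = (g.comp h).symm := by
    rw [e, Arrow.unit_comp]
  rw [← e', Arrow.comp_assoc, Arrow.comp_symm]
  refine Subtype.ext ?_
  have := 𝒢.mul_one (h.symm.comp g.symm).1
  rw [(h.symm.comp g.symm).2.1] at this
  exact this

end LieGroupoid

/-- A 1-dimensional representation of a Lie groupoid: a smooth line bundle `L` over the base
together with a linear action `g : L_x → L_y` of the arrows `g : x → y`, compatible with units and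
composition, such that the action map, from the pull-back of `L` along the source map to `L`, is
smooth. -/
structure LineRep {n m : ℕ} {M : Type u} {G : Type w}
    [TopologicalSpace M] [ChartedSpace (EuclideanSpace ℝ (Fin n)) M]
    [TopologicalSpace G] [ChartedSpace (EuclideanSpace ℝ (Fin m)) G] (𝒢 : LieGroupoid n m M G)
    extends LineBundle.{u, v} n M where
  act : ∀ {x y : M}, 𝒢.Arrow x y → (fib x →ₗ[ℝ] fib y)
  act_unit : ∀ x, act (𝒢.unit x) = LinearMap.id
  act_comp : ∀ {x y z : M} (g : 𝒢.Arrow y z) (h : 𝒢.Arrow x y), act (g.comp h) = act g ∘ₗ act h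
  contMDiff_act : ContMDiff ((𝓡 m).prod 𝓘(ℝ, ℝ)) ((𝓡 n).prod 𝓘(ℝ, ℝ)) ∞
    (fun p : TotalSpace ℝ (toLineBundle.pull 𝒢.src).fib =>
      TotalSpace.mk' ℝ (𝒢.tgt p.1) (act (𝒢.arrow p.1) p.2))

namespace LineRep

open LineBundle LieGroupoid

variable {n m : ℕ} {M : Type u} {G : Type w}
  [TopologicalSpace M] [ChartedSpace (EuclideanSpace ℝ (Fin n)) M]
  [TopologicalSpace G] [ChartedSpace (EuclideanSpace ℝ (Fin m)) G] {𝒢 : LieGroupoid n m M G}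
  {E : Type*} [NormedAddCommGroup E] [NormedSpace ℝ E] {H : Type*} [TopologicalSpace H]
  {I : ModelWithCorners ℝ E H} {K : Type*} [TopologicalSpace K] [ChartedSpace H K]

theorem act_symm_act (L : LineRep.{u, v} 𝒢) {x y : M} (g : 𝒢.Arrow x y) (a : L.fib x) :
    L.act g.symm (L.act g a) = a := by
  rw [← LinearMap.comp_apply, ← L.act_comp, g.symm_comp, L.act_unit]; rfl

theorem act_act_symm (L : LineRep.{u, v} 𝒢) {x y : M} (g : 𝒢.Arrow x y) (a : L.fib y) :
    L.act g (L.act g.symm a) = a := by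
  rw [← LinearMap.comp_apply, ← L.act_comp, g.comp_symm, L.act_unit]; rfl

theorem act_ne_zero (L : LineRep.{u, v} 𝒢) {x y : M} (g : 𝒢.Arrow x y) {a : L.fib x}
    (h : a ≠ 0) : L.act g a ≠ 0 := fun h' => h (by rw [← L.act_symm_act g a, h', map_zero])

/-- The action sends smooth sections of the pull-back along the source to smooth sections of
the pull-back along the target. -/
theorem contMDiffAt_act (L : LineRep.{u, v} 𝒢) {γ : K → G} {σ : ∀ k, L.fib (𝒢.src (γ k))} {k : K}
    (hγ : ContMDiffAt I (𝓡 m) ∞ γ k)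
    (hσ : ContMDiffAt I ((𝓡 n).prod 𝓘(ℝ, ℝ)) ∞
      (fun k => TotalSpace.mk' ℝ (𝒢.src (γ k)) (σ k)) k) :
    ContMDiffAt I ((𝓡 n).prod 𝓘(ℝ, ℝ)) ∞
      (fun k => TotalSpace.mk' ℝ (𝒢.tgt (γ k)) (L.act (𝒢.arrow (γ k)) (σ k))) k :=
  ContMDiffAt.comp_of_eq L.contMDiff_act.contMDiffAt (contMDiffAt_pull_iff.2 ⟨hγ, hσ⟩) rfl

theorem mk_act_eq (L : LineRep.{u, v} 𝒢) {x y : M} (g : 𝒢.Arrow x y) (σ : ∀ x, L.fib x) :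
    TotalSpace.mk' ℝ y (L.act g (σ x)) =
      TotalSpace.mk' ℝ (𝒢.tgt g.1) (L.act (𝒢.arrow g.1) (σ (𝒢.src g.1))) := by
  obtain ⟨g, rfl, rfl⟩ := g
  rfl

/-- An action on a line bundle is smooth if it is so on a smooth local frame near each point. -/
theorem contMDiff_act_of_frames (L : LineBundle.{u, v} n M)
    (act : ∀ {x y : M}, 𝒢.Arrow x y → (L.fib x →ₗ[ℝ] L.fib y))
    (h : ∀ g, ∃ σ : ∀ x, L.fib x, L.SmoothAt σ (𝒢.src g) ∧ σ (𝒢.src g) ≠ 0 ∧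
      ContMDiffAt (𝓡 m) ((𝓡 n).prod 𝓘(ℝ, ℝ)) ∞
        (fun g => TotalSpace.mk' ℝ (𝒢.tgt g) (act (𝒢.arrow g) (σ (𝒢.src g)))) g) :
    ContMDiff ((𝓡 m).prod 𝓘(ℝ, ℝ)) ((𝓡 n).prod 𝓘(ℝ, ℝ)) ∞
      (fun p : TotalSpace ℝ (L.pull 𝒢.src).fib =>
        TotalSpace.mk' ℝ (𝒢.tgt p.1) (act (𝒢.arrow p.1) p.2)) := by
  refine contMDiff_of_frames (L := L.pull 𝒢.src) (L' := L) (f := 𝒢.tgt)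
    (fun g => act (𝒢.arrow g)) fun g => ?_
  obtain ⟨σ, h₁, h₂, h₃⟩ := h g
  exact ⟨fun g => σ (𝒢.src g), contMDiffAt_pull_iff.2
    ⟨contMDiffAt_id, h₁.comp_of_eq 𝒢.src.contMDiff.contMDiffAt rfl⟩, h₂, h₃⟩

theorem tmul_ne_zero {L L' : LineBundle.{u, v} n M} {x : M} {a : L.fib x} {b : L'.fib x}
    (ha : a ≠ 0) (hb : b ≠ 0) : (a ⊗ₜ[ℝ] b : L.fib x ⊗[ℝ] L'.fib x) ≠ 0 := by
  intro h
  have h₁ := congrArg (L.frameAtlas.tensor L'.frameAtlas |>.coord x x) h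
  have h₂ : L.crd x x a * L'.crd x x b = 0 := by
    rw [← L.coord_eq_crd (L.mem_base x), ← L'.coord_eq_crd (L'.mem_base x)]
    simpa [FrameAtlas.tensor] using h₁
  exact mul_ne_zero (L.crd_ne_zero (L.mem_base x) ha) (L'.crd_ne_zero (L'.mem_base x) hb) h₂

/-- The tensor product of two 1-dimensional representations, with `g (a ⊗ b) = g a ⊗ g b`. -/
def tensor (L L' : LineRep.{u, v} 𝒢) : LineRep.{u, v} 𝒢 where
  toLineBundle := L.toLineBundle.tensor L'.toLineBundle
  act g := TensorProduct.map (L.act g) (L'.act g)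
  act_unit x := by
    rw [L.act_unit, L'.act_unit]
    exact TensorProduct.map_id
  act_comp g h := by
    rw [L.act_comp, L'.act_comp]
    exact TensorProduct.map_comp _ _ _ _
  contMDiff_act := by
    refine contMDiff_act_of_frames (L.toLineBundle.tensor L'.toLineBundle)
      (fun g => TensorProduct.map (L.act g) (L'.act g)) fun g => ?_
    obtain ⟨σ, hσ, hσ₀⟩ := L.toLineBundle.exists_frame (𝒢.src g)
    obtain ⟨τ, hτ, hτ₀⟩ := L'.toLineBundle.exists_frame (𝒢.src g)
    have hs := 𝒢.src.contMDiff.contMDiffAt (x := g)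
    exact ⟨fun x => σ x ⊗ₜ τ x, contMDiffAt_tmul hσ hτ, tmul_ne_zero hσ₀ hτ₀,
      contMDiffAt_tmul (L.contMDiffAt_act contMDiffAt_id (hσ.comp_of_eq hs rfl))
        (L'.contMDiffAt_act contMDiffAt_id (hτ.comp_of_eq hs rfl))⟩

/-- The trivial 1-dimensional representation. -/
def trivial (𝒢 : LieGroupoid n m M G) : LineRep.{u, v} 𝒢 where
  toLineBundle := LineBundle.trivial n M
  act _ := LinearMap.id
  act_unit _ := rfl
  act_comp _ _ := rfl
  contMDiff_act := by
    refine contMDiff_act_of_frames (LineBundle.trivial n M) (fun _ => LinearMap.id) fun g => ?_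
    refine ⟨fun _ => ⟨1⟩, contMDiffAt_trivial contMDiffAt_id contMDiffAt_const, ?_,
      contMDiffAt_trivial 𝒢.tgt.contMDiff.contMDiffAt contMDiffAt_const⟩
    exact fun h => one_ne_zero (congrArg ULift.down h)

/-- The dual of a 1-dimensional representation, with `g ξ = ξ ∘ g⁻¹`. -/
def dual (L : LineRep.{u, v} 𝒢) : LineRep.{u, v} 𝒢 where
  toLineBundle := L.toLineBundle.dual
  act g := (L.act g.symm).dualMap
  act_unit x := by
    rw [Arrow.symm_unit, L.act_unit]
    exact LinearMap.dualMap_id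
  act_comp g h := by
    rw [Arrow.symm_comp_rev, L.act_comp]
    exact (LinearMap.dualMap_comp_dualMap _ _).symm
  contMDiff_act := by
    refine contMDiff_act_of_frames L.toLineBundle.dual (fun g => (L.act g.symm).dualMap)
      fun g => ?_
    obtain ⟨ξ, hξ, hξ₀⟩ := L.toLineBundle.dual.exists_frame (𝒢.src g)
    obtain ⟨τ, hτ, hτ₀⟩ := L.toLineBundle.exists_frame (𝒢.tgt g)
    refine ⟨ξ, hξ, hξ₀, ?_⟩
    have hs := 𝒢.src.contMDiff.contMDiffAt (x := g)
    have ht := 𝒢.tgt.contMDiff.contMDiffAt (x := g)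
    have hi := 𝒢.inv.contMDiff.contMDiffAt (x := g)
    refine contMDiffAt_dual (L := L.toLineBundle) (f := 𝒢.tgt) (σ := fun g => τ (𝒢.tgt g))
      (hτ.comp_of_eq ht rfl) hτ₀ ?_
    refine contMDiffAt_pairing (L := L.toLineBundle) (f := 𝒢.src)
      (σ := fun g => L.act (𝒢.arrow g).symm (τ (𝒢.tgt g))) (ξ := fun g => ξ (𝒢.src g)) ?_
      (hξ.comp_of_eq hs rfl)
    have e : (fun g => TotalSpace.mk' ℝ (𝒢.src g) (L.act (𝒢.arrow g).symm (τ (𝒢.tgt g)))) =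
        fun g => TotalSpace.mk' ℝ (𝒢.tgt (𝒢.inv g))
          (L.act (𝒢.arrow (𝒢.inv g)) (τ (𝒢.src (𝒢.inv g)))) :=
      funext fun g => L.mk_act_eq (𝒢.arrow g).symm τ
    rw [e]
    exact L.contMDiffAt_act hi (hτ.comp_of_eq (𝒢.src.contMDiff.contMDiffAt.comp g hi)
      (𝒢.src_inv g))

/-- An isomorphism of 1-dimensional representations: an equivariant isomorphism of smooth line
bundles. -/
structure Iso (L L' : LineRep.{u, v} 𝒢) where
  equiv : ∀ x, L.fib x ≃ₗ[ℝ] L'.fib x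
  equiv_act : ∀ {x y : M} (g : 𝒢.Arrow x y) (a : L.fib x),
    equiv y (L.act g a) = L'.act g (equiv x a)
  contMDiff_equiv : ContMDiff ((𝓡 n).prod 𝓘(ℝ, ℝ)) ((𝓡 n).prod 𝓘(ℝ, ℝ)) ∞
    (fun p : TotalSpace ℝ L.fib => TotalSpace.mk' ℝ p.1 (equiv p.1 p.2))
  contMDiff_symm : ContMDiff ((𝓡 n).prod 𝓘(ℝ, ℝ)) ((𝓡 n).prod 𝓘(ℝ, ℝ)) ∞
    (fun p : TotalSpace ℝ L'.fib => TotalSpace.mk' ℝ p.1 ((equiv p.1).symm p.2))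

theorem Iso.smoothAt {L L' : LineRep.{u, v} 𝒢} (F : Iso L L') {σ : ∀ x, L.fib x} {x : M}
    (hσ : L.SmoothAt σ x) : L'.SmoothAt (fun x => F.equiv x (σ x)) x :=
  ContMDiffAt.comp_of_eq F.contMDiff_equiv.contMDiffAt hσ rfl

/-- An equivariant isomorphism that near each point sends a smooth frame to a smooth section is an
isomorphism of representations. -/
def Iso.ofFrames {L L' : LineRep.{u, v} 𝒢} (equiv : ∀ x, L.fib x ≃ₗ[ℝ] L'.fib x)
    (equiv_act : ∀ {x y : M} (g : 𝒢.Arrow x y) (a : L.fib x),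
      equiv y (L.act g a) = L'.act g (equiv x a))
    (h : ∀ x, ∃ σ : ∀ x, L.fib x, L.SmoothAt σ x ∧ σ x ≠ 0 ∧
      L'.SmoothAt (fun x => equiv x (σ x)) x) : Iso L L' where
  equiv := equiv
  equiv_act := equiv_act
  contMDiff_equiv := contMDiff_of_frames (L := L.toLineBundle) (L' := L'.toLineBundle) (f := id)
    (fun x => (equiv x).toLinearMap) h
  contMDiff_symm := by
    refine contMDiff_of_frames (L := L'.toLineBundle) (L' := L.toLineBundle) (f := id)
      (fun x => (equiv x).symm.toLinearMap) fun x => ?_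
    obtain ⟨σ, h₁, h₂, h₃⟩ := h x
    refine ⟨fun x => equiv x (σ x), h₃, (equiv x).map_ne_zero_iff.2 h₂, ?_⟩
    have e : (fun x => TotalSpace.mk' ℝ (id x) ((equiv x).symm.toLinearMap (equiv x (σ x)))) =
        fun x => TotalSpace.mk' ℝ x (σ x) :=
      funext fun x => congrArg (TotalSpace.mk' ℝ x) ((equiv x).symm_apply_apply (σ x))
    exact e ▸ h₁

/-- Being isomorphic. -/
instance setoid (𝒢 : LieGroupoid n m M G) : Setoid (LineRep.{u, v} 𝒢) where
  r L L' := Nonempty (Iso L L')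
  iseqv :=
    { refl := fun L => ⟨⟨fun _ => .refl ℝ _, fun _ _ => rfl, contMDiff_id, contMDiff_id⟩⟩
      symm := by
        rintro L L' ⟨F⟩
        refine ⟨⟨fun x => (F.equiv x).symm, fun {x y} g a => ?_, F.contMDiff_symm,
          F.contMDiff_equiv⟩⟩
        rw [LinearEquiv.symm_apply_eq, F.equiv_act, LinearEquiv.apply_symm_apply]
      trans := by
        rintro L L' L'' ⟨F⟩ ⟨F'⟩
        refine ⟨⟨fun x => (F.equiv x).trans (F'.equiv x), fun {x y} g a => ?_,
          F'.contMDiff_equiv.comp F.contMDiff_equiv, F.contMDiff_symm.comp F'.contMDiff_symm⟩⟩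
        simp only [LinearEquiv.trans_apply, F.equiv_act, F'.equiv_act] }

/-- Tensor products of isomorphisms. -/
def Iso.tensor {L₁ L₁' L₂ L₂' : LineRep.{u, v} 𝒢} (F₁ : Iso L₁ L₁') (F₂ : Iso L₂ L₂') :
    Iso (L₁.tensor L₂) (L₁'.tensor L₂') :=
  .ofFrames (fun x => TensorProduct.congr (F₁.equiv x) (F₂.equiv x))
    (fun {x y} g => LinearMap.congr_fun (f :=
      (TensorProduct.congr (F₁.equiv y) (F₂.equiv y)).toLinearMap ∘ₗ
        TensorProduct.map (L₁.act g) (L₂.act g)) (g :=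
      TensorProduct.map (L₁'.act g) (L₂'.act g) ∘ₗ
        (TensorProduct.congr (F₁.equiv x) (F₂.equiv x)).toLinearMap)
      (TensorProduct.ext' fun a b =>
        congrArg₂ (fun a b => a ⊗ₜ[ℝ] b) (F₁.equiv_act g a) (F₂.equiv_act g b)))
    (fun x => by
      obtain ⟨σ, hσ, hσ₀⟩ := L₁.toLineBundle.exists_frame x
      obtain ⟨τ, hτ, hτ₀⟩ := L₂.toLineBundle.exists_frame x
      exact ⟨fun x => σ x ⊗ₜ τ x, contMDiffAt_tmul hσ hτ, tmul_ne_zero hσ₀ hτ₀,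
        contMDiffAt_tmul (F₁.smoothAt hσ) (F₂.smoothAt hτ)⟩)

theorem tensor_comm (L L' : LineRep.{u, v} 𝒢) : Nonempty (Iso (L.tensor L') (L'.tensor L)) :=
  ⟨.ofFrames (fun x => TensorProduct.comm ℝ (L.fib x) (L'.fib x))
    (fun {x y} g => LinearMap.congr_fun (f :=
      (TensorProduct.comm ℝ (L.fib y) (L'.fib y)).toLinearMap ∘ₗ
        TensorProduct.map (L.act g) (L'.act g)) (g :=
      TensorProduct.map (L'.act g) (L.act g) ∘ₗ
        (TensorProduct.comm ℝ (L.fib x) (L'.fib x)).toLinearMap)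
      (TensorProduct.ext' fun _ _ => rfl))
    (fun x => by
      obtain ⟨σ, hσ, hσ₀⟩ := L.toLineBundle.exists_frame x
      obtain ⟨τ, hτ, hτ₀⟩ := L'.toLineBundle.exists_frame x
      exact ⟨fun x => σ x ⊗ₜ τ x, contMDiffAt_tmul hσ hτ, tmul_ne_zero hσ₀ hτ₀,
        contMDiffAt_tmul hτ hσ⟩)⟩

theorem tensor_assoc (L₁ L₂ L₃ : LineRep.{u, v} 𝒢) :
    Nonempty (Iso ((L₁.tensor L₂).tensor L₃) (L₁.tensor (L₂.tensor L₃))) :=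
  ⟨.ofFrames (fun x => TensorProduct.assoc ℝ (L₁.fib x) (L₂.fib x) (L₃.fib x))
    (fun {x y} g => LinearMap.congr_fun (f :=
      (TensorProduct.assoc ℝ (L₁.fib y) (L₂.fib y) (L₃.fib y)).toLinearMap ∘ₗ
        TensorProduct.map (TensorProduct.map (L₁.act g) (L₂.act g)) (L₃.act g)) (g :=
      TensorProduct.map (L₁.act g) (TensorProduct.map (L₂.act g) (L₃.act g)) ∘ₗ
        (TensorProduct.assoc ℝ (L₁.fib x) (L₂.fib x) (L₃.fib x)).toLinearMap)
      (TensorProduct.ext_threefold fun _ _ _ => rfl))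
    (fun x => by
      obtain ⟨σ, hσ, hσ₀⟩ := L₁.toLineBundle.exists_frame x
      obtain ⟨τ, hτ, hτ₀⟩ := L₂.toLineBundle.exists_frame x
      obtain ⟨ρ, hρ, hρ₀⟩ := L₃.toLineBundle.exists_frame x
      exact ⟨fun x => (σ x ⊗ₜ τ x) ⊗ₜ ρ x,
        contMDiffAt_tmul (L := L₁.toLineBundle.tensor L₂.toLineBundle) (contMDiffAt_tmul hσ hτ) hρ,
        tmul_ne_zero (L := L₁.toLineBundle.tensor L₂.toLineBundle) (tmul_ne_zero hσ₀ hτ₀) hρ₀,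
        contMDiffAt_tmul (L' := L₂.toLineBundle.tensor L₃.toLineBundle) hσ
          (contMDiffAt_tmul hτ hρ)⟩)⟩

theorem trivial_tensor (L : LineRep.{u, v} 𝒢) : Nonempty (Iso ((trivial 𝒢).tensor L) L) :=
  ⟨.ofFrames (fun x => (TensorProduct.congr ULift.moduleEquiv (.refl ℝ (L.fib x))).trans
      (TensorProduct.lid ℝ (L.fib x)))
    (fun {x y} g => LinearMap.congr_fun (f :=
      ((TensorProduct.congr ULift.moduleEquiv (.refl ℝ (L.fib y))).trans
        (TensorProduct.lid ℝ (L.fib y))).toLinearMap ∘ₗ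
        TensorProduct.map LinearMap.id (L.act g)) (g := L.act g ∘ₗ
      ((TensorProduct.congr ULift.moduleEquiv (.refl ℝ (L.fib x))).trans
        (TensorProduct.lid ℝ (L.fib x))).toLinearMap)
      (TensorProduct.ext' fun a b => ((L.act g).map_smul a.down b).symm))
    (fun x => by
      obtain ⟨σ, hσ, hσ₀⟩ := L.toLineBundle.exists_frame x
      have h₁ : (LineBundle.trivial.{u, v} n M).SmoothAt (fun _ => (⟨1⟩ : ULift ℝ)) x :=
        contMDiffAt_trivial contMDiffAt_id contMDiffAt_const
      refine ⟨fun x => (⟨1⟩ : ULift ℝ) ⊗ₜ σ x, contMDiffAt_tmul h₁ hσ,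
        tmul_ne_zero (L := LineBundle.trivial.{u, v} n M)
          (fun h => one_ne_zero (congrArg ULift.down h)) hσ₀,
        contMDiffAt_smul hσ (contMDiffAt_const (c := (1 : ℝ)))⟩)⟩

/-- The evaluation map, for a 1-dimensional space with a nonzero functional. -/
def evalEquiv (L : LineBundle.{u, v} n M) (x : M) :
    (Module.Dual ℝ (L.fib x) ⊗[ℝ] L.fib x) ≃ₗ[ℝ] ULift.{v} ℝ :=
  (LinearEquiv.ofBijective (contractLeft ℝ (L.fib x)) (by
    have h₁ : contractLeft ℝ (L.fib x) (L.frameAtlas.coord x x ⊗ₜ L.frameAtlas.frame x x) = 1 :=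
      L.frameAtlas.coord_frame x x (L.mem_base x)
    refine ⟨(injective_iff_map_eq_zero _).2 fun a ha => ?_, fun c =>
      ⟨c • (L.frameAtlas.coord x x ⊗ₜ L.frameAtlas.frame x x), by
        rw [map_smul, h₁, smul_eq_mul, _root_.mul_one]⟩⟩
    have h₂ := (L.frameAtlas.dual.tensor L.frameAtlas).coord_smul_frame x x
      ⟨L.mem_base x, L.mem_base x⟩ a
    rw [← h₂] at ha ⊢
    rw [map_smul] at ha
    have h₃ := (congrArg _ h₁.symm).trans ha
    rw [smul_eq_mul, _root_.mul_one] at h₃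
    rw [h₃, zero_smul])).trans ULift.moduleEquiv.symm

theorem dual_tensor (L : LineRep.{u, v} 𝒢) : Nonempty (Iso (L.dual.tensor L) (trivial 𝒢)) :=
  ⟨.ofFrames (fun x => evalEquiv L.toLineBundle x)
    (fun {x y} g => LinearMap.congr_fun (f := (evalEquiv L.toLineBundle y).toLinearMap ∘ₗ
        TensorProduct.map (L.act g.symm).dualMap (L.act g)) (g :=
      (evalEquiv L.toLineBundle x).toLinearMap)
      (TensorProduct.ext' fun ξ b =>
        congrArg (fun b => (ULift.up (ξ b) : ULift.{v} ℝ)) (L.act_symm_act g b)))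
    (fun x => by
      obtain ⟨ξ, hξ, hξ₀⟩ := L.toLineBundle.dual.exists_frame x
      obtain ⟨τ, hτ, hτ₀⟩ := L.toLineBundle.exists_frame x
      exact ⟨fun x => ξ x ⊗ₜ τ x, contMDiffAt_tmul hξ hτ,
        tmul_ne_zero (L := L.toLineBundle.dual) hξ₀ hτ₀,
        contMDiffAt_trivial contMDiffAt_id (contMDiffAt_pairing hτ hξ)⟩)⟩

end LineRep

/-- The set of isomorphism classes of 1-dimensional representations of a Lie groupoid. -/
abbrev LieGroupoid.Rep1 {n m : ℕ} {M : Type u} {G : Type w}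
    [TopologicalSpace M] [ChartedSpace (EuclideanSpace ℝ (Fin n)) M]
    [TopologicalSpace G] [ChartedSpace (EuclideanSpace ℝ (Fin m)) G] (𝒢 : LieGroupoid n m M G) :=
  Quotient (LineRep.setoid.{u, v, w} 𝒢)

namespace LineRep

open LineBundle LieGroupoid

variable {n m : ℕ} {M : Type u} {G : Type w}
  [TopologicalSpace M] [ChartedSpace (EuclideanSpace ℝ (Fin n)) M]
  [TopologicalSpace G] [ChartedSpace (EuclideanSpace ℝ (Fin m)) G] {𝒢 : LieGroupoid n m M G}
  {n' m' : ℕ} {M' : Type u'} {G' : Type w'}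
  [TopologicalSpace M'] [ChartedSpace (EuclideanSpace ℝ (Fin n')) M']
  [TopologicalSpace G'] [ChartedSpace (EuclideanSpace ℝ (Fin m')) G']
  {𝒢' : LieGroupoid n' m' M' G'}

/-- The product of isomorphism classes of 1-dimensional representations is the tensor product, the
unit is the trivial representation. -/
instance : CommMonoid (LieGroupoid.Rep1.{u, v, w} 𝒢) where
  mul := Quotient.map₂ tensor fun _ _ ⟨F⟩ _ _ ⟨F'⟩ => ⟨F.tensor F'⟩
  one := ⟦trivial 𝒢⟧
  mul_assoc := by
    rintro ⟨L₁⟩ ⟨L₂⟩ ⟨L₃⟩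
    exact Quotient.sound (tensor_assoc L₁ L₂ L₃)
  mul_comm := by
    rintro ⟨L₁⟩ ⟨L₂⟩
    exact Quotient.sound (tensor_comm L₁ L₂)
  one_mul := by
    rintro ⟨L⟩
    exact Quotient.sound (trivial_tensor L)
  mul_one := by
    rintro ⟨L⟩
    exact Quotient.sound (Setoid.trans (tensor_comm L (trivial 𝒢)) (trivial_tensor L))

theorem mk_dual_mul (L : LineRep.{u, v} 𝒢) :
    (⟦L.dual⟧ * ⟦L⟧ : LieGroupoid.Rep1.{u, v, w} 𝒢) = 1 := Quotient.sound (dual_tensor L)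

/-- The group of isomorphism classes of 1-dimensional representations; the inverse is given by the
dual. -/
instance : CommGroup (LieGroupoid.Rep1.{u, v, w} 𝒢) where
  inv := Quotient.map dual fun L L' h => by
    have e : (⟦L⟧ : LieGroupoid.Rep1.{u, v, w} 𝒢) = ⟦L'⟧ := Quotient.sound h
    refine Quotient.exact (?_ : (⟦L.dual⟧ : LieGroupoid.Rep1.{u, v, w} 𝒢) = ⟦L'.dual⟧)
    refine left_inv_eq_right_inv (mk_dual_mul L) ?_
    rw [mul_comm, e, mk_dual_mul]
  inv_mul_cancel := by
    rintro ⟨L⟩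
    exact mk_dual_mul L

theorem mk_tensor (L L' : LineRep.{u, v} 𝒢) :
    (⟦L.tensor L'⟧ : LieGroupoid.Rep1.{u, v, w} 𝒢) = ⟦L⟧ * ⟦L'⟧ := rfl

theorem _root_.LieGroupoid.Hom.map_unit (Φ : 𝒢'.Hom 𝒢) (x : M') :
    Φ.map (𝒢'.unit x) = 𝒢.unit (Φ.base x) := Subtype.ext (Φ.arr_one x)

theorem _root_.LieGroupoid.Hom.map_comp (Φ : 𝒢'.Hom 𝒢) {x y z : M'} (g : 𝒢'.Arrow y z)
    (h : 𝒢'.Arrow x y) : Φ.map (g.comp h) = (Φ.map g).comp (Φ.map h) :=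
  Subtype.ext (Φ.arr_mul _ _ (g.2.1.trans h.2.2.symm))

/-- The pull-back of a 1-dimensional representation along a morphism of Lie groupoids. -/
def pull (Φ : 𝒢'.Hom 𝒢) (L : LineRep.{u, v} 𝒢) : LineRep.{u', v} 𝒢' where
  toLineBundle := L.toLineBundle.pull Φ.base
  act g := L.act (Φ.map g)
  act_unit x := by
    rw [Φ.map_unit]
    exact L.act_unit (Φ.base x)
  act_comp g h := by
    rw [Φ.map_comp]
    exact L.act_comp (Φ.map g) (Φ.map h)
  contMDiff_act := by
    refine contMDiff_act_of_frames (L.toLineBundle.pull Φ.base) (fun g => L.act (Φ.map g))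
      fun g => ?_
    obtain ⟨τ, hτ, hτ₀⟩ := L.toLineBundle.exists_frame (Φ.base (𝒢'.src g))
    have hb := Φ.base.contMDiff.contMDiffAt (x := 𝒢'.src g)
    refine ⟨fun x => τ (Φ.base x), contMDiffAt_pull_iff.2
      ⟨contMDiffAt_id, hτ.comp_of_eq hb rfl⟩, hτ₀,
      contMDiffAt_pull_iff.2 ⟨𝒢'.tgt.contMDiff.contMDiffAt, ?_⟩⟩
    have e : (fun g => TotalSpace.mk' ℝ (Φ.base (𝒢'.tgt g))
        (L.act (Φ.map (𝒢'.arrow g)) (τ (Φ.base (𝒢'.src g))))) =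
        fun g => TotalSpace.mk' ℝ (𝒢.tgt (Φ.arr g))
          (L.act (𝒢.arrow (Φ.arr g)) (τ (𝒢.src (Φ.arr g)))) :=
      funext fun g => L.mk_act_eq (Φ.map (𝒢'.arrow g)) τ
    have ha := Φ.arr.contMDiff.contMDiffAt (x := g)
    refine ContMDiffAt.congr_of_eventuallyEq ?_ (Filter.EventuallyEq.of_eq e)
    exact L.contMDiffAt_act ha (hτ.comp_of_eq (𝒢.src.contMDiff.contMDiffAt.comp g ha)
      (Φ.src_arr g))

/-- A nowhere vanishing smooth section of the underlying line bundle. -/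
structure Frame (L : LineRep.{u, v} 𝒢) where
  sec : ∀ x, L.fib x
  smooth : ContMDiff (𝓡 n) ((𝓡 n).prod 𝓘(ℝ, ℝ)) ∞ (fun x => TotalSpace.mk' ℝ x (sec x))
  ne_zero : ∀ x, sec x ≠ 0

variable {L : LineRep.{u, v} 𝒢} (σ : L.Frame)

theorem Frame.exists_unit (g : G) :
    ∃ a : ℝˣ, L.act (𝒢.arrow g) (σ.sec (𝒢.src g)) = (a : ℝ) • σ.sec (𝒢.tgt g) := by
  obtain ⟨a, ha⟩ := L.toLineBundle.exists_smul_eq (σ.ne_zero (𝒢.tgt g))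
    (L.act (𝒢.arrow g) (σ.sec (𝒢.src g)))
  have h₀ : a ≠ 0 := by
    rintro rfl
    rw [zero_smul] at ha
    exact L.act_ne_zero (𝒢.arrow g) (σ.ne_zero _) ha
  exact ⟨Units.mk0 a h₀, ha⟩

/-- The function `c` on the arrows with `g · σ(src g) = c(g) σ(tgt g)`, for a nowhere vanishing
section `σ`. -/
def Frame.coeff (g : G) : ℝˣ := (σ.exists_unit g).choose

theorem Frame.act_sec {x y : M} (g : 𝒢.Arrow x y) :
    L.act g (σ.sec x) = (σ.coeff g.1 : ℝ) • σ.sec y := by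
  obtain ⟨g, rfl, rfl⟩ := g
  exact (σ.exists_unit g).choose_spec

theorem Frame.contMDiff_coeff : ContMDiff (𝓡 m) 𝓘(ℝ, ℝ) ∞ σ.coeff := by
  refine ContMDiff.of_comp_isOpenEmbedding Units.isOpenEmbedding_val fun g => ?_
  refine contMDiffAt_coeff (L := L.toLineBundle) (f := 𝒢.tgt)
    (σ := fun g => σ.sec (𝒢.tgt g)) (τ := fun g => L.act (𝒢.arrow g) (σ.sec (𝒢.src g))) ?_ ?_
    (σ.ne_zero _) (Filter.Eventually.of_forall fun g => σ.act_sec (𝒢.arrow g))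
  · exact σ.smooth.contMDiffAt.comp_of_eq 𝒢.tgt.contMDiff.contMDiffAt rfl
  · exact L.contMDiffAt_act contMDiffAt_id
      (σ.smooth.contMDiffAt.comp_of_eq 𝒢.src.contMDiff.contMDiffAt rfl)

/-- The differentiable cocycle `c` with values in `ℝ^*` of a representation with a nowhere vanishing
section `σ`, defined by `g · σ(src g) = c(g) σ(tgt g)`. -/
def Frame.cocycle : 𝒢.Z1 𝓘(ℝ, ℝ) ℝˣ :=
  ⟨σ.coeff, σ.contMDiff_coeff, fun g h hgh => by
    let g' : 𝒢.Arrow (𝒢.src g) (𝒢.tgt g) := 𝒢.arrow g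
    let h' : 𝒢.Arrow (𝒢.src h) (𝒢.src g) := ⟨h, rfl, hgh.symm⟩
    have e := σ.act_sec (g'.comp h')
    rw [L.act_comp, LinearMap.comp_apply, σ.act_sec h', map_smul, σ.act_sec g', smul_smul] at e
    have e' := smul_left_injective ℝ (σ.ne_zero (𝒢.tgt g)) e
    refine Units.ext (e'.symm.trans ?_)
    exact mul_comm _ _⟩

/-- The class in `H^1(𝒢, ℝ^*)` of a representation with a nowhere vanishing section. -/
def Frame.extClass : 𝒢.H1 𝓘(ℝ, ℝ) ℝˣ := QuotientGroup.mk σ.cocycle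

end LineRep

end

/-!
Averaging a real cocycle over an open cover with respect to a partition of unity subordinate to the
cover changes it by a coboundary into one that is insensitive to the choice of copies, that is, into
a pull-back from `𝒢`. So real cohomology cannot see the cover, and `λ ↦ (ln |λ|, sign λ)` splits the
`ℝ^*`-valued Čech-type cohomology into the real cohomology of `𝒢` and a `ℤ₂`-valued part.

A representation is trivialized by some cover, and its `ℝ^*`-valued cocycle determines it: the
cocycle glues trivial line bundles back together, and a trivial class gives a frame over the cover
whose cocycle is `1`, which therefore descends to an invariant frame on `M`. The same averaging,
applied to `ln |c|`, normalizes the transition functions of a line bundle to `±1`; their squares are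
`1`, so `L ⊗ L` has a global frame.
-/

noncomputable section

/-! ### Functions on disjoint unions -/

namespace DisjUnion

variable {X : Type*} [TopologicalSpace X] {ι : Type*} {O : ι → Opens X}
  {H : Type*} [TopologicalSpace H] {E : Type*} [NormedAddCommGroup E] [NormedSpace ℝ E]
  {I : ModelWithCorners ℝ E H} [ChartedSpace H X]
  {Y : Type*} [TopologicalSpace Y] {H' : Type*} [TopologicalSpace H'] [ChartedSpace H' Y]
  {E' : Type*} [NormedAddCommGroup E'] [NormedSpace ℝ E'] {I' : ModelWithCorners ℝ E' H'}

theorem contMDiffAt_iff {f : Y → DisjUnion O} {y : Y} :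
    ContMDiffAt I' I ∞ f y ↔
      ContMDiffAt I' I ∞ (val ∘ f) y ∧ ∀ᶠ y' in 𝓝 y, (f y').idx = (f y).idx := by
  rw [← contMDiffWithinAt_univ, ← contMDiffWithinAt_univ, contMDiffWithinAt_iff, nhdsWithin_univ]

variable (I) in
theorem exists_contMDiffAt_section (p : DisjUnion O) :
    ∃ s : X → DisjUnion O, s p.val = p ∧ ContMDiffAt I I ∞ s p.val ∧
      ∀ᶠ x in 𝓝 p.val, (s x).val = x := by
  obtain ⟨e, hp, he⟩ := isLocalHomeomorph_val p
  have hp' : p.val ∈ e.target := he ▸ e.map_source hp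
  have hsp : e.symm p.val = p := he ▸ e.left_inv hp
  have hval : ∀ᶠ x in 𝓝 p.val, (e.symm x).val = x := by
    filter_upwards [e.open_target.mem_nhds hp'] with x hx
    rw [he, e.right_inv hx]
  refine ⟨e.symm, hsp, contMDiffAt_iff.2 ⟨contMDiffAt_id.congr_of_eventuallyEq hval, ?_⟩, hval⟩
  exact (e.symm.continuousAt hp').eventually (eventually_idx (e.symm p.val))

theorem contMDiffAt_comp_val_iff {ψ : X → Y} {p : DisjUnion O} :
    ContMDiffAt I I' ∞ (ψ ∘ val) p ↔ ContMDiffAt I I' ∞ ψ p.val := by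
  refine ⟨fun h => ?_, fun h => h.comp p contMDiff_val.contMDiffAt⟩
  obtain ⟨s, hsp, hs, hval⟩ := exists_contMDiffAt_section I p
  exact (h.comp_of_eq hs hsp).congr_of_eventuallyEq (hval.mono fun x hx => congrArg ψ hx.symm)

open Classical in
/-- The restriction of a function to the summand of index `i`, extended by the constant `y₀` to the
ambient space. -/
def extend {Z : Type*} (φ : DisjUnion O → Z) (y₀ : Z) (i : ι) (x : X) : Z :=
  if h : x ∈ O i then φ (mk i x h) else y₀

theorem extend_of_mem {Z : Type*} (φ : DisjUnion O → Z) (y₀ : Z) {i : ι} {x : X} (h : x ∈ O i) :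
    extend φ y₀ i x = φ (mk i x h) := dif_pos h

theorem contMDiffAt_extend {φ : DisjUnion O → Y} (hφ : ContMDiff I I' ∞ φ) (y₀ : Y) {i : ι} {x : X}
    (h : x ∈ O i) : ContMDiffAt I I' ∞ (extend φ y₀ i) x := by
  refine (contMDiffAt_comp_val_iff (p := mk i x h)).1 (hφ.contMDiffAt.congr_of_eventuallyEq ?_)
  filter_upwards [eventually_idx (mk i x h)] with q hq
  obtain rfl : q.idx = i := hq
  exact extend_of_mem φ y₀ q.val_mem

theorem exists_contMDiff_comp_val {φ : DisjUnion O → Y} (hφ : ContMDiff I I' ∞ φ)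
    (hval : Function.Surjective (val : DisjUnion O → X)) (h : Function.FactorsThrough φ val) :
    ∃ ψ : X → Y, ContMDiff I I' ∞ ψ ∧ ∀ p : DisjUnion O, ψ p.val = φ p := by
  have hψ : ∀ p : DisjUnion O, φ (Function.surjInv hval p.val) = φ p :=
    fun p => h (Function.surjInv_eq hval p.val)
  refine ⟨φ ∘ Function.surjInv hval, hval.forall.2 fun p => contMDiffAt_comp_val_iff.1 ?_, hψ⟩
  exact hφ.contMDiffAt.congr_of_eventuallyEq (.of_forall hψ)

end DisjUnion

/-! ### Arrows of the pull-back along an open cover -/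

namespace OpenCover

variable {M : Type u} [TopologicalSpace M] (𝒰 : OpenCover M)

theorem surjective_val : Function.Surjective (DisjUnion.val : 𝒰.Space → M) := fun x =>
  let ⟨U, hU, hx⟩ := 𝒰.covers x
  ⟨.mk ⟨U, hU⟩ x hx, rfl⟩

/-- A chosen copy of the point `x`; it depends on `x` in a possibly discontinuous way. -/
def point (x : M) : 𝒰.Space := Function.surjInv 𝒰.surjective_val x

theorem val_point (x : M) : (𝒰.point x).val = x := Function.surjInv_eq 𝒰.surjective_val x

theorem mem_point_idx (x : M) : x ∈ (𝒰.point x).idx.1 := by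
  simpa only [𝒰.val_point] using (𝒰.point x).val_mem

end OpenCover

namespace LieGroupoid

section Arrows

variable {n m : ℕ} {M : Type u} {G : Type w}
  [TopologicalSpace M] [ChartedSpace (EuclideanSpace ℝ (Fin n)) M]
  [TopologicalSpace G] [ChartedSpace (EuclideanSpace ℝ (Fin m)) G] {𝒢 : LieGroupoid n m M G}

theorem Arrow.comp_unit {x y : M} (g : 𝒢.Arrow x y) : g.comp (𝒢.unit x) = g := by
  obtain ⟨g, rfl, rfl⟩ := g
  exact Subtype.ext (𝒢.mul_one g)

theorem RealZ1.apply_comp (c : 𝒢.RealZ1) {x y z : M} (g : 𝒢.Arrow y z) (h : 𝒢.Arrow x y) :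
    c.1 (g.comp h).1 = c.1 g.1 + c.1 h.1 :=
  c.2.2 _ _ (g.2.1.trans h.2.2.symm)

theorem RealZ1.apply_unit (c : 𝒢.RealZ1) (x : M) : c.1 (𝒢.unit x).1 = 0 := by
  have h := RealZ1.apply_comp c (𝒢.unit x) (𝒢.unit x)
  rw [Arrow.unit_comp] at h
  exact left_eq_add.1 h

theorem contMDiffAt_extend_one {𝒰 : OpenCover M}
    {E' : Type*} [NormedAddCommGroup E'] [NormedSpace ℝ E'] {H' : Type*} [TopologicalSpace H']
    {I' : ModelWithCorners ℝ E' H'} {Y : Type*} [TopologicalSpace Y] [ChartedSpace H' Y]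
    {φ : 𝒢.CoverArrows 𝒰 → Y}
    (hφ : ContMDiff (𝓡 m) I' ∞ φ) (y₀ : Y) {U V : 𝒰.carrier} {x : M} (hU : x ∈ U.1)
    (hV : x ∈ V.1) :
    ContMDiffAt (𝓡 n) I' ∞ (fun x => DisjUnion.extend φ y₀ (U, V) (𝒢.one x)) x := by
  refine (DisjUnion.contMDiffAt_extend hφ y₀ ?_).comp x 𝒢.one.contMDiff.contMDiffAt
  exact ⟨by rwa [𝒢.src_one], by rwa [𝒢.tgt_one]⟩

variable {EA : Type*} [NormedAddCommGroup EA] [NormedSpace ℝ EA]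
  {HA : Type*} [TopologicalSpace HA] {IA : ModelWithCorners ℝ EA HA}
  {A : Type*} [CommGroup A] [TopologicalSpace A] [ChartedSpace HA A] [LieGroup IA ∞ A]

theorem Z1.apply_comp (c : 𝒢.Z1 IA A) {x y z : M} (g : 𝒢.Arrow y z) (h : 𝒢.Arrow x y) :
    c.1 (g.comp h).1 = c.1 g.1 * c.1 h.1 :=
  c.2.2 _ _ (g.2.1.trans h.2.2.symm)

theorem Z1.apply_unit (c : 𝒢.Z1 IA A) (x : M) : c.1 (𝒢.unit x).1 = 1 := by
  have h := Z1.apply_comp c (𝒢.unit x) (𝒢.unit x)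
  rw [Arrow.unit_comp] at h
  exact left_eq_mul.1 h

variable [IsManifold (𝓡 n) ∞ M] [IsManifold (𝓡 m) ∞ G] {𝒰 : OpenCover M}

/-- The arrow `g : x → y`, regarded as an arrow from the copy `p` of `x` to the copy `q` of `y`. -/
def liftArrow {x y : M} (g : 𝒢.Arrow x y) (p q : 𝒰.Space) (hp : p.val = x) (hq : q.val = y) :
    (𝒢.cover 𝒰).Arrow p q :=
  ⟨.mk (p.idx, q.idx) g.1
      ⟨by rw [g.2.1, ← hp]; exact p.val_mem, by rw [g.2.2, ← hq]; exact q.val_mem⟩,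
    DisjUnion.ext' rfl (g.2.1.trans hp.symm), DisjUnion.ext' rfl (g.2.2.trans hq.symm)⟩

theorem eq_liftArrow {p q : 𝒰.Space} (a : (𝒢.cover 𝒰).Arrow p q) {x y : M} (g : 𝒢.Arrow x y)
    (hp : p.val = x) (hq : q.val = y) (h : a.1.val = g.1) : a = liftArrow g p q hp hq := by
  obtain ⟨a, rfl, rfl⟩ := a
  exact Subtype.ext (DisjUnion.ext' rfl h)

theorem liftArrow_comp_liftArrow {x y z : M} (g : 𝒢.Arrow y z) (h : 𝒢.Arrow x y)
    (p q r : 𝒰.Space) (hp : p.val = x) (hq : q.val = y) (hr : r.val = z) :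
    (liftArrow g q r hq hr).comp (liftArrow h p q hp hq) = liftArrow (g.comp h) p r hp hr :=
  eq_liftArrow _ _ _ _ (𝒢.val_coverMul (g.2.1.trans h.2.2.symm))

/-- The unit arrow at a point of `M`, regarded as an arrow between two copies of this point. -/
def copyArrow (𝒢 : LieGroupoid n m M G) (p q : 𝒰.Space) (h : p.val = q.val) :
    (𝒢.cover 𝒰).Arrow p q :=
  liftArrow (𝒢.unit q.val) p q h rfl

theorem copyArrow_comp_liftArrow {x y : M} (g : 𝒢.Arrow x y) (p q q' : 𝒰.Space) (hp : p.val = x)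
    (hq : q.val = y) (hq' : q'.val = y) :
    (𝒢.copyArrow q q' (hq.trans hq'.symm)).comp (liftArrow g p q hp hq) =
      liftArrow g p q' hp hq' := by
  subst hq'
  exact (liftArrow_comp_liftArrow _ _ _ _ _ _ _ _).trans (by rw [Arrow.unit_comp])

theorem liftArrow_comp_copyArrow {x y : M} (g : 𝒢.Arrow x y) (p p' q : 𝒰.Space) (hp : p.val = x)
    (hp' : p'.val = x) (hq : q.val = y) :
    (liftArrow g p q hp hq).comp (𝒢.copyArrow p' p (hp'.trans hp.symm)) =
      liftArrow g p' q hp' hq := by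
  subst hp
  exact (liftArrow_comp_liftArrow _ _ _ _ _ _ _ _).trans (by rw [Arrow.comp_unit])

theorem copyArrow_comp_copyArrow (p q r : 𝒰.Space) (hpq : p.val = q.val) (hqr : q.val = r.val) :
    (𝒢.copyArrow q r hqr).comp (𝒢.copyArrow p q hpq) = 𝒢.copyArrow p r (hpq.trans hqr) :=
  liftArrow_comp_copyArrow (𝒢.unit r.val) q p r hqr (hpq.trans hqr) rfl

theorem extend_one {Z : Type*} (φ : 𝒢.CoverArrows 𝒰 → Z) (z₀ : Z) {x : M} (p q : 𝒰.Space)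
    (hp : p.val = x) (hq : q.val = x) :
    DisjUnion.extend φ z₀ (p.idx, q.idx) (𝒢.one x) =
      φ (𝒢.copyArrow p q (hp.trans hq.symm)).1 := by
  subst hq
  have hmem : 𝒢.one q.val ∈ 𝒢.arrowOpens p.idx.1 q.idx.1 :=
    ⟨by rw [𝒢.src_one, ← hp]; exact p.val_mem, by rw [𝒢.tgt_one]; exact q.val_mem⟩
  exact DisjUnion.extend_of_mem φ z₀ (i := (p.idx, q.idx)) hmem

theorem surjective_val_coverArrows (𝒢 : LieGroupoid n m M G) (𝒰 : OpenCover M) :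
    Function.Surjective (DisjUnion.val : 𝒢.CoverArrows 𝒰 → G) := fun g =>
  ⟨(liftArrow (𝒢.arrow g) (𝒰.point _) (𝒰.point _) (𝒰.val_point _) (𝒰.val_point _)).1, rfl⟩

end Arrows

/-! ### Real cohomology does not change under pull-back along an open cover -/

section RealCohomology

variable {n m : ℕ} {M : Type u} {G : Type w}
  [TopologicalSpace M] [ChartedSpace (EuclideanSpace ℝ (Fin n)) M]
  [TopologicalSpace G] [ChartedSpace (EuclideanSpace ℝ (Fin m)) G] {𝒢 : LieGroupoid n m M G}

theorem realB1_le_realZ1 (𝒢 : LieGroupoid n m M G) : 𝒢.RealB1 ≤ 𝒢.RealZ1 := by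
  rintro c ⟨f, hf, hc⟩
  refine ⟨?_, fun g h hgh => ?_⟩
  · rw [funext hc]
    exact (hf.comp 𝒢.src.contMDiff).sub (hf.comp 𝒢.tgt.contMDiff)
  · rw [hc, hc, hc, 𝒢.src_mul g h hgh, 𝒢.tgt_mul g h hgh, hgh]
    ring

variable [IsManifold (𝓡 n) ∞ M] [IsManifold (𝓡 m) ∞ G] {𝒰 : OpenCover M}

theorem RealZ1.apply_liftArrow_eq (c : (𝒢.cover 𝒰).RealZ1) {x y : M} (g : 𝒢.Arrow x y)
    (p p' q q' : 𝒰.Space) (hp : p.val = x) (hp' : p'.val = x) (hq : q.val = y) (hq' : q'.val = y) :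
    c.1 (liftArrow g p q hp hq).1 =
      c.1 (liftArrow g p' q' hp' hq').1 + c.1 (𝒢.copyArrow p p' (hp.trans hp'.symm)).1 -
        c.1 (𝒢.copyArrow q q' (hq.trans hq'.symm)).1 := by
  have h₁ := RealZ1.apply_comp c (𝒢.copyArrow q q' (hq.trans hq'.symm)) (liftArrow g p q hp hq)
  have h₂ := RealZ1.apply_comp c (liftArrow g p' q' hp' hq')
    (𝒢.copyArrow p p' (hp.trans hp'.symm))
  rw [copyArrow_comp_liftArrow g p q q' hp hq hq'] at h₁
  rw [liftArrow_comp_copyArrow g p' p q' hp' hp hq'] at h₂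
  linarith

theorem RealZ1.exists_apply_val (c : (𝒢.cover 𝒰).RealZ1)
    (h : ∀ (p q : 𝒰.Space) (hpq : p.val = q.val), c.1 (𝒢.copyArrow p q hpq).1 = 0) :
    ∃ d : 𝒢.RealZ1, ∀ a : 𝒢.CoverArrows 𝒰, d.1 a.val = c.1 a := by
  have hlift : ∀ {x y : M} (g : 𝒢.Arrow x y) (p p' q q' : 𝒰.Space) (hp : p.val = x)
      (hp' : p'.val = x) (hq : q.val = y) (hq' : q'.val = y),
      c.1 (liftArrow g p q hp hq).1 = c.1 (liftArrow g p' q' hp' hq').1 := by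
    intro x y g p p' q q' hp hp' hq hq'
    rw [RealZ1.apply_liftArrow_eq c g p p' q q' hp hp' hq hq', h, h, add_zero, sub_zero]
  obtain ⟨d, hd, hdc⟩ := DisjUnion.exists_contMDiff_comp_val c.2.1
    (𝒢.surjective_val_coverArrows 𝒰) (fun a b hab => by
      have ha := eq_liftArrow ((𝒢.cover 𝒰).arrow a) (𝒢.arrow a.val) rfl rfl rfl
      have hb := eq_liftArrow ((𝒢.cover 𝒰).arrow b) (𝒢.arrow a.val)
        (congrArg 𝒢.src hab.symm) (congrArg 𝒢.tgt hab.symm) hab.symm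
      refine (congrArg c.1 (congrArg Subtype.val ha)).trans
        (Eq.trans ?_ (congrArg c.1 (congrArg Subtype.val hb)).symm)
      exact hlift _ _ _ _ _ _ _ _ _)
  refine ⟨⟨d, hd, fun g k hgk => ?_⟩, hdc⟩
  let g' : 𝒢.Arrow (𝒢.src g) (𝒢.tgt g) := 𝒢.arrow g
  let k' : 𝒢.Arrow (𝒢.src k) (𝒢.src g) := ⟨k, rfl, hgk.symm⟩
  have hcomp := RealZ1.apply_comp c
    (liftArrow g' (𝒰.point _) (𝒰.point _) (𝒰.val_point _) (𝒰.val_point _))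
    (liftArrow k' (𝒰.point _) (𝒰.point _) (𝒰.val_point _) (𝒰.val_point _))
  rw [liftArrow_comp_liftArrow, ← hdc, ← hdc, ← hdc] at hcomp
  exact hcomp

/-- The average `p ↦ ∑ V, ρ V x * c (p → x_V)` of a real cocycle over an open cover with respect to
a partition of unity, where `x` is the point of `M` underlying `p` and `x_V` is its copy in `V`. It
is a primitive of the restriction of `c` to the arrows between different copies of a point. -/
def RealZ1.average (c : (𝒢.cover 𝒰).RealZ1) (ρ : SmoothPartitionOfUnity 𝒰.carrier (𝓡 n) M univ)
    (p : 𝒰.Space) : ℝ :=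
  ∑ᶠ V, ρ V p.val * DisjUnion.extend c.1 0 (p.idx, V) (𝒢.one p.val)

theorem RealZ1.contMDiff_average (c : (𝒢.cover 𝒰).RealZ1)
    {ρ : SmoothPartitionOfUnity 𝒰.carrier (𝓡 n) M univ}
    (hρ : ρ.IsSubordinate fun U => (U.1 : Set M)) :
    ContMDiff (𝓡 n) 𝓘(ℝ, ℝ) ∞ (RealZ1.average c ρ) := by
  intro p
  have hsum : ContMDiffAt (𝓡 n) 𝓘(ℝ, ℝ) ∞
      (fun x => ∑ᶠ V, ρ V x • DisjUnion.extend c.1 0 (p.idx, V) (𝒢.one x)) p.val :=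
    ρ.contMDiffAt_finsum fun V hV => contMDiffAt_extend_one c.2.1 0 p.val_mem (hρ V hV)
  refine (DisjUnion.contMDiffAt_comp_val_iff.2 hsum).congr_of_eventuallyEq ?_
  filter_upwards [DisjUnion.eventually_idx p] with q hq
  rw [RealZ1.average, hq]
  rfl

theorem RealZ1.average_sub_average (c : (𝒢.cover 𝒰).RealZ1)
    {ρ : SmoothPartitionOfUnity 𝒰.carrier (𝓡 n) M univ}
    (hρ : ρ.IsSubordinate fun U => (U.1 : Set M)) (p q : 𝒰.Space) (h : p.val = q.val) :
    RealZ1.average c ρ p - RealZ1.average c ρ q = c.1 (𝒢.copyArrow p q h).1 := by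
  have hfin : ∀ a : 𝒰.carrier → ℝ, (Function.support fun V => ρ V q.val * a V).Finite :=
    fun a => (ρ.locallyFinite.point_finite q.val).subset fun V hV => left_ne_zero_of_mul hV
  have hsum : ∑ᶠ V, ρ V q.val * c.1 (𝒢.copyArrow p q h).1 = c.1 (𝒢.copyArrow p q h).1 := by
    rw [← finsum_mul' _ _ (ρ.locallyFinite.point_finite q.val), ρ.sum_eq_one (mem_univ q.val),
      _root_.one_mul]
  rw [RealZ1.average, RealZ1.average, ← hsum, sub_eq_iff_eq_add, h,
    ← finsum_add_distrib (hfin _) (hfin _)]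
  refine finsum_congr fun V => ?_
  by_cases hV : q.val ∈ V.1
  · let r : 𝒰.Space := .mk V q.val hV
    have hp : DisjUnion.extend c.1 0 (p.idx, V) (𝒢.one q.val) = c.1 (𝒢.copyArrow p r h).1 :=
      extend_one c.1 0 p r h rfl
    have hq : DisjUnion.extend c.1 0 (q.idx, V) (𝒢.one q.val) = c.1 (𝒢.copyArrow q r rfl).1 :=
      extend_one c.1 0 q r rfl rfl
    have hpqr : c.1 (𝒢.copyArrow p r h).1 =
        c.1 (𝒢.copyArrow q r rfl).1 + c.1 (𝒢.copyArrow p q h).1 :=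
      (congrArg (fun a => c.1 a.1) (copyArrow_comp_copyArrow p q r h rfl).symm).trans
        (RealZ1.apply_comp c _ _)
    rw [hp, hq, hpqr, mul_add, add_comm]
  · have hρV : ρ V q.val = 0 := by
      by_contra hne
      exact hV (hρ V (subset_tsupport _ hne))
    simp only [hρV, zero_mul, add_zero]

theorem pullRealH1_coverMap_injective (𝒢 : LieGroupoid n m M G) (𝒰 : OpenCover M) :
    Function.Injective (𝒢.coverMap 𝒰).pullRealH1 := by
  refine (injective_iff_map_eq_zero _).2 fun x hx => ?_
  induction x using Submodule.Quotient.induction_on with | _ c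
  obtain ⟨f, hf, hfc⟩ := (Submodule.Quotient.mk_eq_zero _).1 hx
  have hcf : ∀ {p q : 𝒰.Space} (a : (𝒢.cover 𝒰).Arrow p q), c.1 a.1.val = f p - f q := by
    rintro _ _ ⟨a, rfl, rfl⟩
    exact hfc a
  obtain ⟨f', hf', hff'⟩ := DisjUnion.exists_contMDiff_comp_val hf 𝒰.surjective_val
    (fun p q hpq => sub_eq_zero.1
      ((hcf (𝒢.copyArrow p q hpq)).symm.trans (RealZ1.apply_unit c q.val)))
  refine (Submodule.Quotient.mk_eq_zero _).2 ⟨f', hf', fun g => ?_⟩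
  obtain ⟨a, rfl⟩ := 𝒢.surjective_val_coverArrows 𝒰 g
  exact (hcf ((𝒢.cover 𝒰).arrow a)).trans (congrArg₂ _ (hff' _).symm (hff' _).symm)

variable [T2Space M] [SecondCountableTopology M]

theorem exists_smoothPartitionOfUnity_isSubordinate (𝒰 : OpenCover M) :
    ∃ ρ : SmoothPartitionOfUnity 𝒰.carrier (𝓡 n) M univ,
      ρ.IsSubordinate fun U => (U.1 : Set M) := by
  have : LocallyCompactSpace M := ChartedSpace.locallyCompactSpace (EuclideanSpace ℝ (Fin n)) M
  refine SmoothPartitionOfUnity.exists_isSubordinate (𝓡 n) isClosed_univ _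
    (fun U => U.1.isOpen) fun x _ => mem_iUnion.2 ?_
  obtain ⟨U, hU, hx⟩ := 𝒰.covers x
  exact ⟨⟨U, hU⟩, hx⟩

theorem RealZ1.exists_sub_eq_apply_copyArrow (c : (𝒢.cover 𝒰).RealZ1) :
    ∃ f : 𝒰.Space → ℝ, ContMDiff (𝓡 n) 𝓘(ℝ, ℝ) ∞ f ∧
      ∀ (p q : 𝒰.Space) (h : p.val = q.val), f p - f q = c.1 (𝒢.copyArrow p q h).1 :=
  let ⟨_, hρ⟩ := exists_smoothPartitionOfUnity_isSubordinate (n := n) 𝒰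
  ⟨_, RealZ1.contMDiff_average c hρ, RealZ1.average_sub_average c hρ⟩

theorem pullRealH1_coverMap_surjective (𝒢 : LieGroupoid n m M G) (𝒰 : OpenCover M) :
    Function.Surjective (𝒢.coverMap 𝒰).pullRealH1 := by
  intro x
  induction x using Submodule.Quotient.induction_on with | _ c
  obtain ⟨f, hf, hfc⟩ := RealZ1.exists_sub_eq_apply_copyArrow c
  let δf : 𝒢.CoverArrows 𝒰 → ℝ := fun a => f ((𝒢.cover 𝒰).src a) - f ((𝒢.cover 𝒰).tgt a)
  have hδf : δf ∈ (𝒢.cover 𝒰).RealB1 := ⟨f, hf, fun _ => rfl⟩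
  obtain ⟨d, hd⟩ := RealZ1.exists_apply_val (c - ⟨δf, realB1_le_realZ1 _ hδf⟩) fun p q h => by
    have hsrc : (𝒢.cover 𝒰).src (𝒢.copyArrow p q h).1 = p := (𝒢.copyArrow p q h).2.1
    have htgt : (𝒢.cover 𝒰).tgt (𝒢.copyArrow p q h).1 = q := (𝒢.copyArrow p q h).2.2
    change c.1 _ - (f _ - f _) = 0
    rw [hsrc, htgt, hfc p q h, sub_self]
  refine ⟨Submodule.Quotient.mk d, ((Submodule.Quotient.eq _).2 ?_).symm⟩
  refine ⟨f, hf, fun a => ?_⟩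
  change c.1 a - d.1 a.val = f _ - f _
  rw [hd a]
  exact sub_sub_cancel _ _

theorem pullRealH1_coverMap_bijective (𝒢 : LieGroupoid n m M G) (𝒰 : OpenCover M) :
    Function.Bijective (𝒢.coverMap 𝒰).pullRealH1 :=
  ⟨𝒢.pullRealH1_coverMap_injective 𝒰, 𝒢.pullRealH1_coverMap_surjective 𝒰⟩

end RealCohomology

end LieGroupoid

/-! ### The splitting of cohomology with coefficients in `ℝ^*` -/

/-- The homomorphism `exp : ℝ → ℝ^*`, the inclusion of the first factor of `ℝ^* ≅ ℝ × ℤ₂`. -/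
def expUnits : AddChar ℝ ℝˣ where
  toFun r := Units.mk0 (Real.exp r) (Real.exp_ne_zero r)
  map_zero_eq_one' := Units.ext Real.exp_zero
  map_add_eq_mul' r s := Units.ext (Real.exp_add r s)

theorem coe_expUnits (r : ℝ) : (expUnits r : ℝ) = Real.exp r := rfl

theorem contMDiff_expUnits : ContMDiff 𝓘(ℝ, ℝ) 𝓘(ℝ, ℝ) ∞ expUnits :=
  ContMDiff.of_comp_isOpenEmbedding Units.isOpenEmbedding_val Real.contDiff_exp.contMDiff

/-- The inclusion `{1, -1} → ℝ^*` of the second factor of `ℝ^* ≅ ℝ × ℤ₂`. -/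
def castSign : ℤˣ →* ℝˣ := Units.map (Int.castRingHom ℝ)

theorem coe_castSign (e : ℤˣ) : (castSign e : ℝ) = ((e : ℤ) : ℝ) := rfl

theorem expUnits_log_mul_castSign_signUnits (a : ℝˣ) :
    expUnits (Real.log |(a : ℝ)|) * castSign (signUnits a) = a := by
  refine Units.ext ?_
  rw [Units.val_mul, coe_expUnits, Real.exp_log (abs_pos.2 a.ne_zero), coe_castSign]
  rcases lt_or_gt_of_ne a.ne_zero with h | h
  · simp [signUnits, h.not_gt, abs_of_neg h]
  · simp [signUnits, h, abs_of_pos h]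

theorem log_abs_expUnits_mul_castSign (r : ℝ) (e : ℤˣ) :
    Real.log |((expUnits r * castSign e : ℝˣ) : ℝ)| = r := by
  have habs : |(e : ℤ)| = 1 := Int.isUnit_iff_abs_eq.1 e.isUnit
  rw [Units.val_mul, coe_expUnits, coe_castSign, abs_mul, Real.abs_exp, ← Int.cast_abs, habs,
    Int.cast_one, mul_one, Real.log_exp]

theorem signUnits_expUnits_mul_castSign (r : ℝ) (e : ℤˣ) :
    signUnits (expUnits r * castSign e) = e := by
  have hexp : signUnits (expUnits r) = 1 := if_pos (Real.exp_pos r)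
  rw [map_mul, hexp, one_mul]
  rcases Int.units_eq_one_or e with rfl | rfl <;> simp [signUnits, coe_castSign]

namespace LieGroupoid

section Splitting

variable {n m : ℕ} {M : Type u} {G : Type w}
  [TopologicalSpace M] [ChartedSpace (EuclideanSpace ℝ (Fin n)) M]
  [TopologicalSpace G] [ChartedSpace (EuclideanSpace ℝ (Fin m)) G] {𝒢 : LieGroupoid n m M G}

/-- The real cocycle `ln |c|`. -/
def Z1.logAbs (c : 𝒢.Z1 𝓘(ℝ, ℝ) ℝˣ) : 𝒢.RealZ1 :=
  ⟨fun g => Real.log |(c.1 g : ℝ)|, contMDiff_logAbs.comp c.2.1, fun g h hgh => by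
    simp only [c.2.2 g h hgh, Units.val_mul, abs_mul]
    exact Real.log_mul (abs_ne_zero.2 (c.1 g).ne_zero) (abs_ne_zero.2 (c.1 h).ne_zero)⟩

theorem H1.logAbs_prod_sign_injective :
    Function.Injective ((H1.logAbs (𝒢 := 𝒢)).prod H1.sign) := by
  refine (injective_iff_map_eq_one _).2 fun x hx => ?_
  induction x using QuotientGroup.induction_on with | _ c
  obtain ⟨f, hf, hfc⟩ :=
    (Submodule.Quotient.mk_eq_zero _).1 (congrArg (fun y => y.1.toAdd) hx)
  obtain ⟨e, he, hec⟩ := (QuotientGroup.eq_one_iff _).1 (congrArg Prod.snd hx)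
  replace hfc : ∀ g, Real.log |(c.1 g : ℝ)| = f (𝒢.src g) - f (𝒢.tgt g) := hfc
  replace hec : ∀ g, signUnits (c.1 g) = e (𝒢.src g) / e (𝒢.tgt g) := hec
  refine (QuotientGroup.eq_one_iff _).2 ⟨fun x => expUnits (f x) * castSign (e x),
    (contMDiff_expUnits.comp hf).mul (contMDiff_of_discreteTopology.comp he), fun g => ?_⟩
  refine (expUnits_log_mul_castSign_signUnits (c.1 g)).symm.trans ?_
  rw [hfc, hec, AddChar.map_sub_eq_div, map_div, div_mul_div_comm]

theorem H1.logAbs_prod_sign_surjective :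
    Function.Surjective ((H1.logAbs (𝒢 := 𝒢)).prod H1.sign) := by
  rintro ⟨y, z⟩
  induction y using Multiplicative.rec with | _ y
  induction y using Submodule.Quotient.induction_on with | _ c
  induction z using QuotientGroup.induction_on with | _ d
  let b : G → ℝˣ := fun g => expUnits (c.1 g) * castSign (d.1 g)
  have hb : b ∈ 𝒢.Z1 𝓘(ℝ, ℝ) ℝˣ := by
    refine ⟨(contMDiff_expUnits.comp c.2.1).mul (contMDiff_of_discreteTopology.comp d.2.1), ?_⟩
    intro g h hgh
    simp only [b, c.2.2 g h hgh, d.2.2 g h hgh, AddChar.map_add_eq_mul, map_mul]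
    exact mul_mul_mul_comm _ _ _ _
  refine ⟨QuotientGroup.mk ⟨b, hb⟩, Prod.ext ?_ ?_⟩
  · exact congrArg (fun c => Multiplicative.ofAdd (Submodule.Quotient.mk c))
      (Subtype.ext (funext fun g => log_abs_expUnits_mul_castSign _ _))
  · exact congrArg QuotientGroup.mk
      (Subtype.ext (funext fun g => signUnits_expUnits_mul_castSign _ _))

variable {n' m' : ℕ} {M' : Type u'} {G' : Type w'}
  [TopologicalSpace M'] [ChartedSpace (EuclideanSpace ℝ (Fin n')) M']
  [TopologicalSpace G'] [ChartedSpace (EuclideanSpace ℝ (Fin m')) G']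
  {𝒢' : LieGroupoid n' m' M' G'}

theorem H1.logAbs_pullH1 (Φ : 𝒢'.Hom 𝒢) (x : 𝒢.H1 𝓘(ℝ, ℝ) ℝˣ) :
    (H1.logAbs (Φ.pullH1 𝓘(ℝ, ℝ) ℝˣ x)).toAdd = Φ.pullRealH1 (H1.logAbs x).toAdd := by
  induction x using QuotientGroup.induction_on with | _ c
  rfl

theorem H1.sign_pullH1 (Φ : 𝒢'.Hom 𝒢) (x : 𝒢.H1 𝓘(ℝ, ℝ) ℝˣ) :
    H1.sign (Φ.pullH1 𝓘(ℝ, ℝ) ℝˣ x) = Φ.pullH1 (𝓡 0) ℤˣ (H1.sign x) := by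
  induction x using QuotientGroup.induction_on with | _ c
  rfl

end Splitting

section Cech

variable {n m : ℕ} {M : Type u} {G : Type w}
  [TopologicalSpace M] [ChartedSpace (EuclideanSpace ℝ (Fin n)) M] [IsManifold (𝓡 n) ∞ M]
  [TopologicalSpace G] [ChartedSpace (EuclideanSpace ℝ (Fin m)) G] [IsManifold (𝓡 m) ∞ G]
  {𝒢 : LieGroupoid n m M G}
  {EA : Type*} [NormedAddCommGroup EA] [NormedSpace ℝ EA]
  {HA : Type*} [TopologicalSpace HA] {IA : ModelWithCorners ℝ EA HA}
  {A : Type*} [CommGroup A] [TopologicalSpace A] [ChartedSpace HA A] [LieGroup IA ∞ A]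
  {𝒰 𝒱 : OpenCover M}

theorem CechH1.of_resH1 (h : 𝒰 ≤ 𝒱) (x : (𝒢.cover 𝒰).H1 IA A) :
    CechH1.of 𝒢 𝒱 (𝒢.resH1 IA A h x) = CechH1.of 𝒢 𝒰 x :=
  DirectLimit.mk_apply (F := fun 𝒰 : OpenCover M => (𝒢.cover 𝒰).H1 IA A)
    (f := fun _ _ h => 𝒢.resH1 IA A h) 𝒰 𝒱 x h

theorem CechH1.of_pullH1 (r : 𝒱.carrier → 𝒰.carrier) (hr : ∀ V, V.1 ≤ (r V).1)
    (x : (𝒢.cover 𝒰).H1 IA A) :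
    CechH1.of 𝒢 𝒱 ((𝒢.refineMap r hr).pullH1 IA A x) = CechH1.of 𝒢 𝒰 x := by
  have h : 𝒰 ≤ 𝒱 := fun V hV => ⟨_, (r ⟨V, hV⟩).2, hr ⟨V, hV⟩⟩
  rw [← CechH1.of_resH1 h, pullH1_refineMap_eq]
  rfl

theorem CechH1.of_mul (x y : (𝒢.cover 𝒰).H1 IA A) :
    CechH1.of 𝒢 𝒰 (x * y) = CechH1.of 𝒢 𝒰 x * CechH1.of 𝒢 𝒰 y :=
  (DirectLimit.mul_def (G := fun 𝒰 : OpenCover M => (𝒢.cover 𝒰).H1 IA A)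
    (f := fun _ _ h => 𝒢.resH1 IA A h) 𝒰 x y).symm

theorem CechH1.of_eq_one_iff {x : (𝒢.cover 𝒰).H1 IA A} :
    CechH1.of 𝒢 𝒰 x = 1 ↔ ∃ (𝒱 : OpenCover M) (h : 𝒰 ≤ 𝒱), 𝒢.resH1 IA A h x = 1 :=
  DirectLimit.exists_eq_one _

theorem CechH1.exists_of (x : 𝒢.CechH1 IA A) : ∃ 𝒰 y, CechH1.of 𝒢 𝒰 y = x :=
  (DirectLimit.exists_eq_mk _ x).imp fun _ => Exists.imp fun _ => Eq.symm

theorem pullRealH1_refineMap (r : 𝒱.carrier → 𝒰.carrier) (hr : ∀ V, V.1 ≤ (r V).1)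
    (y : 𝒢.RealH1) :
    (𝒢.refineMap r hr).pullRealH1 ((𝒢.coverMap 𝒰).pullRealH1 y) =
      (𝒢.coverMap 𝒱).pullRealH1 y := by
  induction y using Submodule.Quotient.induction_on with | _ c
  rfl

variable [T2Space M] [SecondCountableTopology M]

/-- The isomorphism `H¹(𝒢) ≅ H¹(𝒢_𝒰)` in real cohomology, along which `ln |c|` is transported from
an open cover to `𝒢`. -/
def coverRealEquiv (𝒢 : LieGroupoid n m M G) (𝒰 : OpenCover M) :
    𝒢.RealH1 ≃ₗ[ℝ] (𝒢.cover 𝒰).RealH1 :=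
  .ofBijective _ (𝒢.pullRealH1_coverMap_bijective 𝒰)

/-- The map `[c] ↦ ([ln |c|], [sign c])` over a fixed open cover. -/
def logSign (𝒢 : LieGroupoid n m M G) (𝒰 : OpenCover M) :
    (𝒢.cover 𝒰).H1 𝓘(ℝ, ℝ) ℝˣ →* Multiplicative 𝒢.RealH1 × 𝒢.CechH1 (𝓡 0) ℤˣ :=
  ((𝒢.coverRealEquiv 𝒰).symm.toAddMonoidHom.toMultiplicative.comp H1.logAbs).prod
    ((MonoidHom.mk' (CechH1.of 𝒢 𝒰) CechH1.of_mul).comp H1.sign)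

theorem pullRealH1_logSign (x : (𝒢.cover 𝒰).H1 𝓘(ℝ, ℝ) ℝˣ) :
    (𝒢.coverMap 𝒰).pullRealH1 (𝒢.logSign 𝒰 x).1.toAdd = (H1.logAbs x).toAdd :=
  (𝒢.coverRealEquiv 𝒰).apply_symm_apply _

theorem logSign_resH1 (h : 𝒰 ≤ 𝒱) (x : (𝒢.cover 𝒰).H1 𝓘(ℝ, ℝ) ℝˣ) :
    𝒢.logSign 𝒰 x = 𝒢.logSign 𝒱 (𝒢.resH1 𝓘(ℝ, ℝ) ℝˣ h x) := by
  refine Prod.ext (𝒢.pullRealH1_coverMap_injective 𝒱 ?_) ?_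
  · refine Eq.trans ?_ (pullRealH1_logSign _).symm
    rw [resH1, H1.logAbs_pullH1, ← pullRealH1_logSign, pullRealH1_refineMap]
    rfl
  · exact (CechH1.of_resH1 h _).symm.trans (congrArg _ (H1.sign_pullH1 _ x).symm)

/-- The map `[c] ↦ ([ln |c|], [sign c])` on Čech-type cohomology. -/
def cechLogSign (𝒢 : LieGroupoid n m M G) :
    𝒢.CechH1 𝓘(ℝ, ℝ) ℝˣ →* Multiplicative 𝒢.RealH1 × 𝒢.CechH1 (𝓡 0) ℤˣ :=
  .mk' (DirectLimit.lift _ (fun 𝒰 => 𝒢.logSign 𝒰) fun _ _ h x => logSign_resH1 h x)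
    (DirectLimit.lift_mul _ _)

theorem cechLogSign_injective (𝒢 : LieGroupoid n m M G) : Function.Injective 𝒢.cechLogSign := by
  refine (injective_iff_map_eq_one _).2 fun x hx => ?_
  obtain ⟨𝒰, x, rfl⟩ := CechH1.exists_of x
  obtain ⟨𝒱, h, hs⟩ := CechH1.of_eq_one_iff.1 (congrArg Prod.snd hx)
  set y := 𝒢.resH1 𝓘(ℝ, ℝ) ℝˣ h x
  have hlog : H1.logAbs y = 1 := by
    have hy : (𝒢.logSign 𝒱 y).1 = 1 := congrArg Prod.fst ((logSign_resH1 h x).symm.trans hx)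
    refine (pullRealH1_logSign y).symm.trans ?_
    rw [hy]
    exact map_zero _
  have hsign : H1.sign y = 1 := (H1.sign_pullH1 _ x).trans hs
  have hy : (H1.logAbs.prod H1.sign) y = 1 := Prod.ext hlog hsign
  exact CechH1.of_eq_one_iff.2
    ⟨𝒱, h, H1.logAbs_prod_sign_injective (hy.trans (map_one _).symm)⟩

theorem cechLogSign_surjective (𝒢 : LieGroupoid n m M G) :
    Function.Surjective 𝒢.cechLogSign := by
  rintro ⟨y, z⟩
  obtain ⟨𝒰, z, rfl⟩ := CechH1.exists_of z
  obtain ⟨x, hx⟩ :=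
    H1.logAbs_prod_sign_surjective (.ofAdd ((𝒢.coverMap 𝒰).pullRealH1 y.toAdd), z)
  have hlog : H1.logAbs x = .ofAdd ((𝒢.coverMap 𝒰).pullRealH1 y.toAdd) := congrArg Prod.fst hx
  have hsign : H1.sign x = z := congrArg Prod.snd hx
  refine ⟨CechH1.of 𝒢 𝒰 x, Prod.ext (𝒢.pullRealH1_coverMap_injective 𝒰 ?_)
    (congrArg (CechH1.of 𝒢 𝒰) hsign)⟩
  exact (pullRealH1_logSign x).trans hlog

/-- The splitting `Φ` of Čech-type cohomology with coefficients in `ℝ^*`. -/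
def cechSplitting (𝒢 : LieGroupoid n m M G) :
    𝒢.CechH1 𝓘(ℝ, ℝ) ℝˣ ≃* Multiplicative 𝒢.RealH1 × 𝒢.CechH1 (𝓡 0) ℤˣ :=
  .ofBijective 𝒢.cechLogSign ⟨𝒢.cechLogSign_injective, 𝒢.cechLogSign_surjective⟩

theorem pullRealH1_cechSplitting_of (x : (𝒢.cover 𝒰).H1 𝓘(ℝ, ℝ) ℝˣ) :
    (𝒢.coverMap 𝒰).pullRealH1 (𝒢.cechSplitting (CechH1.of 𝒢 𝒰 x)).1.toAdd =
      (H1.logAbs x).toAdd :=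
  pullRealH1_logSign x

theorem cechSplitting_of_snd (x : (𝒢.cover 𝒰).H1 𝓘(ℝ, ℝ) ℝˣ) :
    (𝒢.cechSplitting (CechH1.of 𝒢 𝒰 x)).2 = CechH1.of 𝒢 𝒰 (H1.sign x) :=
  rfl

end Cech

end LieGroupoid

/-! ### Frames -/

namespace LineRep

open LineBundle LieGroupoid

section Frames

variable {n m : ℕ} {M : Type u} {G : Type w}
  [TopologicalSpace M] [ChartedSpace (EuclideanSpace ℝ (Fin n)) M]
  [TopologicalSpace G] [ChartedSpace (EuclideanSpace ℝ (Fin m)) G] {𝒢 : LieGroupoid n m M G}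
  {n' m' : ℕ} {M' : Type u'} {G' : Type w'}
  [TopologicalSpace M'] [ChartedSpace (EuclideanSpace ℝ (Fin n')) M']
  [TopologicalSpace G'] [ChartedSpace (EuclideanSpace ℝ (Fin m')) G']
  {𝒢' : LieGroupoid n' m' M' G'} {L L' : LineRep.{u, v} 𝒢}

theorem smoothAt_pull {Φ : 𝒢'.Hom 𝒢} {σ : ∀ x, L.fib (Φ.base x)} {x : M'}
    (h : ContMDiffAt (𝓡 n') ((𝓡 n).prod 𝓘(ℝ, ℝ)) ∞
      (fun x => TotalSpace.mk' ℝ (Φ.base x) (σ x)) x) : (L.pull Φ).SmoothAt σ x :=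
  contMDiffAt_pull_iff.2 ⟨contMDiffAt_id, h⟩

/-- The pull-back of an isomorphism. -/
def Iso.pull (F : Iso L L') (Φ : 𝒢'.Hom 𝒢) : Iso (L.pull Φ) (L'.pull Φ) :=
  .ofFrames (fun x => F.equiv (Φ.base x)) (fun g => F.equiv_act (Φ.map g)) fun x => by
    obtain ⟨σ, hσ, hσ₀⟩ := L.toLineBundle.exists_frame (Φ.base x)
    have hΦ := Φ.base.contMDiff.contMDiffAt (x := x)
    exact ⟨fun x => σ (Φ.base x), smoothAt_pull (hσ.comp_of_eq hΦ rfl), hσ₀,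
      smoothAt_pull ((F.smoothAt hσ).comp_of_eq hΦ rfl)⟩

/-- The isomorphism expressing that the pull-back commutes with the tensor product. -/
def Iso.pullTensor (L L' : LineRep.{u, v} 𝒢) (Φ : 𝒢'.Hom 𝒢) :
    Iso ((L.pull Φ).tensor (L'.pull Φ)) ((L.tensor L').pull Φ) :=
  .ofFrames (fun x => LinearEquiv.refl ℝ (L.fib (Φ.base x) ⊗[ℝ] L'.fib (Φ.base x)))
    (fun _ _ => rfl) fun x => by
    obtain ⟨σ, hσ, hσ₀⟩ := L.toLineBundle.exists_frame (Φ.base x)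
    obtain ⟨τ, hτ, hτ₀⟩ := L'.toLineBundle.exists_frame (Φ.base x)
    have hΦ := Φ.base.contMDiff.contMDiffAt (x := x)
    have hσΦ := hσ.comp_of_eq hΦ rfl
    have hτΦ := hτ.comp_of_eq hΦ rfl
    exact ⟨fun x => σ (Φ.base x) ⊗ₜ τ (Φ.base x),
      contMDiffAt_tmul (smoothAt_pull hσΦ) (smoothAt_pull hτΦ),
      tmul_ne_zero (L := L.toLineBundle) (L' := L'.toLineBundle) hσ₀ hτ₀,
      smoothAt_pull (L := L.tensor L') (contMDiffAt_tmul hσΦ hτΦ)⟩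

namespace Frame

theorem coeff_eq (σ : L.Frame) {x y : M} (g : 𝒢.Arrow x y) {a : ℝˣ}
    (h : L.act g (σ.sec x) = (a : ℝ) • σ.sec y) : σ.coeff g.1 = a :=
  Units.ext (smul_left_injective ℝ (σ.ne_zero y) ((σ.act_sec g).symm.trans h))

theorem coeff_of_sec_eq_smul {σ τ : L.Frame} {f : M → ℝˣ}
    (h : ∀ x, τ.sec x = (f x : ℝ) • σ.sec x) (g : G) :
    τ.coeff g = σ.coeff g * (f (𝒢.src g) / f (𝒢.tgt g)) := by
  have hcoeff : f (𝒢.src g) * σ.coeff g =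
      σ.coeff g * (f (𝒢.src g) / f (𝒢.tgt g)) * f (𝒢.tgt g) := by
    rw [_root_.mul_assoc, div_mul_cancel, mul_comm]
  refine τ.coeff_eq (𝒢.arrow g) ?_
  rw [h, h, map_smul, σ.act_sec, smul_smul, smul_smul, ← Units.val_mul, ← Units.val_mul]
  exact congrArg (fun a : ℝˣ => (a : ℝ) • σ.sec (𝒢.tgt g)) hcoeff

theorem exists_sec_eq_smul (σ τ : L.Frame) :
    ∃ f : M → ℝˣ, ContMDiff (𝓡 n) 𝓘(ℝ, ℝ) ∞ f ∧ ∀ x, τ.sec x = (f x : ℝ) • σ.sec x := by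
  have h : ∀ x, ∃ a : ℝˣ, τ.sec x = (a : ℝ) • σ.sec x := fun x => by
    obtain ⟨a, ha⟩ := L.toLineBundle.exists_smul_eq (σ.ne_zero x) (τ.sec x)
    refine ⟨Units.mk0 a ?_, ha⟩
    rintro rfl
    exact τ.ne_zero x (by rw [ha, zero_smul])
  choose f hf using h
  exact ⟨f, ContMDiff.of_comp_isOpenEmbedding Units.isOpenEmbedding_val fun x =>
    contMDiffAt_coeff σ.smooth.contMDiffAt τ.smooth.contMDiffAt (σ.ne_zero x) (.of_forall hf), hf⟩

theorem extClass_eq (σ τ : L.Frame) : σ.extClass = τ.extClass := by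
  obtain ⟨f, hf, hfσ⟩ := σ.exists_sec_eq_smul τ
  refine QuotientGroup.eq.2 ⟨f, hf, fun g => ?_⟩
  exact inv_mul_eq_of_eq_mul (coeff_of_sec_eq_smul hfσ g)

/-- The product of a frame with a smooth function. -/
def scale (σ : L.Frame) (f : M → ℝˣ) (hf : ContMDiff (𝓡 n) 𝓘(ℝ, ℝ) ∞ f) : L.Frame where
  sec x := (f x : ℝ) • σ.sec x
  smooth x := contMDiffAt_smul σ.smooth.contMDiffAt
    ((Units.contMDiff_val (f x)).comp x hf.contMDiffAt)
  ne_zero x := smul_ne_zero (f x).ne_zero (σ.ne_zero x)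

theorem coeff_scale (σ : L.Frame) {f : M → ℝˣ} (hf : ContMDiff (𝓡 n) 𝓘(ℝ, ℝ) ∞ f) (g : G) :
    (σ.scale f hf).coeff g = σ.coeff g * (f (𝒢.src g) / f (𝒢.tgt g)) :=
  coeff_of_sec_eq_smul (fun _ => rfl) g

/-- The image of a frame under an isomorphism. -/
def map (σ : L.Frame) (F : Iso L L') : L'.Frame where
  sec x := F.equiv x (σ.sec x)
  smooth x := F.smoothAt (σ.smooth x)
  ne_zero x := (F.equiv x).map_ne_zero_iff.2 (σ.ne_zero x)

theorem coeff_map (σ : L.Frame) (F : Iso L L') (g : G) : (σ.map F).coeff g = σ.coeff g := by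
  refine (σ.map F).coeff_eq (𝒢.arrow g) ?_
  exact (F.equiv_act _ _).symm.trans
    ((congrArg (F.equiv _) (σ.act_sec (𝒢.arrow g))).trans (map_smul (F.equiv _) _ _))

theorem extClass_map (σ : L.Frame) (F : Iso L L') : (σ.map F).extClass = σ.extClass :=
  congrArg QuotientGroup.mk (Subtype.ext (funext fun g => σ.coeff_map F g))

/-- The tensor product of frames. -/
def tensor (σ : L.Frame) (τ : L'.Frame) : (L.tensor L').Frame where
  sec x := σ.sec x ⊗ₜ τ.sec x
  smooth x := contMDiffAt_tmul (σ.smooth x) (τ.smooth x)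
  ne_zero x := tmul_ne_zero (σ.ne_zero x) (τ.ne_zero x)

theorem coeff_tensor (σ : L.Frame) (τ : L'.Frame) (g : G) :
    (σ.tensor τ).coeff g = σ.coeff g * τ.coeff g := by
  refine (σ.tensor τ).coeff_eq (𝒢.arrow g) ?_
  exact (congrArg₂ (fun a b => a ⊗ₜ[ℝ] b) (σ.act_sec (𝒢.arrow g))
    (τ.act_sec (𝒢.arrow g))).trans (TensorProduct.smul_tmul_smul _ _ _ _)

theorem extClass_tensor (σ : L.Frame) (τ : L'.Frame) :
    (σ.tensor τ).extClass = σ.extClass * τ.extClass :=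
  congrArg QuotientGroup.mk (Subtype.ext (funext fun g => σ.coeff_tensor τ g))

/-- The pull-back of a frame. -/
def pull (σ : L.Frame) (Φ : 𝒢'.Hom 𝒢) : (L.pull Φ).Frame where
  sec x := σ.sec (Φ.base x)
  smooth x := smoothAt_pull ((σ.smooth.comp Φ.base.contMDiff) x)
  ne_zero x := σ.ne_zero (Φ.base x)

theorem extClass_pull (σ : L.Frame) (Φ : 𝒢'.Hom 𝒢) :
    (σ.pull Φ).extClass = Φ.pullH1 𝓘(ℝ, ℝ) ℝˣ σ.extClass := by
  refine congrArg QuotientGroup.mk (Subtype.ext (funext fun g => ?_))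
  exact (σ.pull Φ).coeff_eq (𝒢'.arrow g) (σ.act_sec (Φ.map (𝒢'.arrow g)))

theorem contMDiff_sec_pull {Φ : 𝒢'.Hom 𝒢} (σ : (L.pull Φ).Frame) :
    ContMDiff (𝓡 n') ((𝓡 n).prod 𝓘(ℝ, ℝ)) ∞
      (fun x => TotalSpace.mk' ℝ (Φ.base x) (σ.sec x : L.fib (Φ.base x))) :=
  fun x => (contMDiffAt_pull_iff.1 (σ.smooth x)).2

end Frame

theorem Frame.nonempty_trivial_iso_of_coeff_eq_one {L : LineRep.{u, v} 𝒢} (τ : L.Frame)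
    (h : ∀ g, τ.coeff g = 1) : Nonempty (Iso (trivial 𝒢) L) := by
  let F : ∀ x, ULift.{v} ℝ →ₗ[ℝ] L.fib x := fun x =>
    LinearMap.toSpanSingleton ℝ _ (τ.sec x) ∘ₗ ULift.moduleEquiv.toLinearMap
  have hF : ∀ x, Function.Bijective (F x) := fun x => by
    refine ⟨fun a b hab => ULift.ext _ _ (smul_left_injective ℝ (τ.ne_zero x) hab), fun w => ?_⟩
    obtain ⟨a, ha⟩ := L.toLineBundle.exists_smul_eq (τ.ne_zero x) w
    exact ⟨⟨a⟩, ha.symm⟩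
  refine ⟨.ofFrames (fun x => .ofBijective (F x) (hF x)) (fun {x y} g a => ?_) fun x => ?_⟩
  · change (a.down • τ.sec y : L.fib y) = L.act g (a.down • τ.sec x)
    rw [map_smul, τ.act_sec, h, Units.val_one, one_smul]
  · refine ⟨fun _ => (⟨1⟩ : ULift ℝ), contMDiffAt_trivial contMDiffAt_id contMDiffAt_const,
      fun h => one_ne_zero (congrArg ULift.down h), ?_⟩
    exact contMDiffAt_smul τ.smooth.contMDiffAt (contMDiffAt_const (c := (1 : ℝ)))

end Frames

end LineRep

/-! ### Frames over open covers -/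

theorem FrameAtlas.frame_ne_zero {n : ℕ} {M : Type u} [TopologicalSpace M]
    [ChartedSpace (EuclideanSpace ℝ (Fin n)) M] {fib : M → Type v} [∀ x, AddCommGroup (fib x)]
    [∀ x, Module ℝ (fib x)] (𝒜 : FrameAtlas n fib) {i x : M} (hx : x ∈ 𝒜.dom i) :
    𝒜.frame i x ≠ 0 := fun h =>
  zero_ne_one (by rw [← 𝒜.coord_frame i x hx, h, map_zero])

theorem LineBundle.smoothAt_frameAtlas_frame {n : ℕ} {M : Type u} [TopologicalSpace M]
    [ChartedSpace (EuclideanSpace ℝ (Fin n)) M] (L : LineBundle.{u, v} n M) {i x : M}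
    (hx : x ∈ L.frameAtlas.dom i) : L.SmoothAt (L.frameAtlas.frame i) x := by
  refine contMDiffAt_iff.2 ⟨contMDiffAt_id, ?_⟩
  have hbase := (L.frameAtlas.isOpen_dom x).mem_nhds (L.mem_base x)
  refine ((L.frameAtlas.smooth i x).contMDiffAt (Filter.inter_mem
    ((L.frameAtlas.isOpen_dom i).mem_nhds hx) hbase)).congr_of_eventuallyEq ?_
  filter_upwards [hbase] with y hy
  exact (L.coord_eq_crd hy _).symm

namespace LineRep

open LineBundle LieGroupoid

section CoverFrames

variable {n m : ℕ} {M : Type u} {G : Type w}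
  [TopologicalSpace M] [ChartedSpace (EuclideanSpace ℝ (Fin n)) M]
  [TopologicalSpace G] [ChartedSpace (EuclideanSpace ℝ (Fin m)) G]
  [IsManifold (𝓡 n) ∞ M] [IsManifold (𝓡 m) ∞ G] {𝒢 : LieGroupoid n m M G}
  {L L' : LineRep.{u, v} 𝒢} {𝒰 𝒱 : OpenCover M}

/-- The isomorphism expressing that restriction to a refinement `𝒱` of an open cover `𝒰` is
compatible with the pull-backs to the two covers. -/
def Iso.pullRefine (L : LineRep.{u, v} 𝒢) (r : 𝒱.carrier → 𝒰.carrier)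
    (hr : ∀ V, V.1 ≤ (r V).1) :
    Iso ((L.pull (𝒢.coverMap 𝒰)).pull (𝒢.refineMap r hr)) (L.pull (𝒢.coverMap 𝒱)) :=
  .ofFrames (fun p => LinearEquiv.refl ℝ (L.fib p.val)) (fun _ _ => rfl) fun p => by
    obtain ⟨σ, hσ, hσ₀⟩ := L.toLineBundle.exists_frame p.val
    have hσp := hσ.comp_of_eq (DisjUnion.contMDiff_val.contMDiffAt (x := p)) rfl
    have hσr := hσ.comp_of_eq
      (DisjUnion.contMDiff_val.contMDiffAt (x := (𝒢.refineMap r hr).base p)) rfl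
    exact ⟨fun q => σ q.val, smoothAt_pull (L := L.pull (𝒢.coverMap 𝒰))
      ((smoothAt_pull (L := L) (Φ := 𝒢.coverMap 𝒰) hσr).comp_of_eq
        (𝒢.refineMap r hr).base.contMDiff.contMDiffAt rfl), hσ₀,
      smoothAt_pull (L := L) (Φ := 𝒢.coverMap 𝒱) hσp⟩

namespace Frame

/-- The restriction of a frame over an open cover to a refinement. -/
def restrict (σ : (L.pull (𝒢.coverMap 𝒰)).Frame) (r : 𝒱.carrier → 𝒰.carrier)
    (hr : ∀ V, V.1 ≤ (r V).1) : (L.pull (𝒢.coverMap 𝒱)).Frame :=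
  (σ.pull (𝒢.refineMap r hr)).map (Iso.pullRefine L r hr)

theorem extClass_restrict (σ : (L.pull (𝒢.coverMap 𝒰)).Frame) (r : 𝒱.carrier → 𝒰.carrier)
    (hr : ∀ V, V.1 ≤ (r V).1) :
    (σ.restrict r hr).extClass = (𝒢.refineMap r hr).pullH1 𝓘(ℝ, ℝ) ℝˣ σ.extClass :=
  (extClass_map _ _).trans (σ.extClass_pull _)

theorem of_extClass_eq (F : Iso L L') (σ : (L.pull (𝒢.coverMap 𝒰)).Frame)
    (τ : (L'.pull (𝒢.coverMap 𝒱)).Frame) :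
    CechH1.of 𝒢 𝒰 σ.extClass = CechH1.of 𝒢 𝒱 τ.extClass := by
  obtain ⟨𝒲, h₁, h₂⟩ := exists_ge_ge 𝒰 𝒱
  obtain ⟨r, hr⟩ := exists_refine h₁
  obtain ⟨r', hr'⟩ := exists_refine h₂
  rw [← CechH1.of_pullH1 r hr, ← CechH1.of_pullH1 r' hr', ← extClass_restrict,
    ← extClass_restrict, ← (σ.restrict r hr).extClass_map (F.pull _)]
  exact congrArg _ (extClass_eq _ _)

/-- The frame over an open cover that is given by a local frame on each of its members. -/
def ofCover (s : 𝒰.carrier → ∀ x, L.fib x) (hs : ∀ U, ∀ x ∈ U.1, L.SmoothAt (s U) x)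
    (hs₀ : ∀ U, ∀ x ∈ U.1, s U x ≠ 0) : (L.pull (𝒢.coverMap 𝒰)).Frame where
  sec p := s p.idx p.val
  smooth p := by
    have hsp := (hs p.idx p.val p.val_mem).comp_of_eq
      (DisjUnion.contMDiff_val.contMDiffAt (x := p)) rfl
    refine smoothAt_pull (L := L) (Φ := 𝒢.coverMap 𝒰) (hsp.congr_of_eventuallyEq ?_)
    filter_upwards [DisjUnion.eventually_idx p] with q hq
    rw [hq]
    rfl
  ne_zero p := hs₀ p.idx p.val p.val_mem

theorem exists_descend (σ : (L.pull (𝒢.coverMap 𝒰)).Frame)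
    (h : ∀ (p q : 𝒰.Space) (hpq : p.val = q.val), σ.coeff (𝒢.copyArrow p q hpq).1 = 1) :
    ∃ τ : L.Frame, ∀ a : 𝒢.CoverArrows 𝒰, τ.coeff a.val = σ.coeff a := by
  obtain ⟨ψ, hψ, hψσ⟩ := DisjUnion.exists_contMDiff_comp_val σ.contMDiff_sec_pull
    𝒰.surjective_val (by
      rintro ⟨U, x, hU⟩ ⟨V, y, hV⟩ (rfl : x = y)
      have hact : L.act (𝒢.unit x) (σ.sec (.mk U x hU) : L.fib x) = _ :=
        σ.act_sec (𝒢.copyArrow (.mk U x hU) (.mk V x hV) rfl)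
      have hone : L.act (𝒢.unit x) (σ.sec (.mk U x hU) : L.fib x) =
          ((1 : ℝˣ) : ℝ) • (σ.sec (.mk V x hV) : L.fib x) :=
        hact.trans (congrArg (fun a : ℝˣ => (a : ℝ) • (σ.sec (.mk V x hV) : L.fib x))
          (h (.mk U x hU) (.mk V x hV) rfl))
      rw [L.act_unit, Units.val_one, one_smul] at hone
      exact congrArg (TotalSpace.mk' ℝ x) hone)
  have hexists : ∀ x, ∃ w : L.fib x, ψ x = TotalSpace.mk' ℝ x w :=
    𝒰.surjective_val.forall.2 fun p => ⟨σ.sec p, hψσ p⟩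
  choose s hs using hexists
  have hsσ : ∀ p : 𝒰.Space, s p.val = σ.sec p := fun p =>
    TotalSpace.mk_injective p.val ((hs p.val).symm.trans (hψσ p))
  let τ : L.Frame := ⟨s, funext hs ▸ hψ, 𝒰.surjective_val.forall.2 fun p h₀ =>
    σ.ne_zero p ((hsσ p).symm.trans h₀)⟩
  refine ⟨τ, fun a => τ.coeff_eq (𝒢.arrow a.val) ?_⟩
  exact (congrArg (L.act (𝒢.arrow a.val)) (hsσ ((𝒢.cover 𝒰).src a))).trans
    ((σ.act_sec ((𝒢.cover 𝒰).arrow a)).trans (congrArg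
      (fun w : L.fib (𝒢.tgt a.val) => (σ.coeff a : ℝ) • w) (hsσ ((𝒢.cover 𝒰).tgt a)).symm))

end Frame

theorem exists_coverFrame (L : LineRep.{u, v} 𝒢) :
    ∃ 𝒰 : OpenCover M, Nonempty (L.pull (𝒢.coverMap 𝒰)).Frame := by
  let dom : M → Opens M := fun i => ⟨_, L.frameAtlas.isOpen_dom i⟩
  let 𝒰 : OpenCover M := ⟨range dom, fun x => ⟨dom x, mem_range_self x, L.mem_base x⟩⟩
  choose i hi using fun U : 𝒰.carrier => U.2
  have hmem : ∀ U : 𝒰.carrier, ∀ x ∈ U.1, x ∈ L.frameAtlas.dom (i U) := fun U x hx => by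
    rw [← hi U] at hx
    exact hx
  exact ⟨𝒰, ⟨.ofCover (fun U => L.frameAtlas.frame (i U))
    (fun U x hx => L.smoothAt_frameAtlas_frame (hmem U x hx))
    fun U x hx => L.frameAtlas.frame_ne_zero (hmem U x hx)⟩⟩

/-- Averaging the logarithms of the transition functions of a frame amounts to choosing a metric on
the fibers, for which the frame is then normalized. -/
theorem exists_coverFrame_abs_coeff_copyArrow_eq_one [T2Space M] [SecondCountableTopology M]
    (L : LineRep.{u, v} 𝒢) :
    ∃ (𝒰 : OpenCover M) (σ : (L.pull (𝒢.coverMap 𝒰)).Frame),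
      ∀ (p q : 𝒰.Space) (h : p.val = q.val), |(σ.coeff (𝒢.copyArrow p q h).1 : ℝ)| = 1 := by
  obtain ⟨𝒰, ⟨σ⟩⟩ := L.exists_coverFrame
  obtain ⟨f, hf, hfσ⟩ := RealZ1.exists_sub_eq_apply_copyArrow (Z1.logAbs σ.cocycle)
  have hexp : ContMDiff (𝓡 n) 𝓘(ℝ, ℝ) ∞ fun p => expUnits (-f p) :=
    contMDiff_expUnits.comp (contDiff_neg.contMDiff.comp hf)
  refine ⟨𝒰, σ.scale _ hexp, fun p q h => ?_⟩
  have hsrc : (𝒢.cover 𝒰).src (𝒢.copyArrow p q h).1 = p := (𝒢.copyArrow p q h).2.1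
  have htgt : (𝒢.cover 𝒰).tgt (𝒢.copyArrow p q h).1 = q := (𝒢.copyArrow p q h).2.2
  have hlog : f p - f q = Real.log |(σ.coeff (𝒢.copyArrow p q h).1 : ℝ)| := hfσ p q h
  rw [Frame.coeff_scale, hsrc, htgt, ← AddChar.map_sub_eq_div, Units.val_mul, coe_expUnits, abs_mul,
    Real.abs_exp, neg_sub_neg, ← neg_sub, hlog, Real.exp_neg,
    Real.exp_log (abs_pos.2 (Units.ne_zero _)), mul_inv_cancel₀ (abs_ne_zero.2 (Units.ne_zero _))]

theorem nonempty_frame_tensor_self [T2Space M] [SecondCountableTopology M] (L : LineRep.{u, v} 𝒢) :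
    Nonempty (L.tensor L).Frame := by
  obtain ⟨𝒰, σ, hσ⟩ := L.exists_coverFrame_abs_coeff_copyArrow_eq_one
  obtain ⟨τ, -⟩ := ((σ.tensor σ).map (Iso.pullTensor L L (𝒢.coverMap 𝒰))).exists_descend
    fun p q h => by
      rw [Frame.coeff_map, Frame.coeff_tensor]
      refine Units.ext ?_
      rw [Units.val_mul, ← abs_mul_abs_self, hσ p q h, _root_.one_mul, Units.val_one]
  exact ⟨τ⟩

end CoverFrames

end LineRep

/-! ### The representation glued from a cocycle -/

namespace FrameAtlas

variable {n : ℕ} {M : Type u} [TopologicalSpace M] [ChartedSpace (EuclideanSpace ℝ (Fin n)) M]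
  {fib : M → Type v} [∀ x, AddCommGroup (fib x)] [∀ x, Module ℝ (fib x)] {𝒜 : FrameAtlas n fib}

theorem smoothAt_lineBundle_iff {σ : ∀ x, fib x} {x : M} :
    𝒜.lineBundle.SmoothAt σ x ↔
      ContMDiffAt (𝓡 n) 𝓘(ℝ, ℝ) ∞ (fun y => 𝒜.coord x y (σ y)) x :=
  (LineBundle.contMDiffAt_iff (L := 𝒜.lineBundle)).trans (and_iff_right contMDiffAt_id)

end FrameAtlas

namespace LieGroupoid

section Gluing

variable {n m : ℕ} {M : Type u} {G : Type w}
  [TopologicalSpace M] [ChartedSpace (EuclideanSpace ℝ (Fin n)) M] [IsManifold (𝓡 n) ∞ M]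
  [TopologicalSpace G] [ChartedSpace (EuclideanSpace ℝ (Fin m)) G] [IsManifold (𝓡 m) ∞ G]
  {𝒢 : LieGroupoid n m M G} {𝒰 : OpenCover M} (c : (𝒢.cover 𝒰).Z1 𝓘(ℝ, ℝ) ℝˣ)

/-- The factor by which the arrow `g` acts on the line bundle glued from a cocycle: the value of the
cocycle on the lift of `g` to the chosen copies of its source and its target. -/
def Z1.gluedAct {x y : M} (g : 𝒢.Arrow x y) : ℝˣ :=
  c.1 (liftArrow g (𝒰.point x) (𝒰.point y) (𝒰.val_point x) (𝒰.val_point y)).1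

/-- The local frame over `U` of the line bundle glued from a cocycle, whose fibers are all `ℝ`: the
value of the cocycle on the arrow from the copy of `x` in `U` to the chosen copy of `x`. -/
def Z1.gluedFrame (U : 𝒰.carrier) (x : M) : ℝˣ :=
  DisjUnion.extend c.1 1 (U, (𝒰.point x).idx) (𝒢.one x)

theorem Z1.gluedAct_unit (x : M) : Z1.gluedAct c (𝒢.unit x) = 1 := by
  have h := eq_liftArrow ((𝒢.cover 𝒰).unit (𝒰.point x)) (𝒢.unit x) (𝒰.val_point x)
    (𝒰.val_point x) (congrArg 𝒢.one (𝒰.val_point x))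
  exact (congrArg (fun a => c.1 a.1) h.symm).trans (Z1.apply_unit c _)

theorem Z1.gluedAct_comp {x y z : M} (g : 𝒢.Arrow y z) (h : 𝒢.Arrow x y) :
    Z1.gluedAct c (g.comp h) = Z1.gluedAct c g * Z1.gluedAct c h := by
  rw [gluedAct, gluedAct, gluedAct, ← Z1.apply_comp, liftArrow_comp_liftArrow]

theorem Z1.gluedAct_mul_gluedFrame {x y : M} (g : 𝒢.Arrow x y) (p q : 𝒰.Space) (hp : p.val = x)
    (hq : q.val = y) :
    Z1.gluedAct c g * Z1.gluedFrame c p.idx x =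
      c.1 (liftArrow g p q hp hq).1 * Z1.gluedFrame c q.idx y := by
  rw [gluedAct, gluedFrame, gluedFrame, extend_one c.1 1 p _ hp (𝒰.val_point x),
    extend_one c.1 1 q _ hq (𝒰.val_point y), mul_comm (c.1 (liftArrow g p q hp hq).1),
    ← Z1.apply_comp, ← Z1.apply_comp, copyArrow_comp_liftArrow g p q _ hp hq (𝒰.val_point y),
    liftArrow_comp_copyArrow g _ p _ (𝒰.val_point x) hp (𝒰.val_point y)]

theorem Z1.gluedFrame_eq_mul {U V : 𝒰.carrier} {x : M} (hU : x ∈ U.1) (hV : x ∈ V.1) :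
    Z1.gluedFrame c U x = DisjUnion.extend c.1 1 (U, V) (𝒢.one x) * Z1.gluedFrame c V x := by
  have h := Z1.gluedAct_mul_gluedFrame c (𝒢.unit x) (.mk U x hU) (.mk V x hV) rfl rfl
  rw [gluedAct_unit, _root_.one_mul] at h
  exact h.trans (congrArg (· * _) (extend_one c.1 1 (.mk U x hU) (.mk V x hV) rfl rfl).symm)

theorem Z1.contMDiffAt_inv_gluedFrame_mul {U V : 𝒰.carrier} {x : M} (hU : x ∈ U.1)
    (hV : x ∈ V.1) : ContMDiffAt (𝓡 n) 𝓘(ℝ, ℝ) ∞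
      (fun x => (((Z1.gluedFrame c V x)⁻¹ * Z1.gluedFrame c U x : ℝˣ) : ℝ)) x := by
  refine ((Units.contMDiff_val (n := ∞) _).comp x
    (contMDiffAt_extend_one c.2.1 1 hU hV)).congr_of_eventuallyEq ?_
  filter_upwards [U.1.isOpen.mem_nhds hU, V.1.isOpen.mem_nhds hV] with y hyU hyV
  rw [Z1.gluedFrame_eq_mul c hyU hyV, mul_comm (DisjUnion.extend _ _ _ _), inv_mul_cancel_left]
  rfl

/-- The local frames of the line bundle glued from a cocycle. -/
def Z1.gluedAtlas : FrameAtlas n (fun _ : M => ULift.{v} ℝ) where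
  dom i := (𝒰.point i).idx.1
  isOpen_dom i := (𝒰.point i).idx.1.isOpen
  mem_dom := 𝒰.mem_point_idx
  frame i x := ⟨Z1.gluedFrame c (𝒰.point i).idx x⟩
  coord i x := ((Z1.gluedFrame c (𝒰.point i).idx x)⁻¹ : ℝˣ) • ULift.moduleEquiv.toLinearMap
  coord_frame i x _ := (Z1.gluedFrame c (𝒰.point i).idx x).inv_mul
  coord_smul_frame i x _ w := ULift.ext _ _
    ((mul_right_comm _ _ _).trans (by rw [Units.inv_mul, _root_.one_mul]; rfl))
  smooth _ _ _ hx := (Z1.contMDiffAt_inv_gluedFrame_mul c hx.1 hx.2).contMDiffWithinAt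

theorem Z1.smoothAt_gluedFrame {U : 𝒰.carrier} {x : M} (hU : x ∈ U.1) :
    (Z1.gluedAtlas.{u, v} c).lineBundle.SmoothAt
      (fun x => (⟨Z1.gluedFrame c U x⟩ : ULift.{v} ℝ)) x :=
  FrameAtlas.smoothAt_lineBundle_iff.2
    (Z1.contMDiffAt_inv_gluedFrame_mul c hU (𝒰.mem_point_idx x))

/-- The action of an arrow on the line bundle glued from a cocycle. -/
def Z1.gluedActHom {x y : M} (g : 𝒢.Arrow x y) : ULift.{v} ℝ →ₗ[ℝ] ULift.{v} ℝ :=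
  (Z1.gluedAct c g : ℝ) • LinearMap.id

theorem Z1.gluedActHom_gluedFrame {x y : M} (g : 𝒢.Arrow x y) (p q : 𝒰.Space) (hp : p.val = x)
    (hq : q.val = y) :
    Z1.gluedActHom.{u, v} c g ⟨Z1.gluedFrame c p.idx x⟩ =
      (c.1 (liftArrow g p q hp hq).1 : ℝ) • (⟨Z1.gluedFrame c q.idx y⟩ : ULift.{v} ℝ) :=
  ULift.ext _ _ (congrArg Units.val (Z1.gluedAct_mul_gluedFrame c g p q hp hq))

theorem Z1.contMDiff_gluedActHom :
    ContMDiff ((𝓡 m).prod 𝓘(ℝ, ℝ)) ((𝓡 n).prod 𝓘(ℝ, ℝ)) ∞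
      (fun p : TotalSpace ℝ ((Z1.gluedAtlas.{u, v} c).lineBundle.pull 𝒢.src).fib =>
        TotalSpace.mk' ℝ (E := (Z1.gluedAtlas.{u, v} c).lineBundle.fib) (𝒢.tgt p.1)
          (Z1.gluedActHom c (𝒢.arrow p.1) p.2)) := by
  refine LineRep.contMDiff_act_of_frames (Z1.gluedAtlas c).lineBundle (Z1.gluedActHom c)
    fun g => ?_
  set U := (𝒰.point (𝒢.src g)).idx
  set V := (𝒰.point (𝒢.tgt g)).idx
  have hU : 𝒢.src g ∈ U.1 := 𝒰.mem_point_idx _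
  have hV : 𝒢.tgt g ∈ V.1 := 𝒰.mem_point_idx _
  refine ⟨_, Z1.smoothAt_gluedFrame c hU,
    fun h => (Z1.gluedFrame c U _).ne_zero (congrArg ULift.down h), ?_⟩
  have hext := DisjUnion.contMDiffAt_extend c.2.1 1 (i := (U, V)) (x := g) ⟨hU, hV⟩
  refine (LineBundle.contMDiffAt_smul
    ((Z1.smoothAt_gluedFrame c hV).comp_of_eq 𝒢.tgt.contMDiff.contMDiffAt rfl)
    ((Units.contMDiff_val (n := ∞) _).comp g hext)).congr_of_eventuallyEq ?_
  filter_upwards [(𝒢.arrowOpens U.1 V.1).isOpen.mem_nhds ⟨hU, hV⟩] with g' hg'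
  exact congrArg (TotalSpace.mk' ℝ _) ((Z1.gluedActHom_gluedFrame c (𝒢.arrow g')
    (.mk U _ hg'.1) (.mk V _ hg'.2) rfl rfl).trans (congrArg
      (fun a : ℝˣ => (a : ℝ) • (⟨Z1.gluedFrame c V (𝒢.tgt g')⟩ : ULift.{v} ℝ))
      (DisjUnion.extend_of_mem c.1 1 hg').symm))

end Gluing

end LieGroupoid

namespace LineRep

open LieGroupoid

section Gluing

variable {n m : ℕ} {M : Type u} {G : Type w}
  [TopologicalSpace M] [ChartedSpace (EuclideanSpace ℝ (Fin n)) M] [IsManifold (𝓡 n) ∞ M]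
  [TopologicalSpace G] [ChartedSpace (EuclideanSpace ℝ (Fin m)) G] [IsManifold (𝓡 m) ∞ G]
  {𝒢 : LieGroupoid n m M G} {𝒰 : OpenCover M} (c : (𝒢.cover 𝒰).Z1 𝓘(ℝ, ℝ) ℝˣ)

/-- The representation glued from a cocycle over an open cover. -/
def glued : LineRep.{u, v} 𝒢 where
  toLineBundle := (Z1.gluedAtlas c).lineBundle
  act g := Z1.gluedActHom c g
  act_unit x := by
    rw [Z1.gluedActHom, Z1.gluedAct_unit]
    exact one_smul ℝ (LinearMap.id : ULift.{v} ℝ →ₗ[ℝ] ULift.{v} ℝ)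
  act_comp g h := by
    rw [Z1.gluedActHom, Z1.gluedAct_comp]
    exact LinearMap.ext fun w : ULift.{v} ℝ =>
      mul_smul (Z1.gluedAct c g : ℝ) (Z1.gluedAct c h : ℝ) w
  contMDiff_act := Z1.contMDiff_gluedActHom c

/-- The frame over the open cover of the representation glued from a cocycle. -/
def gluedCoverFrame : ((glued.{u, v} c).pull (𝒢.coverMap 𝒰)).Frame :=
  .ofCover (L := glued.{u, v} c) (fun U x => (⟨Z1.gluedFrame c U x⟩ : ULift.{v} ℝ))
    (fun _ _ => Z1.smoothAt_gluedFrame c)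
    fun U x _ h => (Z1.gluedFrame c U x).ne_zero (congrArg ULift.down h)

theorem extClass_gluedCoverFrame : (gluedCoverFrame.{u, v} c).extClass = QuotientGroup.mk c := by
  refine congrArg QuotientGroup.mk (Subtype.ext (funext fun a => ?_))
  refine (gluedCoverFrame.{u, v} c).coeff_eq ((𝒢.cover 𝒰).arrow a) ?_
  exact Z1.gluedActHom_gluedFrame c (𝒢.arrow a.val) ((𝒢.cover 𝒰).src a) ((𝒢.cover 𝒰).tgt a) rfl rfl

end Gluing

end LineRep

/-! ### The classes of a representation -/

namespace LineRep

open LieGroupoid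

section Classes

variable {n m : ℕ} {M : Type u} {G : Type w}
  [TopologicalSpace M] [ChartedSpace (EuclideanSpace ℝ (Fin n)) M] [IsManifold (𝓡 n) ∞ M]
  [TopologicalSpace G] [ChartedSpace (EuclideanSpace ℝ (Fin m)) G] [IsManifold (𝓡 m) ∞ G]
  {𝒢 : LieGroupoid n m M G} {𝒰 : OpenCover M}

/-- The Čech-type class `θc(L)` of a representation, computed with an arbitrary choice of a cover
and of a frame over it. -/
def cechClass (L : LineRep.{u, v} 𝒢) : 𝒢.CechH1 𝓘(ℝ, ℝ) ℝˣ :=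
  CechH1.of 𝒢 L.exists_coverFrame.choose L.exists_coverFrame.choose_spec.some.extClass

theorem Iso.cechClass_eq {L L' : LineRep.{u, v} 𝒢} (F : Iso L L')
    (σ : (L'.pull (𝒢.coverMap 𝒰)).Frame) : L.cechClass = CechH1.of 𝒢 𝒰 σ.extClass :=
  Frame.of_extClass_eq F _ _

theorem Frame.cechClass_eq {L : LineRep.{u, v} 𝒢} (σ : (L.pull (𝒢.coverMap 𝒰)).Frame) :
    L.cechClass = CechH1.of 𝒢 𝒰 σ.extClass :=
  (Setoid.refl L : Nonempty (Iso L L)).some.cechClass_eq σ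

theorem cechClass_tensor (L L' : LineRep.{u, v} 𝒢) :
    (L.tensor L').cechClass = L.cechClass * L'.cechClass := by
  obtain ⟨𝒰, ⟨σ⟩⟩ := L.exists_coverFrame
  obtain ⟨𝒱, ⟨τ⟩⟩ := L'.exists_coverFrame
  obtain ⟨𝒲, h₁, h₂⟩ := exists_ge_ge 𝒰 𝒱
  obtain ⟨r, hr⟩ := exists_refine h₁
  obtain ⟨r', hr'⟩ := exists_refine h₂
  let σ' := σ.restrict r hr
  let τ' := τ.restrict r' hr'
  rw [((σ'.tensor τ').map (Iso.pullTensor L L' (𝒢.coverMap 𝒲))).cechClass_eq, σ'.cechClass_eq,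
    τ'.cechClass_eq, Frame.extClass_map, Frame.extClass_tensor, CechH1.of_mul]

/-- The homomorphism `θc` on isomorphism classes of representations. -/
def rep1ToCech (𝒢 : LieGroupoid n m M G) : Rep1.{u, v, w} 𝒢 →* 𝒢.CechH1 𝓘(ℝ, ℝ) ℝˣ :=
  MonoidHom.mk'
    (Quotient.lift cechClass fun _ _ (h : Nonempty (Iso _ _)) => h.some.cechClass_eq _)
    (Quotient.ind₂ cechClass_tensor)

theorem Frame.nonempty_trivial_iso_of_extClass_eq_one {L : LineRep.{u, v} 𝒢}
    (σ : (L.pull (𝒢.coverMap 𝒰)).Frame) (hσ : σ.extClass = 1) :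
    Nonempty (Iso (trivial 𝒢) L) := by
  obtain ⟨f, hf, hfσ⟩ := (QuotientGroup.eq_one_iff _).1 hσ
  replace hfσ : ∀ a, σ.coeff a = f ((𝒢.cover 𝒰).src a) / f ((𝒢.cover 𝒰).tgt a) := hfσ
  have hone : ∀ a, (σ.scale f⁻¹ hf.inv).coeff a = 1 := fun a => by
    rw [coeff_scale, hfσ, Pi.inv_apply, Pi.inv_apply, inv_div_inv, div_mul_div_cancel, div_self']
  obtain ⟨τ, hτ⟩ := (σ.scale f⁻¹ hf.inv).exists_descend fun _ _ _ => hone _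
  exact τ.nonempty_trivial_iso_of_coeff_eq_one
    ((surjective_val_coverArrows 𝒢 𝒰).forall.2 fun a => (hτ a).trans (hone a))

theorem rep1ToCech_injective (𝒢 : LieGroupoid n m M G) :
    Function.Injective (rep1ToCech.{u, v} 𝒢) := by
  refine (injective_iff_map_eq_one _).2 (Quotient.ind fun L hL => ?_)
  obtain ⟨𝒰, ⟨σ⟩⟩ := L.exists_coverFrame
  obtain ⟨𝒱, h, hσ⟩ := CechH1.of_eq_one_iff.1 (σ.cechClass_eq.symm.trans hL)
  rw [resH1, ← Frame.extClass_restrict] at hσ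
  exact (Quotient.sound (Frame.nonempty_trivial_iso_of_extClass_eq_one _ hσ)).symm

theorem rep1ToCech_surjective (𝒢 : LieGroupoid n m M G) :
    Function.Surjective (rep1ToCech.{u, v} 𝒢) := fun x => by
  obtain ⟨𝒰, x, rfl⟩ := CechH1.exists_of x
  induction x using QuotientGroup.induction_on with | _ c
  exact ⟨⟦glued c⟧, by
    rw [← extClass_gluedCoverFrame]
    exact (gluedCoverFrame c).cechClass_eq⟩

/-- The isomorphism `θc` of the group of representations with Čech-type cohomology. -/
def rep1EquivCech (𝒢 : LieGroupoid n m M G) : Rep1.{u, v, w} 𝒢 ≃* 𝒢.CechH1 𝓘(ℝ, ℝ) ℝˣ :=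
  .ofBijective (rep1ToCech 𝒢) ⟨rep1ToCech_injective 𝒢, rep1ToCech_surjective 𝒢⟩

theorem Frame.rep1EquivCech_mk {L : LineRep.{u, v} 𝒢} (σ : (L.pull (𝒢.coverMap 𝒰)).Frame) :
    rep1EquivCech 𝒢 ⟦L⟧ = CechH1.of 𝒢 𝒰 σ.extClass :=
  σ.cechClass_eq

variable [T2Space M] [SecondCountableTopology M]

/-- The characteristic class `θ` on isomorphism classes of representations, defined as the real
component of `Φ ∘ θc`. -/
def charClass (x : Rep1.{u, v, w} 𝒢) : 𝒢.RealH1 :=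
  (𝒢.cechSplitting (rep1EquivCech 𝒢 x)).1.toAdd

/-- The sign class `w` on isomorphism classes of representations, defined as the `ℤ₂`-component of
`Φ ∘ θc`. -/
def signClass (x : Rep1.{u, v, w} 𝒢) : 𝒢.CechH1 (𝓡 0) ℤˣ :=
  (𝒢.cechSplitting (rep1EquivCech 𝒢 x)).2

theorem Frame.charClass_mk {L : LineRep.{u, v} 𝒢} (σ : L.Frame) :
    charClass (⟦L⟧ : Rep1.{u, v, w} 𝒢) = (H1.logAbs σ.extClass).toAdd := by
  obtain ⟨𝒰⟩ : Nonempty (OpenCover M) := inferInstance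
  refine 𝒢.pullRealH1_coverMap_injective 𝒰 ?_
  rw [charClass, (σ.pull (𝒢.coverMap 𝒰)).rep1EquivCech_mk, pullRealH1_cechSplitting_of,
    σ.extClass_pull, H1.logAbs_pullH1]

theorem charClass_mul (x y : Rep1.{u, v, w} 𝒢) :
    charClass (x * y) = charClass x + charClass y := by
  rw [charClass, map_mul, map_mul, Prod.fst_mul, toAdd_mul, charClass, charClass]

theorem charClass_eq_half_smul_charClass_tensor_self (L : LineRep.{u, v} 𝒢) :
    charClass (⟦L⟧ : Rep1.{u, v, w} 𝒢) = (1 / 2 : ℝ) • charClass ⟦L.tensor L⟧ := by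
  rw [mk_tensor, charClass_mul, ← two_smul ℝ, smul_smul, one_div_mul_cancel two_ne_zero, one_smul]

theorem Frame.signClass_mk {L : LineRep.{u, v} 𝒢} (σ : (L.pull (𝒢.coverMap 𝒰)).Frame) :
    signClass (⟦L⟧ : Rep1.{u, v, w} 𝒢) = CechH1.of 𝒢 𝒰 (H1.sign σ.extClass) := by
  rw [signClass, σ.rep1EquivCech_mk, cechSplitting_of_snd]

end Classes

end LineRep

end

theorem mainTheorem8 {n m : ℕ} {M : Type u} {G : Type w}
    [TopologicalSpace M] [ChartedSpace (EuclideanSpace ℝ (Fin n)) M] [IsManifold (𝓡 n) ∞ M]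
    [T2Space M] [SecondCountableTopology M]
    [TopologicalSpace G] [ChartedSpace (EuclideanSpace ℝ (Fin m)) G] [IsManifold (𝓡 m) ∞ G]
    (𝒢 : LieGroupoid n m M G) :
    -- the pull-back along an open cover induces an isomorphism in real cohomology
    (∀ 𝒰 : OpenCover M, Function.Bijective (𝒢.coverMap 𝒰).pullRealH1) ∧
    -- any `L` becomes trivializable over some open cover, and `L ⊗ L` is trivializable
    (∀ L : LineRep.{u, v, w} 𝒢, ∃ 𝒰 : OpenCover M, Nonempty (L.pull (𝒢.coverMap 𝒰)).Frame) ∧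
    (∀ L : LineRep.{u, v, w} 𝒢, Nonempty (L.tensor L).Frame) ∧
    ∃ (θc : LieGroupoid.Rep1.{u, v, w} 𝒢 ≃* 𝒢.CechH1 𝓘(ℝ, ℝ) ℝˣ)
      (Φ : 𝒢.CechH1 𝓘(ℝ, ℝ) ℝˣ ≃* Multiplicative 𝒢.RealH1 × 𝒢.CechH1 (𝓡 0) ℤˣ)
      (θ : LieGroupoid.Rep1.{u, v, w} 𝒢 → 𝒢.RealH1)
      (sw : LieGroupoid.Rep1.{u, v, w} 𝒢 → 𝒢.CechH1 (𝓡 0) ℤˣ),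
      -- `θc` and `sw` are the classes of the cocycles of `L` over covers that trivialize `L`
      (∀ (L : LineRep.{u, v, w} 𝒢) (𝒰 : OpenCover M) (σ : (L.pull (𝒢.coverMap 𝒰)).Frame),
        θc ⟦L⟧ = LieGroupoid.CechH1.of 𝒢 𝒰 σ.extClass ∧
        sw ⟦L⟧ = LieGroupoid.CechH1.of 𝒢 𝒰 (LieGroupoid.H1.sign σ.extClass)) ∧
      -- `θ` is the characteristic class
      (∀ (L : LineRep.{u, v, w} 𝒢) (σ : L.Frame),
        θ ⟦L⟧ = (LieGroupoid.H1.logAbs σ.extClass).toAdd) ∧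
      (∀ L : LineRep.{u, v, w} 𝒢, θ ⟦L⟧ = (1 / 2 : ℝ) • θ ⟦L.tensor L⟧) ∧
      -- `Φ` is induced by `λ ↦ (ln |λ|, sign λ)` and the isomorphisms in real cohomology
      (∀ (𝒰 : OpenCover M) (x : (𝒢.cover 𝒰).H1 𝓘(ℝ, ℝ) ℝˣ),
        (𝒢.coverMap 𝒰).pullRealH1 (Φ (LieGroupoid.CechH1.of 𝒢 𝒰 x)).1.toAdd =
          (LieGroupoid.H1.logAbs x).toAdd ∧
        (Φ (LieGroupoid.CechH1.of 𝒢 𝒰 x)).2 =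
          LieGroupoid.CechH1.of 𝒢 𝒰 (LieGroupoid.H1.sign x)) ∧
      -- the value of `θc` in terms of the splitting
      ∀ L : LineRep.{u, v, w} 𝒢, Φ (θc ⟦L⟧) = (Multiplicative.ofAdd (θ ⟦L⟧), sw ⟦L⟧) :=
  ⟨LieGroupoid.pullRealH1_coverMap_bijective 𝒢, LineRep.exists_coverFrame,
    LineRep.nonempty_frame_tensor_self, LineRep.rep1EquivCech 𝒢, 𝒢.cechSplitting,
    LineRep.charClass, LineRep.signClass,
    fun _ _ σ => ⟨σ.rep1EquivCech_mk, σ.signClass_mk⟩,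
    fun _ σ => σ.charClass_mk,
    LineRep.charClass_eq_half_smul_charClass_tensor_self,
    fun _ x => ⟨LieGroupoid.pullRealH1_cechSplitting_of x, LieGroupoid.cechSplitting_of_snd x⟩,
    fun _ => rfl⟩
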